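/- Let $k$ be a field. A finite-dimensional $k$-algebra $A$ is elementary if $A/\operatorname{rad}A\cong k^r$ as $k$-algebras for some $r$. Bimodules are $k$-central. For finite-dimensional elementary algebras $A$, $B$ with complete sets of orthogonal primitive idempotents $\{e_1,\dots,e_n\}$ and $\{f_1,\dots,f_m\}$, the dimension matrix of a finite-dimensional $B$-$A$-bimodule $V$ is the integer $n\times m$ matrix $\operatorname{dm}V=(\dim_k f_jVe_i)_{ij}$, and the Cartan matrix of $A$ is the $n\times n$ matrix $C_A=(\dim_k e_jAe_i)_{ij}$. For a complex $X$ of bimodules that is bounded with finite-dimensional terms, $\operatorname{dm}X=\sum_{l\in\mathbb Z}(-1)^l\operatorname{dm}X^l$; for a complex $X$ of bimodules whose total cohomology is finite-dimensional, $\operatorname{dm}X=\sum_{l\in\mathbb Z}(-1)^l\operatorname{dm}H^l(X)$. **Theorem.** Let $A$, $B$, $C$ be finite-dimensional elementary $k$-algebras with $A$ of finite global dimension, and let $\{e_1,\dots,e_n\}$, $\{f_1,\dots,f_m\}$, $\{g_1,\dots,g_p\}$ be complete sets of orthogonal primitive idempotents of $A$, $B$, $C$ respectively. Then $C_A$ is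 invertible over $\mathbb Z$, and: (1) For all bounded complexes $M$ of finite-dimensional $B$-$A$-bimodules and $N$ of finite-dimensional $C$-$A$-bimodules, the complex of $C$-$B$-bimodules $\mathbf R\mathrm{Hom}_A(M,N)$ has finite-dimensional total cohomology, and $$\operatorname{dm}\mathbf R\mathrm{Hom}_A(M,N)=\sum_{l\in\mathbb Z}(-1)^l\operatorname{dm}\operatorname{Ext}^l_A(M,N)=(\operatorname{dm}M)^T\,C_A^{-T}\,\operatorname{dm}N .$$ (2) For all bounded complexes $M$ of finite-dimensional $B$-$A$-bimodules and $N$ of finite-dimensional $A$-$C$-bimodules, the complex of $B$-$C$-bimodules $M\otimes^{\mathbf L}_AN$ has finite-dimensional total cohomology, and $$\operatorname{dm}(M\otimes^{\mathbf L}_AN)=\sum_{l\in\mathbb Z}(-1)^l\operatorname{dm}\operatorname{Tor}^A_l(M,N)=\operatorname{dm}N\; C_A^{-1}\,\operatorname{dm}M .$$ Here $\mathbf R\mathrm{Hom}_A(M,N)=\mathrm{Hom}_A(P,N)$ and $M\otimes^{\mathbf L}_AN=P\otimes_AN$ for any homotopically projective resolution $P\to M$ of complexes of $B$-$A$-bimodules.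 -/

import Mathlib

universe u

noncomputable section

namespace BimoduleHRR

open CategoryTheory MulOpposite
open scoped TensorProduct ModuleCat
set_option linter.unusedVariables false
/-! ### Algebras -/

/-- `A / rad A` is isomorphic to a finite direct product of copies of `k`. -/
def IsElementary (k A : Type u) [Field k] [Ring A] [Algebra k A] : Prop :=
  ∃ n : ℕ, Nonempty ((A ⧸ Ring.jacobson A) ≃ₐ[k] (Fin n → k))

/-- Finite global dimension: the projective dimensions of all right modules are bounded. -/
def HasFiniteGlobalDimension (A : Type u) [Ring A] : Prop :=
  ∃ d : ℕ, ∀ X : ModuleCat.{u} Aᵐᵒᵖ, HasProjectiveDimensionLE X d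

/-- A primitive idempotent: nonzero, and not a sum of two nonzero orthogonal idempotents. -/
def IsPrimitiveIdempotent {A : Type u} [Ring A] (a : A) : Prop :=
  IsIdempotentElem a ∧ a ≠ 0 ∧
    ∀ x y : A, IsIdempotentElem x → IsIdempotentElem y → x * y = 0 → y * x = 0 →
      x + y = a → x = 0 ∨ y = 0

/-- A complete set of (pairwise) orthogonal primitive idempotents `e₁, …, eₙ` of `A`. -/
def IsCompletePrimitiveSet {A : Type u} [Ring A] {n : ℕ} (e : Fin n → A) : Prop :=
  CompleteOrthogonalIdempotents e ∧ ∀ i, IsPrimitiveIdempotent (e i)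

/-- The Cartan matrix `C_A`, with entries `c_{ij} = dim (e_j A e_i)`. -/
def cartanMatrix (k : Type u) {A : Type u} [Field k] [Ring A] [Algebra k A] {n : ℕ}
    (e : Fin n → A) : Matrix (Fin n) (Fin n) ℤ :=
  fun i j => (Module.finrank k
    (LinearMap.range (LinearMap.mulLeft k (e j) ∘ₗ LinearMap.mulRight k (e i))) : ℤ)

/-! ### Bimodules and their dimension matrices -/

variable (k : Type u) [Field k]
variable (A B C : Type u) [Ring A] [Algebra k A] [Ring B] [Algebra k B] [Ring C] [Algebra k C]

/-- `Bimod k A B` is the category of `B`-`A`-bimodules (left action of `B`, right action of `A`, with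
`k` acting centrally), that is, of left modules over `B ⊗ Aᵒᵖ`. -/
abbrev Bimod : Type (u + 1) := ModuleCat.{u} (B ⊗[k] Aᵐᵒᵖ)

variable {k A B C}

/-- The dimension matrix of a `B`-`A`-bimodule `V`, with entries `c_{ij} = dim (f_j V e_i)`. -/
def dimMatrix {n m : ℕ} (f : Fin m → B) (e : Fin n → A) (V : Bimod k A B) :
    Matrix (Fin n) (Fin m) ℤ :=
  fun i j => (Module.finrank k
    (LinearMap.range (Algebra.lsmul k k V (f j ⊗ₜ[k] op (e i)))) : ℤ)

/-- A bounded complex of finite dimensional bimodules. -/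
def IsBoundedFiniteDimensional (M : CochainComplex (Bimod k A B) ℤ) : Prop :=
  (∃ a b : ℤ, M.IsStrictlyGE a ∧ M.IsStrictlyLE b) ∧ ∀ l, FiniteDimensional k (M.X l)

/-- The super dimension matrix `∑ (-1)^l dm M^l` of a complex of bimodules. -/
def superDimMatrix {n m : ℕ} (f : Fin m → B) (e : Fin n → A)
    (M : CochainComplex (Bimod k A B) ℤ) : Matrix (Fin n) (Fin m) ℤ :=
  ∑ᶠ l : ℤ, (l.negOnePow : ℤ) • dimMatrix f e (M.X l)

/-- The total cohomology is finite dimensional. -/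
def IsCohomologicallyFinite (X : CochainComplex (Bimod k A B) ℤ) : Prop :=
  (∀ l, FiniteDimensional k (X.homology l)) ∧ {l : ℤ | ¬ Limits.IsZero (X.homology l)}.Finite

/-- The super dimension matrix `∑ (-1)^l dm H^l(X)` of a cohomologically finite dimensional
complex of bimodules. -/
def cohomologyDimMatrix {n m : ℕ} (f : Fin m → B) (e : Fin n → A)
    (X : CochainComplex (Bimod k A B) ℤ) : Matrix (Fin n) (Fin m) ℤ :=
  ∑ᶠ l : ℤ, (l.negOnePow : ℤ) • dimMatrix f e (X.homology l)

/-- A homotopically projective (K-projective) resolution of a complex of bimodules. -/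
structure HProjResolution (M : CochainComplex (Bimod k A B) ℤ) where
  /-- the resolving complex of bimodules -/
  complex : CochainComplex (Bimod k A B) ℤ
  isKProjective : complex.IsKProjective
  /-- the augmentation -/
  π : complex ⟶ M
  quasiIso : QuasiIso π

/-! ### The complex of bimodules `Hom_A(P, N)` -/

/-- The right `A`-module underlying a `B`-`A`-bimodule. -/
abbrev rightRestrict (k A B : Type u) [Field k] [Ring A] [Algebra k A] [Ring B] [Algebra k B] :
    Bimod k A B ⥤ ModuleCat.{u} Aᵐᵒᵖ :=
  ModuleCat.restrictScalars
    (Algebra.TensorProduct.includeRight : Aᵐᵒᵖ →ₐ[k] B ⊗[k] Aᵐᵒᵖ).toRingHom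

/-- The complex of right `A`-modules underlying a complex of `B`-`A`-bimodules. -/
abbrev rightComplex (M : CochainComplex (Bimod k A B) ℤ) :
    CochainComplex (ModuleCat.{u} Aᵐᵒᵖ) ℤ :=
  ((rightRestrict k A B).mapHomologicalComplex _).obj M

/-- The action of `b : B` on a complex of `B`-`A`-bimodules, as an endomorphism of the underlying
complex of right `A`-modules. -/
def leftMul (M : CochainComplex (Bimod k A B) ℤ) (b : B) : rightComplex M ⟶ rightComplex M where
  f i := ModuleCat.ofHom
    (X := (rightRestrict k A B).obj (M.X i)) (Y := (rightRestrict k A B).obj (M.X i))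
    { toFun := fun x => ((b ⊗ₜ[k] (1 : Aᵐᵒᵖ) • (show M.X i from x) : M.X i))
      map_add' := fun x y => smul_add (b ⊗ₜ[k] (1 : Aᵐᵒᵖ)) (show M.X i from x) (show M.X i from y)
      map_smul' := fun a x => by
        change b ⊗ₜ[k] (1 : Aᵐᵒᵖ) • ((1 : B) ⊗ₜ[k] a • (show M.X i from x)) =
          (1 : B) ⊗ₜ[k] a • (b ⊗ₜ[k] (1 : Aᵐᵒᵖ) • (show M.X i from x))
        rw [← mul_smul, ← mul_smul]
        simp }
  comm' i j _ := ModuleCat.hom_ext (LinearMap.ext fun x =>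
    ((M.d i j).hom.map_smul (b ⊗ₜ[k] (1 : Aᵐᵒᵖ)) (show M.X i from x)))

open CochainComplex HomComplex

lemma leftMul_f_apply (M : CochainComplex (Bimod k A B) ℤ) (b : B) (i : ℤ) (x : M.X i) :
    ((leftMul M b).f i).hom x = (b ⊗ₜ[k] (1 : Aᵐᵒᵖ)) • x := rfl

lemma leftMul_one (M : CochainComplex (Bimod k A B) ℤ) : leftMul M (1 : B) = 𝟙 _ := by
  ext i x
  exact one_smul (B ⊗[k] Aᵐᵒᵖ) (show M.X i from x)

lemma leftMul_mul (M : CochainComplex (Bimod k A B) ℤ) (b b' : B) :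
    leftMul M (b * b') = leftMul M b' ≫ leftMul M b := by
  ext i x
  change ((b * b') ⊗ₜ[k] (1 : Aᵐᵒᵖ)) • (show M.X i from x) =
    (b ⊗ₜ[k] (1 : Aᵐᵒᵖ)) • ((b' ⊗ₜ[k] (1 : Aᵐᵒᵖ)) • (show M.X i from x))
  rw [← mul_smul]
  simp

lemma leftMul_add (M : CochainComplex (Bimod k A B) ℤ) (b b' : B) :
    leftMul M (b + b') = leftMul M b + leftMul M b' := by
  ext i x
  change ((b + b') ⊗ₜ[k] (1 : Aᵐᵒᵖ)) • (show M.X i from x) =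
    (b ⊗ₜ[k] (1 : Aᵐᵒᵖ)) • (show M.X i from x) + (b' ⊗ₜ[k] (1 : Aᵐᵒᵖ)) • (show M.X i from x)
  rw [TensorProduct.add_tmul, add_smul]

lemma leftMul_algebraMap (M : CochainComplex (Bimod k A B) ℤ) (c : k) :
    leftMul M (algebraMap k B c) = c • 𝟙 (rightComplex M) := by
  ext i x
  change ((algebraMap k B c) ⊗ₜ[k] (1 : Aᵐᵒᵖ)) • (show M.X i from x) =
    ((1 : B) ⊗ₜ[k] (algebraMap k Aᵐᵒᵖ c)) • (show M.X i from x)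
  rw [Algebra.algebraMap_eq_smul_one, Algebra.algebraMap_eq_smul_one, TensorProduct.smul_tmul]

lemma leftMul_zero (M : CochainComplex (Bimod k A B) ℤ) : leftMul M (0 : B) = 0 := by
  simpa using leftMul_algebraMap M (0 : k)


variable (P : CochainComplex (Bimod k A B) ℤ) (N : CochainComplex (Bimod k A C) ℤ) (n : ℤ)

/-- The degree `n` part `∏ Hom_A(P^i, N^{i+n})` of the complex `Hom_A(P, N)`. -/
abbrev HomCochain : Type u := Cochain (rightComplex P) (rightComplex N) n

/-- The left action of `C` on `Hom_A(P, N)`: `(c φ)(x) = c φ(x)`. -/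
def homLeftAction : C →ₐ[k] Module.End k (HomCochain P N n) :=
  AlgHom.ofLinearMap
    { toFun := fun c =>
        { toFun := fun z => z.comp (Cochain.ofHom (leftMul N c)) (add_zero n)
          map_add' := fun z z' => by simp
          map_smul' := fun r z => by simp }
      map_add' := fun c c' => by ext z : 1; simp [leftMul_add]
      map_smul' := fun r c => by
        ext z p q hpq : 3
        simp [Algebra.smul_def, leftMul_mul, leftMul_algebraMap] }
    (by ext z : 1; simp [leftMul_one])
    (fun c c' => by ext z p q hpq : 3; simp [leftMul_mul])

/-- The right action of `B` on `Hom_A(P, N)`: `(φ b)(x) = φ(b x)`. -/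
def homRightAction : Bᵐᵒᵖ →ₐ[k] Module.End k (HomCochain P N n) :=
  AlgHom.ofLinearMap
    { toFun := fun b =>
        { toFun := fun z => (Cochain.ofHom (leftMul P b.unop)).comp z (zero_add n)
          map_add' := fun z z' => by simp
          map_smul' := fun r z => by simp }
      map_add' := fun c c' => by ext z : 1; simp [leftMul_add]
      map_smul' := fun r c => by
        ext z p q hpq : 3
        simp [Algebra.smul_def, leftMul_mul, leftMul_algebraMap] }
    (by ext z : 1; simp [leftMul_one])
    (fun c c' => by ext z p q hpq : 3; simp [leftMul_mul])

/-- The `C`-`B`-bimodule structure of `Hom_A(P, N)` in degree `n`: `(c φ b)(x) = c φ(b x)`. -/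
def homAction : C ⊗[k] Bᵐᵒᵖ →ₐ[k] Module.End k (HomCochain P N n) :=
  Algebra.TensorProduct.lift (homLeftAction P N n) (homRightAction P N n)
    (fun c b => by ext z p q hpq : 3; simp [homLeftAction, homRightAction])

instance homModule : Module (C ⊗[k] Bᵐᵒᵖ) (HomCochain P N n) :=
  Module.compHom _ (homAction P N n).toRingHom

lemma hom_tmul_smul (c : C) (b : B) (z : HomCochain P N n) :
    ((c ⊗ₜ[k] op b) • z : HomCochain P N n) =
      ((Cochain.ofHom (leftMul P b)).comp z (zero_add n)).comp
        (Cochain.ofHom (leftMul N c)) (add_zero n) := rfl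

variable {P N} in
lemma δ_bimod_smul (i j : ℤ) (r : C ⊗[k] Bᵐᵒᵖ) (z : HomCochain P N i) :
    (δ i j (r • z) : HomCochain P N j) = r • (δ i j z : HomCochain P N j) := by
  have h : (δ_hom k (rightComplex P) (rightComplex N) i j) ∘ₗ (LinearMap.applyₗ z) ∘ₗ
        (homAction P N i).toLinearMap =
      (LinearMap.applyₗ (δ i j z)) ∘ₗ (homAction P N j).toLinearMap :=
    TensorProduct.ext' fun c b => by
      obtain ⟨b, rfl⟩ := op_surjective b
      simp [homAction, homLeftAction, homRightAction]
  exact LinearMap.congr_fun h r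

variable {P N} in
/-- The differential of `Hom_A(P, N)`. -/
def homDifferential (i j : ℤ) : HomCochain P N i →ₗ[C ⊗[k] Bᵐᵒᵖ] HomCochain P N j where
  toFun z := δ i j z
  map_add' := δ_add i j
  map_smul' := δ_bimod_smul i j

/-- The complex of `C`-`B`-bimodules `Hom_A(P, N)`. -/
def homComplex : CochainComplex (Bimod k B C) ℤ where
  X n := ModuleCat.of _ (HomCochain P N n)
  d i j := ModuleCat.ofHom (homDifferential i j)
  shape i j hij := by ext z : 2; exact δ_shape _ _ hij z
  d_comp_d' i j l _ _ := by ext z : 2; exact δ_δ i j l z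

/-! ### The complex of bimodules `P ⊗_A N` -/

section Tensor

open TensorProduct

variable (V V' V'' : Bimod k A B) (W W' W'' : Bimod k C A)

/-- The relations `v a ⊗ w - v ⊗ a w` defining `V ⊗_A W` as a quotient of `V ⊗_k W`. -/
def balancedRelations : Submodule k (V ⊗[k] W) :=
  Submodule.span k {t | ∃ (v : V) (a : A) (w : W),
    t = (((1 : B) ⊗ₜ[k] op a) • v) ⊗ₜ[k] w - v ⊗ₜ[k] ((a ⊗ₜ[k] (1 : Cᵐᵒᵖ)) • w)}

/-- The tensor product `V ⊗_A W` of a `B`-`A`-bimodule `V` and an `A`-`C`-bimodule `W`. -/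
def BalancedTensor : Type u := (V ⊗[k] W) ⧸ balancedRelations V W

instance : AddCommGroup (BalancedTensor V W) :=
  inferInstanceAs (AddCommGroup ((V ⊗[k] W) ⧸ balancedRelations V W))

instance : Module k (BalancedTensor V W) :=
  inferInstanceAs (Module k ((V ⊗[k] W) ⧸ balancedRelations V W))

/-- The quotient map `V ⊗_k W → V ⊗_A W`. -/
def balancedQuotient : V ⊗[k] W →ₗ[k] BalancedTensor V W := (balancedRelations V W).mkQ

variable {V V' V'' W W' W''}

/-- The map on `V ⊗_A W` induced by a pair of maps of vector spaces that are compatible with the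
actions of `A`. -/
def balancedMap (φ : V →ₗ[k] V') (ψ : W →ₗ[k] W')
    (hφ : ∀ (v : V) (a : A), φ (((1 : B) ⊗ₜ[k] op a) • v) = ((1 : B) ⊗ₜ[k] op a) • φ v)
    (hψ : ∀ (a : A) (w : W), ψ ((a ⊗ₜ[k] (1 : Cᵐᵒᵖ)) • w) = (a ⊗ₜ[k] (1 : Cᵐᵒᵖ)) • ψ w) :
    BalancedTensor V W →ₗ[k] BalancedTensor V' W' :=
  Submodule.mapQ _ _ (TensorProduct.map φ ψ) (by
    rw [balancedRelations, Submodule.span_le]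
    rintro _ ⟨v, a, w, rfl⟩
    refine Submodule.subset_span ⟨φ v, a, ψ w, ?_⟩
    simp only [map_sub, TensorProduct.map_tmul, hφ, hψ])

/-- The class `v ⊗ w` in `V ⊗_A W`. -/
def balancedMk (v : V) (w : W) : BalancedTensor V W :=
  balancedQuotient V W (v ⊗ₜ[k] w)

@[simp]
lemma balancedMap_mk (φ : V →ₗ[k] V') (ψ : W →ₗ[k] W') (hφ) (hψ) (v : V) (w : W) :
    balancedMap φ ψ hφ hψ (balancedMk v w) = balancedMk (φ v) (ψ w) := rfl

lemma balancedTensor_ext {X : Type*} [AddCommGroup X] [Module k X]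
    {f g : BalancedTensor V W →ₗ[k] X}
    (h : ∀ v w, f (balancedMk v w) = g (balancedMk v w)) : f = g :=
  Submodule.linearMap_qext _ (TensorProduct.ext' h)

lemma balancedMk_add_left (v v' : V) (w : W) :
    balancedMk (v + v') w = balancedMk v w + balancedMk v' w := by
  simp [balancedMk, TensorProduct.add_tmul]

lemma balancedMk_add_right (v : V) (w w' : W) :
    balancedMk v (w + w') = balancedMk v w + balancedMk v w' := by
  simp [balancedMk, TensorProduct.tmul_add]

lemma balancedMk_smul_left (r : k) (v : V) (w : W) :
    balancedMk (r • v) w = r • balancedMk v w := by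
  rw [balancedMk, ← TensorProduct.smul_tmul', map_smul]; rfl

lemma balancedMk_smul_right (r : k) (v : V) (w : W) :
    balancedMk v (r • w) = r • balancedMk v w := by
  simp [balancedMk]

variable (V W)

/-- The left action of `B` on `V ⊗_A W`: `b (v ⊗ w) = b v ⊗ w`. -/
def tensorLeftAction : B →ₐ[k] Module.End k (BalancedTensor V W) :=
  AlgHom.ofLinearMap
    { toFun := fun b => balancedMap (Algebra.lsmul k k V (b ⊗ₜ[k] (1 : Aᵐᵒᵖ))) LinearMap.id
        (fun v a => by simp only [Algebra.lsmul_coe]; rw [← mul_smul, ← mul_smul]; simp)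
        (fun a w => rfl)
      map_add' := fun b b' => balancedTensor_ext fun v w => by
        simp [TensorProduct.add_tmul, balancedMk_add_left]
      map_smul' := fun r b => balancedTensor_ext fun v w => by
        simp [← TensorProduct.smul_tmul', balancedMk_smul_left] }
    (balancedTensor_ext fun v w => by simp [← Algebra.TensorProduct.one_def])
    (fun b b' => balancedTensor_ext fun v w => by
      simp [← mul_smul])

/-- The right action of `C` on `V ⊗_A W`: `(v ⊗ w) c = v ⊗ w c`. -/
def tensorRightAction : Cᵐᵒᵖ →ₐ[k] Module.End k (BalancedTensor V W) :=
  AlgHom.ofLinearMap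
    { toFun := fun c => balancedMap LinearMap.id (Algebra.lsmul k k W ((1 : A) ⊗ₜ[k] c))
        (fun v a => rfl)
        (fun a w => by simp only [Algebra.lsmul_coe]; rw [← mul_smul, ← mul_smul]; simp)
      map_add' := fun b b' => balancedTensor_ext fun v w => by
        simp [TensorProduct.tmul_add, balancedMk_add_right]
      map_smul' := fun r b => balancedTensor_ext fun v w => by
        simp [balancedMk_smul_right] }
    (balancedTensor_ext fun v w => by simp [← Algebra.TensorProduct.one_def])
    (fun b b' => balancedTensor_ext fun v w => by
      simp [← mul_smul])

/-- The `B`-`C`-bimodule structure of `V ⊗_A W`: `b (v ⊗ w) c = b v ⊗ w c`. -/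
def tensorAction : B ⊗[k] Cᵐᵒᵖ →ₐ[k] Module.End k (BalancedTensor V W) :=
  Algebra.TensorProduct.lift (tensorLeftAction V W) (tensorRightAction V W)
    (fun b c => balancedTensor_ext fun v w => by simp [tensorLeftAction, tensorRightAction])

instance tensorModule : Module (B ⊗[k] Cᵐᵒᵖ) (BalancedTensor V W) :=
  Module.compHom _ (tensorAction V W).toRingHom

variable {V W}

lemma tensor_tmul_smul (b : B) (c : Cᵐᵒᵖ) (v : V) (w : W) :
    ((b ⊗ₜ[k] c) • balancedMk v w : BalancedTensor V W) =
      balancedMk ((b ⊗ₜ[k] (1 : Aᵐᵒᵖ)) • v) (((1 : A) ⊗ₜ[k] c) • w) := rfl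

lemma balancedTensor_induction {p : BalancedTensor V W → Prop} (t : BalancedTensor V W)
    (h0 : p 0) (hmk : ∀ v w, p (balancedMk v w)) (hadd : ∀ x y, p x → p y → p (x + y)) : p t := by
  obtain ⟨t, rfl⟩ : ∃ s, balancedQuotient V W s = t := Submodule.mkQ_surjective _ t
  induction t with
  | zero => rw [map_zero]; exact h0
  | tmul v w => exact hmk v w
  | add x y hx hy => rw [map_add]; exact hadd _ _ hx hy

lemma balancedMap_smul (φ : V ⟶ V') (ψ : W ⟶ W') (hφ) (hψ) (r : B ⊗[k] Cᵐᵒᵖ)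
    (t : BalancedTensor V W) :
    balancedMap (φ.hom.restrictScalars k) (ψ.hom.restrictScalars k) hφ hψ (r • t) =
      r • balancedMap (φ.hom.restrictScalars k) (ψ.hom.restrictScalars k) hφ hψ t := by
  have h : (balancedMap (φ.hom.restrictScalars k) (ψ.hom.restrictScalars k) hφ hψ) ∘ₗ
        (LinearMap.applyₗ t) ∘ₗ (tensorAction V W).toLinearMap =
      (LinearMap.applyₗ (balancedMap (φ.hom.restrictScalars k) (ψ.hom.restrictScalars k) hφ hψ t)) ∘ₗ
        (tensorAction V' W').toLinearMap :=
    TensorProduct.ext' fun b c => LinearMap.congr_fun (balancedTensor_ext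
      (f := balancedMap (φ.hom.restrictScalars k) (ψ.hom.restrictScalars k) hφ hψ ∘ₗ
        tensorAction V W (b ⊗ₜ c))
      (g := tensorAction V' W' (b ⊗ₜ c) ∘ₗ
        balancedMap (φ.hom.restrictScalars k) (ψ.hom.restrictScalars k) hφ hψ)
      fun v w => by simp [tensorAction, tensorLeftAction, tensorRightAction]) t
  exact LinearMap.congr_fun h r

/-- The bimodule map `φ ⊗ ψ : V ⊗_A W → V' ⊗_A W'`. -/
def tensorMap (φ : V ⟶ V') (ψ : W ⟶ W') :
    BalancedTensor V W →ₗ[B ⊗[k] Cᵐᵒᵖ] BalancedTensor V' W' :=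
  { toFun := balancedMap (φ.hom.restrictScalars k) (ψ.hom.restrictScalars k)
      (fun v a => φ.hom.map_smul _ v) (fun a w => ψ.hom.map_smul _ w)
    map_add' := map_add _
    map_smul' := balancedMap_smul φ ψ _ _ }

@[simp]
lemma tensorMap_mk (φ : V ⟶ V') (ψ : W ⟶ W') (v : V) (w : W) :
    tensorMap φ ψ (balancedMk v w) = balancedMk (φ.hom v) (ψ.hom w) := rfl

lemma tensorMap_ext {X : Type*} [AddCommGroup X] [Module (B ⊗[k] Cᵐᵒᵖ) X]
    {f g : BalancedTensor V W →ₗ[B ⊗[k] Cᵐᵒᵖ] X}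
    (h : ∀ v w, f (balancedMk v w) = g (balancedMk v w)) : f = g := by
  ext t
  induction t using balancedTensor_induction with
  | h0 => simp
  | hadd x y hx hy => rw [map_add, map_add, hx, hy]
  | hmk v w => exact h v w

variable (k A B C)

/-- The bifunctor `(V, W) ↦ V ⊗_A W` from `B`-`A`-bimodules and `A`-`C`-bimodules to
`B`-`C`-bimodules. -/
def tensorBifunctor : Bimod k A B ⥤ Bimod k C A ⥤ Bimod k C B where
  obj V :=
    { obj := fun W => ModuleCat.of _ (BalancedTensor V W)
      map := fun ψ => ModuleCat.ofHom (tensorMap (𝟙 V) ψ)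
      map_id := fun W => ModuleCat.hom_ext (tensorMap_ext fun v w => rfl)
      map_comp := fun f g => ModuleCat.hom_ext (tensorMap_ext fun v w => rfl) }
  map φ :=
    { app := fun W => ModuleCat.ofHom (tensorMap φ (𝟙 W))
      naturality := fun W W' ψ => ModuleCat.hom_ext (tensorMap_ext fun v w => rfl) }
  map_id V := NatTrans.ext (funext fun W => ModuleCat.hom_ext (tensorMap_ext fun v w => rfl))
  map_comp f g :=
    NatTrans.ext (funext fun W => ModuleCat.hom_ext (tensorMap_ext fun v w => rfl))

instance : (tensorBifunctor k A B C).PreservesZeroMorphisms where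
  map_zero V V' := NatTrans.ext (funext fun W => ModuleCat.hom_ext (tensorMap_ext fun v w =>
    show balancedMk (0 : V') w = 0 by simp [balancedMk]))

instance (V : Bimod k A B) : ((tensorBifunctor k A B C).obj V).PreservesZeroMorphisms where
  map_zero W W' := ModuleCat.hom_ext (tensorMap_ext fun v w =>
    show balancedMk v (0 : W') = 0 by simp [balancedMk])

variable {k A B C}

/-- The total complex of `B`-`C`-bimodules `P ⊗_A N`. -/
def tensorComplex (P : CochainComplex (Bimod k A B) ℤ) (N : CochainComplex (Bimod k C A) ℤ) :
    CochainComplex (Bimod k C B) ℤ :=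
  HomologicalComplex.mapBifunctor P N (tensorBifunctor k A B C) (ComplexShape.up ℤ)

end Tensor

/-! ### The derived functors -/

section Derived

variable {M : CochainComplex (Bimod k A B) ℤ}

/-- The complex of `C`-`B`-bimodules `RHom_A(M, N) = Hom_A(P, N)`, computed with a homotopically
projective resolution `P` of `M`; its cohomology bimodules are the `Ext_A^l(M, N)`. -/
def rHom (P : HProjResolution M) (N : CochainComplex (Bimod k A C) ℤ) :
    CochainComplex (Bimod k B C) ℤ :=
  homComplex P.complex N

/-- The complex of `B`-`C`-bimodules `M ⊗^L_A N = P ⊗_A N`, computed with a homotopically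
projective resolution `P` of `M`; its cohomology bimodules in degrees `-l` are the
`Tor^A_l(M, N)`. -/
def derivedTensor (P : HProjResolution M) (N : CochainComplex (Bimod k C A) ℤ) :
    CochainComplex (Bimod k C B) ℤ :=
  tensorComplex P.complex N

end Derived

/-! ### Existence of resolutions -/

lemma quasiIso_of_op {D : Type*} [Category* D] [Abelian D] {K L : CochainComplex D ℤ} (φ : K ⟶ L)
    (h : QuasiIso ((CochainComplex.opEquivalence D).functor.map φ.op)) : QuasiIso φ := by
  refine ⟨fun n => ?_⟩
  obtain ⟨m, rfl⟩ : ∃ m, n = -m := ⟨-n, by simp⟩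
  have hm := h.quasiIsoAt m
  rw [quasiIsoAt_iff' _ (m - 1) m (m + 1) (by simp) (by simp)] at hm
  rw [quasiIsoAt_iff' _ (-(m + 1)) (-m) (-(m - 1)) (by grind [CochainComplex.prev])
    (by grind [CochainComplex.next]), ← ShortComplex.quasiIso_opMap_iff]
  exact hm

/-- Every bounded above complex of bimodules has a homotopically projective resolution. -/
lemma exists_hProjResolution {M : CochainComplex (Bimod k A B) ℤ} (b : ℤ) [M.IsStrictlyLE b] :
    Nonempty (HProjResolution M) := by
  let E := CochainComplex.opEquivalence (Bimod k A B)
  have hM : (E.functor.obj (Opposite.op M)).IsStrictlyGE (-b) := by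
    rw [isStrictlyGE_iff]
    intro i hi
    exact (M.isZero_of_isStrictlyLE b _ (by change b < -i; lia)).op
  obtain ⟨L, i, hi, hL, hLb⟩ :=
    CochainComplex.Plus.modelCategoryQuillen.exists_quasiIso_injective
      (E.functor.obj (Opposite.op M)) (-b)
  have : L.IsKInjective := CochainComplex.isKInjective_of_injective L (-b)
  have : ((𝟭 _).obj L).IsKInjective := this
  let P := (E.inverse.obj L).unop
  let j : E.functor.obj (Opposite.op M) ⟶ E.functor.obj (Opposite.op P) :=
    i ≫ E.counitIso.inv.app L
  have hj : QuasiIso j := inferInstance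
  refine ⟨⟨P, CochainComplex.isKProjective_of_op
    (CochainComplex.isKInjective_of_iso (E.counitIso.symm.app L)), (E.functor.preimage j).unop,
    quasiIso_of_op _ ?_⟩⟩
  rw [Quiver.Hom.op_unop, Functor.map_preimage]
  exact hj

end BimoduleHRR

end

open BimoduleHRR
open scoped Matrix

noncomputable section

namespace BimoduleHRR

open CategoryTheory MulOpposite
open scoped TensorProduct ModuleCat
set_option linter.unusedVariables false

/-! ### Characters of an elementary algebra -/

section Characters

variable {k A : Type u} [Field k] [Ring A] [Algebra k A]

/-! The theorem rests on the fact that the Cartan matrix computes homomorphisms out of projectives.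
Since `A` is elementary, its simple right modules are lines `S_s` on which `A` acts through
characters `χ_s`, with `χ_s (e_t) = δ_st`. For a finite-dimensional projective right module `U`, let
`c_s(U) = dim Hom_A(U, S_s)`. As `Hom_A(U, -)` is exact, splitting off one line after another from
`Y` gives `dim Hom_A(U, Y) = ∑ c_s(U) dim(Y e_s)` (`IsDualFamily.finrank_hom`). For `Y = D(A e_t)`
the left side is `dim(U e_t)`, so the dimension vector of `U` is `C_A c(U)`
(`IsDualFamily.rangeDim_eq_mulVec`). Finite projective resolutions then place the dimension vector
of every finite-dimensional module in the image of `C_A` over the integers. The simple modules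
contribute the standard basis, so `C_A` is invertible and `c(U) = C_A⁻¹ dim U`.

For bimodules `V`, `W` with `V` projective over `A`, cutting with the idempotents `f_i`, `g_j`
reduces `dm Hom_A(V, W)` to this formula, because `f_i V` is a summand of `V`. The tensor product
follows from `D(V ⊗_A W) = Hom_A(V, DW)`.

For complexes, `M` is replaced by a bounded complex `Q` of finite-dimensional bimodules that are
projective over `A` and have the same alternating dimensions (`exists_projective_resolution`). `Q`
need not be homotopically projective as a complex of bimodules, but it is so over `A`, and so is any
homotopically projective `P`, since restriction to `A` is left adjoint to an exact functor. A
comparison map `P ⟶ Q` of bimodule complexes is therefore a homotopy equivalence over `A`, which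
suffices for `Hom_A(-, N)` and `- ⊗_A N` to turn it into quasi-isomorphisms. Finally, the Euler
characteristic of cohomology is that of the terms, and the double sum over terms factors by
bilinearity. -/

lemma IsElementary.exists_surjective [FiniteDimensional k A] (hA : IsElementary k A) :
    ∃ (r : ℕ) (π : A →ₐ[k] (Fin r → k)), Function.Surjective π ∧
      ∃ m : ℕ, ∀ l : List A, m ≤ l.length → (∀ x ∈ l, π x = 0) → l.prod = 0 := by
  obtain ⟨r, ⟨φ⟩⟩ := hA
  have : IsArtinianRing A := IsArtinianRing.of_finite k A
  refine ⟨r, φ.toAlgHom.comp (Ideal.Quotient.mkₐ k (Ring.jacobson A)),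
    φ.surjective.comp Ideal.Quotient.mk_surjective, ?_⟩
  -- Nilpotence of the radical is recorded for products of arbitrary kernel elements, not only for
  -- powers of one element: the search for eigenvectors multiplies by varying elements.
  obtain ⟨m, hm⟩ := IsSemiprimaryRing.isNilpotent (R := A)
  have key : ∀ l : List A, (∀ x ∈ l, x ∈ Ring.jacobson A) →
      l.prod ∈ (Ring.jacobson A) ^ l.length := by
    intro l
    induction l with
    | nil => intro _; rw [List.length_nil, Submodule.pow_zero, Ideal.one_eq_top]; trivial
    | cons a l ih =>
      intro h
      rw [List.prod_cons, List.length_cons, Ideal.IsTwoSided.pow_succ]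
      exact Ideal.mul_mem_mul (h a (by simp)) (ih fun x hx => h x (by simp [hx]))
  refine ⟨m, fun l hl h => ?_⟩
  have h1 := key l fun x hx => by
    have := h x hx
    simpa [Ideal.Quotient.eq_zero_iff_mem] using this
  have h2 := Ideal.pow_le_pow_right hl h1
  rw [hm] at h2
  simpa using h2

lemma isIdempotentElem_field_iff {x : k} (h : IsIdempotentElem x) : x = 0 ∨ x = 1 := by
  have : x * (x - 1) = 0 := by rw [mul_sub, h.eq]; simp
  rcases mul_eq_zero.1 this with h | h
  · exact Or.inl h
  · exact Or.inr (sub_eq_zero.1 h)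

/-- The characters of an elementary algebra dual to a complete set of primitive idempotents. -/
structure IsDualFamily {n : ℕ} (e : Fin n → A) (χ : Fin n → A →ₐ[k] k) : Prop where
  apply_eq : ∀ s t, χ s (e t) = if s = t then 1 else 0
  exists_eigenvector : ∀ (Y : Type u) [AddCommGroup Y] [Module k Y] [Module Aᵐᵒᵖ Y]
    [IsScalarTower k Aᵐᵒᵖ Y] [Nontrivial Y],
    ∃ (s : Fin n) (w : Y), w ≠ 0 ∧ ∀ a : A, op a • w = χ s a • w

/-- The characters are the coordinates of `A / rad A ≅ k^r`. Each takes the value 0 or 1 on an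
idempotent. Some coordinate is 1 on `e_s`, which is not nilpotent; primitivity makes it unique;
completeness makes every coordinate arise in this way. An eigenvector is found among the vectors
killed by the radical. -/
theorem exists_isDualFamily [FiniteDimensional k A] (hA : IsElementary k A) {n : ℕ}
    {e : Fin n → A} (he : IsCompletePrimitiveSet e) :
    ∃ χ : Fin n → A →ₐ[k] k, IsDualFamily e χ := by
  obtain ⟨r, π, hπ, m, hm⟩ := hA.exists_surjective
  have hnil : ∀ x, π x = 0 → IsNilpotent x := by
    intro x hx
    refine ⟨m, ?_⟩
    rw [← List.prod_replicate]
    exact hm _ (by simp) fun y hy => by rw [List.eq_of_mem_replicate hy]; exact hx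
  let ψ : Fin r → A →ₐ[k] k := fun i => (Pi.evalAlgHom k (fun _ => k) i).comp π
  have hψ : ∀ i a, ψ i a = π a i := fun _ _ => rfl
  have hidem : ∀ s, IsIdempotentElem (e s) := he.1.idem
  have h01 : ∀ i s, ψ i (e s) = 0 ∨ ψ i (e s) = 1 := fun i s =>
    isIdempotentElem_field_iff ((hidem s).map (ψ i))
  have hex : ∀ s, ∃ i, ψ i (e s) = 1 := by
    intro s
    by_contra! h
    have h0 : π (e s) = 0 := funext fun i => (h01 i s).resolve_right (h i)
    obtain ⟨N, hN⟩ := hnil _ h0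
    have : e s = 0 := by
      rw [← (hidem s).pow_succ_eq N, pow_succ, hN, zero_mul]
    exact (he.2 s).2.1 this
  have huniq : ∀ s i j, ψ i (e s) = 1 → ψ j (e s) = 1 → i = j := by
    intro s i j hi hj
    by_contra hij
    -- The `i`-th coordinate idempotent lifts to an idempotent `x` orthogonal to `1 - e_s`, so `e_s
    -- = x + (e_s - x)` is an orthogonal decomposition. Neither summand vanishes: coordinate `i` of
    -- `x` and coordinate `j` of `e_s - x` are both 1.
    obtain ⟨x, hx, hx1, hx2, hx3⟩ := exists_isIdempotentElem_mul_eq_zero_of_ker_isNilpotent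
      (π : A →+* (Fin r → k)) (fun x hx => hnil x hx) (Pi.single i 1)
      (by obtain ⟨y, hy⟩ := hπ (Pi.single i 1); exact ⟨y, hy⟩)
      (by rw [IsIdempotentElem, ← Pi.single_mul]; simp)
      (1 - e s) (hidem s).one_sub
      (by
        ext l
        by_cases hl : l = i
        · subst hl; simp [← hψ, hi]
        · simp [hl])
      (by
        ext l
        by_cases hl : l = i
        · subst hl; simp [← hψ, hi]
        · simp [hl])
    have h1 : x * e s = x := by rw [mul_sub, mul_one, sub_eq_zero] at hx2; exact hx2.symm
    have h2 : e s * x = x := by rw [sub_mul, one_mul, sub_eq_zero] at hx3; exact hx3.symm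
    have hπx : ∀ l, π x l = (Pi.single i 1 : Fin r → k) l := fun l => congrFun hx1 l
    rcases (he.2 s).2.2 x (e s - x) hx
      (by rw [IsIdempotentElem, mul_sub, sub_mul, sub_mul, (hidem s).eq, h1, h2, hx.eq]; simp)
      (by rw [mul_sub, h1, hx.eq, sub_self]) (by rw [sub_mul, h2, hx.eq, sub_self])
      (by abel) with h | h
    · have := hπx i
      simp [h] at this
    · have := hπx j
      rw [← sub_eq_zero.1 h, ← hψ, hj] at this
      simp [Ne.symm hij] at this
  choose i hi using hex
  have happ : ∀ s t, ψ (i s) (e t) = if s = t then 1 else 0 := by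
    intro s t
    split_ifs with h
    · rw [← h, hi]
    · have h1 : ψ (i s) (e s * e t) = 0 := by rw [he.1.ortho h, map_zero]
      rwa [map_mul, hi, one_mul] at h1
  have hall : ∀ j, ∃ s, j = i s := by
    intro j
    have h1 : ∑ s, ψ j (e s) = 1 := by rw [← map_sum, he.1.complete, map_one]
    obtain ⟨s, _, hs⟩ := Finset.exists_ne_zero_of_sum_ne_zero (h1.trans_ne one_ne_zero)
    exact ⟨s, huniq s _ _ ((h01 j s).resolve_left hs) (hi s)⟩
  refine ⟨fun s => ψ (i s), happ, ?_⟩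
  intro Y _ _ _ _ _
  -- If every nonzero vector were moved to a nonzero vector by some element of the kernel,
  -- arbitrarily long products of kernel elements would act nontrivially, against nilpotence.
  obtain ⟨v, hv, hvJ⟩ : ∃ v : Y, v ≠ 0 ∧ ∀ a, π a = 0 → op a • v = 0 := by
    by_contra! H
    have key : ∀ N : ℕ, ∃ (l : List A) (v : Y), l.length = N ∧ (∀ x ∈ l, π x = 0) ∧
        op l.prod • v ≠ 0 := by
      obtain ⟨v, hv⟩ := exists_ne (0 : Y)
      intro N
      induction N with
      | zero => exact ⟨[], v, rfl, by simp, by simpa using hv⟩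
      | succ N ih =>
        obtain ⟨l, v, hl, h0, hne⟩ := ih
        obtain ⟨a, ha, ha'⟩ := H _ hne
        refine ⟨l ++ [a], v, by simp [hl], ?_, ?_⟩
        · intro x hx
          rcases List.mem_append.1 hx with h | h
          · exact h0 x h
          · rw [List.mem_singleton.1 h]; exact ha
        · rw [List.prod_append, List.prod_singleton, op_mul, mul_smul]
          exact ha'
    obtain ⟨l, v, hl, h0, hne⟩ := key m
    exact hne (by rw [hm l hl.ge h0, op_zero, zero_smul])
  -- Lifts of the coordinate idempotents sum to 1 modulo the kernel, which kills `v`. So `v` is the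
  -- sum of the `v y_j`, and a nonzero one is the eigenvector.
  choose y hy using fun j : Fin r => hπ (Pi.single j 1)
  have hsum : v = ∑ j, op (y j) • v := by
    have h0 : π (1 - ∑ j, y j) = 0 := by
      rw [map_sub, map_one, map_sum, sub_eq_zero]
      simp_rw [hy]
      exact (Finset.univ_sum_single (1 : Fin r → k)).symm
    have := hvJ _ h0
    rw [MulOpposite.op_sub, sub_smul, op_one, one_smul, sub_eq_zero] at this
    rw [← Finset.sum_smul, ← Finset.op_sum]
    exact this
  obtain ⟨j, _, hj⟩ := Finset.exists_ne_zero_of_sum_ne_zero (hsum ▸ hv : (∑ j, op (y j) • v) ≠ 0)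
  obtain ⟨s, rfl⟩ := hall j
  refine ⟨s, _, hj, fun a => ?_⟩
  -- Multiplying a coordinate idempotent of `k^r` by `π a` only scales it by the corresponding
  -- coordinate.
  have h0 : π (y (i s) * a - ψ (i s) a • y (i s)) = 0 := by
    rw [map_sub, map_mul, map_smul, hy]
    ext l
    by_cases hl : l = i s
    · subst hl; simp [hψ]
    · simp [hl]
  have := hvJ _ h0
  rw [MulOpposite.op_sub, sub_smul, op_mul, mul_smul, sub_eq_zero, op_smul, smul_assoc] at this
  exact this

end Characters

/-! ### Dimensions of the images of idempotents -/

section RangeDim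

variable {k : Type*} [Field k]

section Linear

variable {V V₁ V₂ V₃ : Type*} [AddCommGroup V] [Module k V] [AddCommGroup V₁] [Module k V₁]
  [AddCommGroup V₂] [Module k V₂] [AddCommGroup V₃] [Module k V₃]

lemma finrank_range_of_equiv (φ : V₁ ≃ₗ[k] V₂) (a : V₁ →ₗ[k] V₁) (b : V₂ →ₗ[k] V₂)
    (h : ∀ x, φ (a x) = b (φ x)) :
    Module.finrank k (LinearMap.range a) = Module.finrank k (LinearMap.range b) := by
  have : (LinearMap.range a).map (φ : V₁ →ₗ[k] V₂) = LinearMap.range b := by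
    ext y
    simp only [Submodule.mem_map, LinearMap.mem_range]
    constructor
    · rintro ⟨_, ⟨x, rfl⟩, rfl⟩
      exact ⟨φ x, (h x).symm⟩
    · rintro ⟨x, rfl⟩
      exact ⟨a (φ.symm x), ⟨_, rfl⟩, by simp [h]⟩
  rw [← this]
  exact (LinearEquiv.finrank_map_eq φ _).symm

/-- Passing to images of idempotents is exact. With `a₂ = id` this is additivity of dimension, and
with `a₂` the action of an idempotent it is additivity of the entries of dimension matrices. -/
lemma finrank_range_of_exact [FiniteDimensional k V₂] (i : V₁ →ₗ[k] V₂) (p : V₂ →ₗ[k] V₃)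
    (hi : Function.Injective i) (hp : Function.Surjective p) (hip : Function.Exact i p)
    (a₁ : V₁ →ₗ[k] V₁) (a₂ : V₂ →ₗ[k] V₂) (a₃ : V₃ →ₗ[k] V₃) (h₁ : ∀ x, i (a₁ x) = a₂ (i x))
    (h₃ : ∀ x, p (a₂ x) = a₃ (p x)) (h₂ : ∀ x, a₂ (a₂ x) = a₂ x) :
    Module.finrank k (LinearMap.range a₂) =
      Module.finrank k (LinearMap.range a₁) + Module.finrank k (LinearMap.range a₃) := by
  let p' : LinearMap.range a₂ →ₗ[k] V₃ := p ∘ₗ (LinearMap.range a₂).subtype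
  have hr : LinearMap.range p' = LinearMap.range a₃ := by
    ext y
    constructor
    · rintro ⟨⟨_, x, rfl⟩, rfl⟩
      exact ⟨p x, (h₃ x).symm⟩
    · rintro ⟨x, rfl⟩
      obtain ⟨x, rfl⟩ := hp x
      exact ⟨⟨_, x, rfl⟩, h₃ x⟩
  have hk : (LinearMap.ker p').map (LinearMap.range a₂).subtype = (LinearMap.range a₁).map i := by
    ext y
    constructor
    · rintro ⟨⟨_, x, rfl⟩, hx, rfl⟩
      obtain ⟨z, hz⟩ := (hip _).1 hx
      -- Here `a₂ x = i z`, and idempotence gives `i (a₁ z) = a₂ (a₂ x) = a₂ x`.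
      exact ⟨a₁ z, ⟨z, rfl⟩, by rw [h₁, hz]; exact h₂ x⟩
    · rintro ⟨_, ⟨z, rfl⟩, rfl⟩
      exact ⟨⟨_, i z, rfl⟩, LinearMap.mem_ker.2 ((hip _).2 ⟨a₁ z, h₁ z⟩), (h₁ z).symm⟩
  have h1 := LinearMap.finrank_range_add_finrank_ker p'
  have h2 : Module.finrank k (LinearMap.ker p') = Module.finrank k (LinearMap.range a₁) := by
    rw [← Submodule.finrank_map_subtype_eq, hk]
    exact (LinearEquiv.finrank_eq (Submodule.equivMapOfInjective i hi _)).symm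
  rw [hr, h2] at h1
  omega

end Linear

/-- The dimension of `r V`. -/
def rangeDim (k : Type*) [Field k] {R : Type*} [Ring R] [Algebra k R] (r : R) (V : Type*)
    [AddCommGroup V] [Module k V] [Module R V] [IsScalarTower k R V] : ℕ :=
  Module.finrank k (LinearMap.range (Algebra.lsmul k k V r))

variable {R : Type*} [Ring R] [Algebra k R]
  {V₁ : Type*} [AddCommGroup V₁] [Module k V₁] [Module R V₁] [IsScalarTower k R V₁]
  {V₂ : Type*} [AddCommGroup V₂] [Module k V₂] [Module R V₂] [IsScalarTower k R V₂]
  {V₃ : Type*} [AddCommGroup V₃] [Module k V₃] [Module R V₃] [IsScalarTower k R V₃]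

lemma rangeDim_of_exact [FiniteDimensional k V₂] {r : R} (hr : IsIdempotentElem r)
    (i : V₁ →ₗ[R] V₂) (p : V₂ →ₗ[R] V₃)
    (hi : Function.Injective i) (hp : Function.Surjective p) (hip : Function.Exact i p) :
    rangeDim k r V₂ = rangeDim k r V₁ + rangeDim k r V₃ :=
  finrank_range_of_exact (i.restrictScalars k) (p.restrictScalars k) hi hp hip _ _ _
    (fun x => i.map_smul r x) (fun x => p.map_smul r x)
    (fun x => by simp [← mul_smul, hr.eq])

lemma rangeDim_congr (r : R) (φ : V₁ ≃ₗ[R] V₂) : rangeDim k r V₁ = rangeDim k r V₂ :=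
  finrank_range_of_equiv (φ.restrictScalars k) _ _ fun x => φ.map_smul r x

lemma rangeDim_of_subsingleton [Subsingleton V₁] (r : R) : rangeDim k r V₁ = 0 :=
  Module.finrank_zero_of_subsingleton

lemma rangeDim_submodule [FiniteDimensional k V₁] {r : R} (hr : IsIdempotentElem r)
    (W : Submodule R V₁) :
    rangeDim k r V₁ = rangeDim k r W + rangeDim k r (V₁ ⧸ W) :=
  rangeDim_of_exact hr W.subtype W.mkQ W.injective_subtype W.mkQ_surjective
    (LinearMap.exact_subtype_mkQ W)

end RangeDim

/-! ### Spaces of homomorphisms out of projective modules -/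

section Hom

variable {k : Type*} [Field k] {R : Type*} [Ring R] [Algebra k R]
  {U : Type*} [AddCommGroup U] [Module k U] [Module R U] [IsScalarTower k R U]
  {Y₁ : Type*} [AddCommGroup Y₁] [Module k Y₁] [Module R Y₁] [IsScalarTower k R Y₁]
  {Y₂ : Type*} [AddCommGroup Y₂] [Module k Y₂] [Module R Y₂] [IsScalarTower k R Y₂]
  {Y₃ : Type*} [AddCommGroup Y₃] [Module k Y₃] [Module R Y₃] [IsScalarTower k R Y₃]

lemma finiteDimensional_hom [FiniteDimensional k U] [FiniteDimensional k Y₁] :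
    FiniteDimensional k (U →ₗ[R] Y₁) :=
  Module.Finite.of_injective (LinearMap.restrictScalarsₗ k R U Y₁ k)
    (LinearMap.restrictScalars_injective k)

variable (k U) in
/-- Composition with a linear map on the left. -/
def homPostcomp (i : Y₁ →ₗ[R] Y₂) : (U →ₗ[R] Y₁) →ₗ[k] (U →ₗ[R] Y₂) where
  toFun z := i ∘ₗ z
  map_add' _ _ := LinearMap.comp_add _ _ _
  map_smul' c z := LinearMap.ext fun x => by
    simp

variable (k) in
-- Projectivity of `U` makes `Hom(U, -)` exact; the count is `finrank_range_of_exact` with identity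
-- maps as idempotents.
lemma finrank_hom_of_exact [Module.Projective R U] [FiniteDimensional k U] [FiniteDimensional k Y₂]
    (i : Y₁ →ₗ[R] Y₂) (p : Y₂ →ₗ[R] Y₃)
    (hi : Function.Injective i) (hp : Function.Surjective p) (hip : Function.Exact i p) :
    Module.finrank k (U →ₗ[R] Y₂) =
      Module.finrank k (U →ₗ[R] Y₁) + Module.finrank k (U →ₗ[R] Y₃) := by
  have := finiteDimensional_hom (k := k) (R := R) (U := U) (Y₁ := Y₂)
  have h := finrank_range_of_exact (homPostcomp k U i) (homPostcomp k U p)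
    (fun z z' h => LinearMap.ext fun x => hi (LinearMap.congr_fun h x))
    (fun z => Module.projective_lifting_property p z hp)
    (fun z => by
      constructor
      · intro hz
        have hz' : ∀ x, z x ∈ LinearMap.range i := fun x =>
          (hip _).1 (LinearMap.congr_fun hz x)
        let e := LinearEquiv.ofInjective i hi
        refine ⟨e.symm.toLinearMap ∘ₗ z.codRestrict _ hz', LinearMap.ext fun x => ?_⟩
        have : e (e.symm (z.codRestrict _ hz' x)) = z.codRestrict _ hz' x := e.apply_symm_apply _
        exact congrArg Subtype.val this
      · rintro ⟨y, rfl⟩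
        exact LinearMap.ext fun x => (hip _).2 ⟨y x, rfl⟩)
    LinearMap.id LinearMap.id LinearMap.id (fun _ => rfl) (fun _ => rfl) (fun _ => rfl)
  rw [LinearMap.range_id, finrank_top, LinearMap.range_id, finrank_top, LinearMap.range_id,
    finrank_top] at h
  exact h

variable {V : Type*} [AddCommGroup V] [Module R V]

/-- Homomorphisms fixed by `z ↦ b z a`, for idempotents `a` and `b`, are the homomorphisms between
the images of `a` and `b`. -/
lemma finrank_range_hom_idempotent (a : V →ₗ[R] V) (b : Y₁ →ₗ[R] Y₁)
    (ha : ∀ x, a (a x) = a x) (hb : ∀ x, b (b x) = b x)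
    (T : (V →ₗ[R] Y₁) →ₗ[k] (V →ₗ[R] Y₁)) (hT : ∀ z x, T z x = b (z (a x))) :
    Module.finrank k (LinearMap.range T) =
      Module.finrank k (LinearMap.range a →ₗ[R] LinearMap.range b) := by
  let Φ : (LinearMap.range a →ₗ[R] LinearMap.range b) →ₗ[k] (V →ₗ[R] Y₁) :=
    { toFun := fun z => (LinearMap.range b).subtype ∘ₗ z ∘ₗ a.rangeRestrict
      map_add' := fun _ _ => rfl
      map_smul' := fun _ _ => rfl }
  have hΦ : Function.Injective Φ := by
    intro z z' h
    ext ⟨_, x, rfl⟩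
    exact LinearMap.congr_fun h x
  have hr : LinearMap.range Φ = LinearMap.range T := by
    ext y
    constructor
    · rintro ⟨z, rfl⟩
      refine ⟨Φ z, LinearMap.ext fun x => ?_⟩
      rw [hT]
      obtain ⟨w, hw⟩ := (z (a.rangeRestrict x)).2
      have h1 : a.rangeRestrict (a x) = a.rangeRestrict x := Subtype.ext (ha x)
      change b (z (a.rangeRestrict (a x))) = z (a.rangeRestrict x)
      rw [h1, ← hw, hb]
    · rintro ⟨z, rfl⟩
      refine ⟨b.rangeRestrict ∘ₗ z ∘ₗ (LinearMap.range a).subtype, LinearMap.ext fun x => ?_⟩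
      rw [hT]
      rfl
  rw [← hr, LinearMap.finrank_range_of_inj hΦ]

lemma projective_range_idempotent [Module.Projective R V] (a : V →ₗ[R] V)
    (ha : ∀ x, a (a x) = a x) : Module.Projective R (LinearMap.range a) :=
  Module.Projective.of_split (LinearMap.range a).subtype a.rangeRestrict
    (LinearMap.ext fun ⟨_, x, hx⟩ => Subtype.ext (by subst hx; exact ha x))

end Hom

/-! ### The Euler form of an elementary algebra -/

section EulerForm

variable {k A : Type u} [Field k] [Ring A] [Algebra k A]

/-- The space of linear forms on which `A` acts through the character `χ`. -/
def characterForms (χ : A →ₐ[k] k) (U : Type*) [AddCommGroup U] [Module k U] [Module Aᵐᵒᵖ U] :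
    Submodule k (Module.Dual k U) where
  carrier := {φ | ∀ a u, φ (op a • u) = χ a * φ u}
  add_mem' {φ φ'} h h' a u := by
    rw [LinearMap.add_apply, LinearMap.add_apply, h, h', mul_add]
  zero_mem' a u := by simp
  smul_mem' c φ h a u := by
    rw [LinearMap.smul_apply, LinearMap.smul_apply, h, smul_eq_mul, smul_eq_mul, mul_left_comm]

/-- The dimension of the space of linear forms on which `A` acts through `χ`. -/
def characterDim (χ : A →ₐ[k] k) (U : Type*) [AddCommGroup U] [Module k U] [Module Aᵐᵒᵖ U] : ℕ :=
  Module.finrank k (characterForms χ U)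

section Eigenvector

variable {Y : Type*} [AddCommGroup Y] [Module k Y] [Module Aᵐᵒᵖ Y] [IsScalarTower k Aᵐᵒᵖ Y]
  {χ : A →ₐ[k] k} {w : Y}

/-- The line spanned by an eigenvector. -/
def eigenline (hw : w ≠ 0) (hχ : ∀ a : A, op a • w = χ a • w) :
    k ≃ₗ[k] Submodule.span Aᵐᵒᵖ {w} :=
  LinearEquiv.ofBijective
    (LinearMap.toSpanSingleton k _ (⟨w, Submodule.mem_span_singleton_self w⟩ :
      Submodule.span Aᵐᵒᵖ {w}))
    ⟨fun c c' h => by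
      have h' : c • w = c' • w := congrArg Subtype.val h
      exact smul_left_injective k hw h', by
      rintro ⟨y, hy⟩
      obtain ⟨a, rfl⟩ := Submodule.mem_span_singleton.1 hy
      exact ⟨χ a.unop, Subtype.ext (hχ a.unop).symm⟩⟩

lemma op_smul_eigenline (hχ : ∀ a : A, op a • w = χ a • w) (a : A)
    (y : Submodule.span Aᵐᵒᵖ {w}) : op a • y = χ a • y := by
  obtain ⟨y, hy⟩ := y
  obtain ⟨b, rfl⟩ := Submodule.mem_span_singleton.1 hy
  refine Subtype.ext ?_
  change op a • b • w = χ a • b • w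
  obtain ⟨b, rfl⟩ := op_surjective b
  rw [hχ b, smul_comm, hχ a, smul_comm]

/-- Once the line is identified with `k`, an `A`-linear map into it is exactly a linear form that
transforms through `χ`. -/
lemma finrank_hom_eigenline (hw : w ≠ 0) (hχ : ∀ a : A, op a • w = χ a • w)
    (U : Type*) [AddCommGroup U] [Module k U] [Module Aᵐᵒᵖ U] [IsScalarTower k Aᵐᵒᵖ U] :
    Module.finrank k (U →ₗ[Aᵐᵒᵖ] Submodule.span Aᵐᵒᵖ {w}) = characterDim χ U := by
  let ε := eigenline hw hχ
  let Φ : (U →ₗ[Aᵐᵒᵖ] Submodule.span Aᵐᵒᵖ {w}) →ₗ[k] Module.Dual k U :=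
    { toFun := fun z => ε.symm.toLinearMap ∘ₗ z.restrictScalars k
      map_add' := fun z z' => LinearMap.ext fun u => map_add ε.symm (z u) (z' u)
      map_smul' := fun c z => LinearMap.ext fun u => map_smul ε.symm c (z u) }
  have hΦ : Function.Injective Φ := fun z z' h =>
    LinearMap.ext fun u => ε.symm.injective (LinearMap.congr_fun h u)
  have hr : LinearMap.range Φ = characterForms χ U := by
    ext φ
    constructor
    · rintro ⟨z, rfl⟩ a u
      change ε.symm (z (op a • u)) = χ a * ε.symm (z u)
      rw [map_smul, op_smul_eigenline hχ, map_smul, smul_eq_mul]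
    · intro hφ
      refine ⟨{ toFun := fun u => ε (φ u), map_add' := fun u u' => by rw [map_add, map_add],
                map_smul' := fun a u => ?_ }, LinearMap.ext fun u => ε.symm_apply_apply _⟩
      obtain ⟨a, rfl⟩ := op_surjective a
      rw [hφ, RingHom.id_apply, op_smul_eigenline hχ, ← smul_eq_mul, map_smul]
  rw [characterDim, ← hr, LinearMap.finrank_range_of_inj hΦ]

lemma rangeDim_eigenline (hw : w ≠ 0) (hχ : ∀ a : A, op a • w = χ a • w) {a : A}
    [Decidable (χ a = 0)] :
    rangeDim k (op a) (Submodule.span Aᵐᵒᵖ {w}) = if χ a = 0 then 0 else 1 := by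
  have h : Algebra.lsmul k k (Submodule.span Aᵐᵒᵖ {w}) (op a) = χ a • LinearMap.id :=
    LinearMap.ext fun y => op_smul_eigenline hχ a y
  rw [rangeDim, h]
  split_ifs with h0
  · rw [h0, zero_smul, LinearMap.range_zero, finrank_bot]
  · rw [LinearMap.range_smul _ _ h0, LinearMap.range_id, finrank_top,
      ← (eigenline hw hχ).finrank_eq, Module.finrank_self]

end Eigenvector

lemma rangeDim_one {R : Type*} [Ring R] [Algebra k R] (V : Type*)
    [AddCommGroup V] [Module k V] [Module R V] [IsScalarTower k R V] :
    rangeDim k (1 : R) V = Module.finrank k V := by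
  rw [rangeDim, map_one, Module.End.one_eq_id, LinearMap.range_id, finrank_top]

variable {n : ℕ} {e : Fin n → A} {χ : Fin n → A →ₐ[k] k}

/-- Induction on `dim Y`, dividing by the line of an eigenvector. Both sides are additive in `Y`,
the left one because `U` is projective. On a line with character `χ_s` only the `s`-th summand
survives, since `e_t` acts on it by `δ_st`. -/
theorem IsDualFamily.finrank_hom (hχ : IsDualFamily e χ) (he : ∀ s, IsIdempotentElem (e s))
    (U : Type*) [AddCommGroup U] [Module k U] [Module Aᵐᵒᵖ U] [IsScalarTower k Aᵐᵒᵖ U]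
    [FiniteDimensional k U] [Module.Projective Aᵐᵒᵖ U]
    (Y : Type u) [AddCommGroup Y] [Module k Y] [Module Aᵐᵒᵖ Y] [IsScalarTower k Aᵐᵒᵖ Y]
    [FiniteDimensional k Y] :
    Module.finrank k (U →ₗ[Aᵐᵒᵖ] Y) = ∑ s, characterDim (χ s) U * rangeDim k (op (e s)) Y := by
  have he' : ∀ s, IsIdempotentElem (op (e s)) := fun s => by
    rw [IsIdempotentElem, ← op_mul, (he s).eq]
  induction h : Module.finrank k Y using Nat.strong_induction_on generalizing Y with
  | _ N ih =>
    subst h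
    rcases subsingleton_or_nontrivial Y with hY | hY
    · rw [Module.finrank_zero_of_subsingleton]
      simp [rangeDim_of_subsingleton]
    · obtain ⟨s, w, hw, hws⟩ := hχ.exists_eigenvector Y
      let W := Submodule.span Aᵐᵒᵖ {w}
      have : FiniteDimensional k (Y ⧸ W) :=
        Module.Finite.of_surjective (W.mkQ.restrictScalars k) W.mkQ_surjective
      -- For the idempotent 1, `rangeDim` is the dimension, so the quotient by the line has
      -- dimension one less.
      have h1 := rangeDim_submodule (k := k) (IsIdempotentElem.one (M := Aᵐᵒᵖ)) W
      rw [rangeDim_one, rangeDim_one, rangeDim_one,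
        ← (eigenline hw hws).finrank_eq, Module.finrank_self] at h1
      have h2 := ih _ (by omega) (Y ⧸ W) rfl
      rw [finrank_hom_of_exact k W.subtype W.mkQ W.injective_subtype W.mkQ_surjective
        (LinearMap.exact_subtype_mkQ W), h2, finrank_hom_eigenline hw hws]
      simp_rw [fun t => rangeDim_submodule (k := k) (he' t) W, mul_add, Finset.sum_add_distrib]
      congr 1
      rw [Finset.sum_eq_single s]
      · classical rw [rangeDim_eigenline hw hws, hχ.apply_eq]; simp
      · intro t _ hts
        classical rw [rangeDim_eigenline hw hws, hχ.apply_eq]; simp [Ne.symm hts]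
      · simp

/-- The dual of a left `A`-module, as a right `A`-module. -/
def RightDual (k W : Type*) [Field k] [AddCommGroup W] [Module k W] : Type _ := Module.Dual k W

section RightDual

variable (W : Type*) [AddCommGroup W] [Module k W]

instance : AddCommGroup (RightDual k W) := inferInstanceAs (AddCommGroup (Module.Dual k W))

instance : Module k (RightDual k W) := inferInstanceAs (Module k (Module.Dual k W))

instance [FiniteDimensional k W] : FiniteDimensional k (RightDual k W) :=
  inferInstanceAs (FiniteDimensional k (Module.Dual k W))

variable [Module A W] [IsScalarTower k A W]

instance : Module Aᵐᵒᵖ (RightDual k W) where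
  smul a φ := (show Module.Dual k W from φ) ∘ₗ Algebra.lsmul k k W a.unop
  one_smul φ := LinearMap.ext fun x =>
    congrArg (show Module.Dual k W from φ) (one_smul A x)
  mul_smul a b φ := LinearMap.ext fun x =>
    congrArg (show Module.Dual k W from φ) (mul_smul b.unop a.unop x)
  smul_zero a := rfl
  smul_add a φ φ' := rfl
  add_smul a b φ := LinearMap.ext fun x =>
    (congrArg (show Module.Dual k W from φ) (add_smul a.unop b.unop x)).trans (map_add _ _ _)
  zero_smul φ := LinearMap.ext fun x =>
    (congrArg (show Module.Dual k W from φ) (zero_smul A x)).trans (map_zero _)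

lemma op_smul_rightDual_apply (a : Aᵐᵒᵖ) (φ : RightDual k W) (x : W) :
    (show Module.Dual k W from a • φ) x = (show Module.Dual k W from φ) (a.unop • x) := rfl

instance : IsScalarTower k Aᵐᵒᵖ (RightDual k W) where
  smul_assoc c a φ := LinearMap.ext fun x => by
    refine (congrArg (show Module.Dual k W from φ) (smul_assoc c a.unop x)).trans ?_
    exact map_smul (show Module.Dual k W from φ) c _

lemma rangeDim_rightDual (a : A) : rangeDim k (op a) (RightDual k W) = rangeDim k a W :=
  LinearMap.finrank_range_dualMap_eq_finrank_range (Algebra.lsmul k k W a)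

end RightDual

/-! ### Dimension vectors of projective modules through the Cartan matrix. -/

section Cartan

variable {a : A}

/-- Homomorphisms into the dual of `A a`, for an idempotent `a`. -/
lemma finrank_hom_rightDual (ha : IsIdempotentElem a)
    (U : Type*) [AddCommGroup U] [Module k U] [Module Aᵐᵒᵖ U] [IsScalarTower k Aᵐᵒᵖ U]
    [FiniteDimensional k U] :
    Module.finrank k (U →ₗ[Aᵐᵒᵖ]
      RightDual k (LinearMap.range (LinearMap.toSpanSingleton A A a))) =
      rangeDim k (op a) U := by
  let W := LinearMap.range (LinearMap.toSpanSingleton A A a)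
  let X := LinearMap.range (Algebra.lsmul k k U (op a))
  -- A homomorphism `z` is recovered from the linear form `y ↦ z(y)(a)` on `U a`, because `z(u)(x a)
  -- = z(u x a)(a)`. This identifies the space of homomorphisms with the dual of `U a`.
  let a' : W := ⟨a, 1, one_smul A a⟩
  have hX : ∀ (u : U) (w : W), op (w : A) • u ∈ X := by
    rintro u ⟨_, x, rfl⟩
    exact ⟨op x • u, (mul_smul (op a) (op x) u).symm⟩
  let Φ : (U →ₗ[Aᵐᵒᵖ] RightDual k W) →ₗ[k] Module.Dual k X :=
    { toFun := fun z =>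
        { toFun := fun y => (show Module.Dual k W from z y) a'
          map_add' := fun y y' => by
            change (show Module.Dual k W from z (y + y')) a' = _
            rw [map_add]; rfl
          map_smul' := fun c y => by
            change (show Module.Dual k W from z (c • (y : U))) a' = _
            rw [LinearMap.map_smul_of_tower]; rfl }
      map_add' := fun _ _ => rfl
      map_smul' := fun _ _ => rfl }
  have hΦ : Function.Bijective Φ := by
    constructor
    · intro z z' h
      refine LinearMap.ext fun u => LinearMap.ext fun w => ?_
      have h1 : ∀ z : U →ₗ[Aᵐᵒᵖ] RightDual k W, (show Module.Dual k W from z u) w =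
          Φ z ⟨_, hX u w⟩ := by
        intro z
        change _ = (show Module.Dual k W from z (op (w : A) • u)) a'
        rw [map_smul, op_smul_rightDual_apply]
        congr 1
        obtain ⟨_, x, rfl⟩ := w
        refine Subtype.ext ?_
        change x * a = (x * a) * a
        rw [mul_assoc, ha.eq]
      rw [h1, h1, h]
    · intro ψ
      refine ⟨{ toFun := fun u =>
                  ({ toFun := fun w => ψ ⟨_, hX u w⟩
                     map_add' := fun w w' => ?_
                     map_smul' := fun c w => ?_ } : Module.Dual k W)
                map_add' := fun u u' => LinearMap.ext fun w => ?_
                map_smul' := fun b u => LinearMap.ext fun w => ?_ }, LinearMap.ext fun y => ?_⟩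
      · rw [← map_add]
        congr 1
        exact Subtype.ext (add_smul (op (w : A)) (op (w' : A)) u)
      · rw [← map_smul]
        congr 1
        exact Subtype.ext (smul_assoc c (op (w : A)) u)
      · change ψ _ = ψ _ + ψ _
        rw [← map_add]
        congr 1
        exact Subtype.ext (smul_add (op (w : A)) u u')
      · change ψ _ = ψ _
        congr 1
        exact Subtype.ext (mul_smul (op (w : A)) b u).symm
      · change ψ _ = ψ _
        congr 1
        obtain ⟨_, x, rfl⟩ := y
        refine Subtype.ext ?_
        change op a • op a • x = op a • x
        rw [← mul_smul, ← op_mul, ha.eq]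
  rw [(LinearEquiv.ofBijective Φ hΦ).finrank_eq, Subspace.dual_finrank_eq]
  rfl

/-- Both numbers are `dim (e_s A e_t)`; the first index of the Cartan matrix belongs to the
idempotent on the right. -/
lemma rangeDim_span_idempotent (e : Fin n → A) (s t : Fin n) :
    (rangeDim k (e s) (LinearMap.range (LinearMap.toSpanSingleton A A (e t))) : ℤ) =
      cartanMatrix k e t s := by
  let W := (LinearMap.range (LinearMap.toSpanSingleton A A (e t))).restrictScalars k
  have h := Submodule.finrank_map_subtype_eq W (LinearMap.range
    (Algebra.lsmul k k (LinearMap.range (LinearMap.toSpanSingleton A A (e t))) (e s)))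
  have hW : Submodule.map W.subtype (LinearMap.range
      (Algebra.lsmul k k (LinearMap.range (LinearMap.toSpanSingleton A A (e t))) (e s))) =
      LinearMap.range (LinearMap.mulLeft k (e s) ∘ₗ LinearMap.mulRight k (e t)) := by
    ext x
    constructor
    · rintro ⟨_, ⟨⟨_, y, rfl⟩, rfl⟩, rfl⟩
      exact ⟨y, rfl⟩
    · rintro ⟨y, rfl⟩
      exact ⟨_, ⟨⟨_, y, rfl⟩, rfl⟩, rfl⟩
  rw [hW] at h
  exact congrArg Nat.cast h.symm

/-- The formula of `IsDualFamily.finrank_hom` is evaluated at `Y = D(A e_t)`: the homomorphisms have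
dimension `dim (U e_t)`, and `dim (Y e_s) = dim (e_s A e_t)`. -/
theorem IsDualFamily.rangeDim_eq_mulVec [FiniteDimensional k A] (hχ : IsDualFamily e χ)
    (he : ∀ s, IsIdempotentElem (e s))
    (U : Type*) [AddCommGroup U] [Module k U] [Module Aᵐᵒᵖ U] [IsScalarTower k Aᵐᵒᵖ U]
    [FiniteDimensional k U] [Module.Projective Aᵐᵒᵖ U] :
    (fun t => (rangeDim k (op (e t)) U : ℤ)) =
      (cartanMatrix k e).mulVec fun s => (characterDim (χ s) U : ℤ) := by
  funext t
  have := FiniteDimensional.finiteDimensional_submodule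
    ((LinearMap.range (LinearMap.toSpanSingleton A A (e t))).restrictScalars k)
  have : FiniteDimensional k (LinearMap.range (LinearMap.toSpanSingleton A A (e t))) := this
  rw [← finrank_hom_rightDual (he t) U, hχ.finrank_hom he]
  push_cast
  refine Finset.sum_congr rfl fun s _ => ?_
  rw [rangeDim_rightDual, rangeDim_span_idempotent, mul_comm]

end Cartan

end EulerForm

/-! ### Invertibility of the Cartan matrix -/

section Determinant

variable {k A : Type u} [Field k] [Ring A] [Algebra k A]

lemma shortExact_ker_subtype {R : Type*} [Ring R] {F X : Type u} [AddCommGroup F] [Module R F]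
    [AddCommGroup X] [Module R X] (p : F →ₗ[R] X) (hp : Function.Surjective p) :
    (ShortComplex.mk (ModuleCat.ofHom (LinearMap.ker p).subtype) (ModuleCat.ofHom p)
      (by ext x; exact x.2)).ShortExact where
  exact := by
    rw [ShortComplex.ShortExact.moduleCat_exact_iff_function_exact]
    exact LinearMap.exact_subtype_ker_map p
  mono_f := (ModuleCat.mono_iff_injective _).2 (LinearMap.ker p).injective_subtype
  epi_g := (ModuleCat.epi_iff_surjective _).2 hp

variable {n : ℕ} {e : Fin n → A} {χ : Fin n → A →ₐ[k] k}

/-- Dimension shifting along a finite free cover `F → X` with kernel `K`: the dimension vector of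
`X` is that of `F` minus that of `K`, and `K` has smaller projective dimension. Thus `v` is an
alternating sum of integral vectors `c(U)` over a projective resolution. -/
theorem IsDualFamily.exists_rangeDim_eq_mulVec [FiniteDimensional k A] (hχ : IsDualFamily e χ)
    (he : ∀ s, IsIdempotentElem (e s)) (d : ℕ)
    (X : Type u) [AddCommGroup X] [Module k X] [Module Aᵐᵒᵖ X] [IsScalarTower k Aᵐᵒᵖ X]
    [FiniteDimensional k X] (hX : HasProjectiveDimensionLE (ModuleCat.of Aᵐᵒᵖ X) d) :
    ∃ v : Fin n → ℤ, (fun t => (rangeDim k (op (e t)) X : ℤ)) = (cartanMatrix k e).mulVec v := by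
  induction d generalizing X with
  | zero =>
    have h1 : Projective (ModuleCat.of Aᵐᵒᵖ X) :=
      projective_iff_hasProjectiveDimensionLT_one.2 hX
    have : Module.Projective Aᵐᵒᵖ X := (IsProjective.iff_projective X).2 h1
    exact ⟨_, hχ.rangeDim_eq_mulVec he X⟩
  | succ d ih =>
    have : Module.Finite Aᵐᵒᵖ X := Module.Finite.of_restrictScalars_finite k Aᵐᵒᵖ X
    obtain ⟨N, p, hp⟩ := Module.Finite.exists_fin' Aᵐᵒᵖ X
    have h1 : Projective (ModuleCat.of Aᵐᵒᵖ (Fin N → Aᵐᵒᵖ)) :=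
      (IsProjective.iff_projective _).1 inferInstance
    have hK : HasProjectiveDimensionLE (ModuleCat.of Aᵐᵒᵖ (LinearMap.ker p)) d :=
      ((shortExact_ker_subtype p hp).hasProjectiveDimensionLT_X₃_iff d h1).1 hX
    have : FiniteDimensional k (LinearMap.ker p) :=
      FiniteDimensional.finiteDimensional_submodule ((LinearMap.ker p).restrictScalars k)
    obtain ⟨v, hv⟩ := ih (LinearMap.ker p) hK
    refine ⟨(fun s => (characterDim (χ s) (Fin N → Aᵐᵒᵖ) : ℤ)) - v, ?_⟩
    rw [Matrix.mulVec_sub, ← hv, ← hχ.rangeDim_eq_mulVec he]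
    funext t
    have het : IsIdempotentElem (op (e t)) := by
      rw [IsIdempotentElem, ← op_mul, (he t).eq]
    have := rangeDim_of_exact (k := k) het (LinearMap.ker p).subtype p
      (LinearMap.ker p).injective_subtype hp (LinearMap.exact_subtype_ker_map p)
    simp only [Pi.sub_apply, this]
    push_cast
    ring

/-- The one-dimensional right module on which `A` acts through `χ`. -/
def CharacterModule (χ : A →ₐ[k] k) : Type u := k

section CharacterModule

variable (χ : A →ₐ[k] k)

instance : AddCommGroup (CharacterModule χ) := inferInstanceAs (AddCommGroup k)

instance : Module k (CharacterModule χ) := inferInstanceAs (Module k k)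

instance : FiniteDimensional k (CharacterModule χ) := inferInstanceAs (FiniteDimensional k k)

instance : Module Aᵐᵒᵖ (CharacterModule χ) where
  smul a x := χ a.unop • x
  one_smul x := by change χ 1 • x = x; rw [map_one, one_smul]
  mul_smul a b x := by
    change χ (b.unop * a.unop) • x = χ a.unop • χ b.unop • x
    rw [map_mul, mul_comm, mul_smul]
  smul_zero a := smul_zero (χ a.unop)
  smul_add a := smul_add (χ a.unop)
  add_smul a b x := by
    change χ (a.unop + b.unop) • x = χ a.unop • x + χ b.unop • x
    rw [map_add, add_smul]
  zero_smul x := by change χ 0 • x = 0; rw [map_zero, zero_smul]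

instance : IsScalarTower k Aᵐᵒᵖ (CharacterModule χ) where
  smul_assoc c a x := by
    change χ (c • a.unop) • x = c • χ a.unop • x
    rw [map_smul, smul_assoc]

lemma rangeDim_characterModule (a : A) [Decidable (χ a = 0)] :
    rangeDim k (op a) (CharacterModule χ) = if χ a = 0 then 0 else 1 := by
  have h : Algebra.lsmul k k (CharacterModule χ) (op a) = χ a • LinearMap.id :=
    LinearMap.ext fun x => rfl
  rw [rangeDim, h]
  split_ifs with h0
  · rw [h0, zero_smul, LinearMap.range_zero, finrank_bot]
  · rw [LinearMap.range_smul _ _ h0, LinearMap.range_id, finrank_top]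
    exact Module.finrank_self k

end CharacterModule

variable [FiniteDimensional k A]

/-- The one-dimensional modules of the characters have the standard basis as dimension vectors.
Their preimages under `C_A` are the columns of an integral right inverse. -/
theorem IsDualFamily.isUnit_det_cartanMatrix (hχ : IsDualFamily e χ)
    (he : ∀ s, IsIdempotentElem (e s)) (hgl : HasFiniteGlobalDimension A) :
    IsUnit (cartanMatrix k e).det := by
  classical
  obtain ⟨d, hd⟩ := hgl
  choose v hv using fun s => hχ.exists_rangeDim_eq_mulVec he d (CharacterModule (χ s)) (hd _)
  have h : cartanMatrix k e * (Matrix.of v).transpose = 1 := by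
    ext t s
    have h1 := congrFun (hv s) t
    rw [rangeDim_characterModule, hχ.apply_eq] at h1
    rw [Matrix.mul_apply', Matrix.one_apply]
    change (cartanMatrix k e).mulVec (v s) t = _
    rw [← h1]
    by_cases hst : s = t
    · simp [hst]
    · simp [hst, Ne.symm hst]
  exact Matrix.isUnit_det_of_right_inverse h

lemma finrank_range_comp_lsmul {R V : Type*} [Ring R] [Algebra k R] [AddCommGroup V] [Module k V]
    [Module R V] [IsScalarTower k R V] (a : V →ₗ[R] V) (r : R) :
    Module.finrank k (LinearMap.range (a.restrictScalars k ∘ₗ Algebra.lsmul k k V r)) =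
      rangeDim k r (LinearMap.range a) := by
  let W := (LinearMap.range a).restrictScalars k
  have h := Submodule.finrank_map_subtype_eq W (LinearMap.range
    (Algebra.lsmul k k (LinearMap.range a) r))
  have hW : Submodule.map W.subtype (LinearMap.range (Algebra.lsmul k k (LinearMap.range a) r)) =
      LinearMap.range (a.restrictScalars k ∘ₗ Algebra.lsmul k k V r) := by
    ext x
    constructor
    · rintro ⟨_, ⟨⟨_, y, rfl⟩, rfl⟩, rfl⟩
      exact ⟨y, a.map_smul r y⟩
    · rintro ⟨y, rfl⟩
      exact ⟨_, ⟨⟨_, y, rfl⟩, rfl⟩, (a.map_smul r y).symm⟩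
  rw [hW] at h
  exact h

/-- The dimension of a corner of `Hom_A(V, Y)`, for a projective right module `V`. -/
theorem IsDualFamily.finrank_range_hom (hχ : IsDualFamily e χ)
    (he : ∀ s, IsIdempotentElem (e s)) (hC : IsUnit (cartanMatrix k e).det)
    {V : Type*} [AddCommGroup V] [Module k V] [Module Aᵐᵒᵖ V] [IsScalarTower k Aᵐᵒᵖ V]
    [FiniteDimensional k V] [Module.Projective Aᵐᵒᵖ V]
    {Y : Type u} [AddCommGroup Y] [Module k Y] [Module Aᵐᵒᵖ Y] [IsScalarTower k Aᵐᵒᵖ Y]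
    [FiniteDimensional k Y]
    (a : V →ₗ[Aᵐᵒᵖ] V) (b : Y →ₗ[Aᵐᵒᵖ] Y) (ha : ∀ x, a (a x) = a x) (hb : ∀ x, b (b x) = b x)
    (T : (V →ₗ[Aᵐᵒᵖ] Y) →ₗ[k] (V →ₗ[Aᵐᵒᵖ] Y)) (hT : ∀ z x, T z x = b (z (a x))) :
    (Module.finrank k (LinearMap.range T) : ℤ) =
      dotProduct ((cartanMatrix k e)⁻¹.mulVec fun t =>
        (Module.finrank k (LinearMap.range
          (a.restrictScalars k ∘ₗ Algebra.lsmul k k V (op (e t)))) : ℤ))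
        fun s => (Module.finrank k (LinearMap.range
          (b.restrictScalars k ∘ₗ Algebra.lsmul k k Y (op (e s)))) : ℤ) := by
  have : Module.Projective Aᵐᵒᵖ (LinearMap.range a) := projective_range_idempotent a ha
  have : FiniteDimensional k (LinearMap.range a) :=
    FiniteDimensional.finiteDimensional_submodule ((LinearMap.range a).restrictScalars k)
  have : FiniteDimensional k (LinearMap.range b) :=
    FiniteDimensional.finiteDimensional_submodule ((LinearMap.range b).restrictScalars k)
  simp_rw [finrank_range_comp_lsmul]
  -- The image of `T` is `Hom(aV, bY)` up to isomorphism, and `aV` is still projective, so its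
  -- multiplicity vector is `C_A⁻¹` applied to its dimension vector.
  rw [finrank_range_hom_idempotent a b ha hb T hT, hχ.finrank_hom he, hχ.rangeDim_eq_mulVec he,
    Matrix.mulVec_mulVec, Matrix.nonsing_inv_mul _ hC, Matrix.one_mulVec]
  push_cast
  rfl

end Determinant

/-! ### Cohomology of complexes of modules -/

section QuasiIso

open CochainComplex HomComplex

variable {R : Type u} [Ring R]

/-- Being a quasi-isomorphism can be tested on underlying abelian groups, so the inverse and the
homotopies need only be additive. This matters because a homotopy inverse over `A` need not commute
with the action of `B`. -/
lemma quasiIso_of_additive_homotopyEquiv {X Y : CochainComplex (ModuleCat.{u} R) ℤ} (φ : X ⟶ Y)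
    (ψ : ∀ n, Y.X n →+ X.X n)
    (hψ : ∀ n m (_ : n + 1 = m) y, ψ m ((Y.d n m).hom y) = (X.d n m).hom (ψ n y))
    (s : ∀ n m (_ : n + (-1) = m), X.X n →+ X.X m)
    (t : ∀ n m (_ : n + (-1) = m), Y.X n →+ Y.X m)
    (hs : ∀ l n m (h : l + 1 = n) (h' : n + 1 = m) x, ψ n ((φ.f n).hom x) =
      (X.d l n).hom (s n l (by omega) x) + s m n (by omega) ((X.d n m).hom x) + x)
    (ht : ∀ l n m (h : l + 1 = n) (h' : n + 1 = m) y, (φ.f n).hom (ψ n y) =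
      (Y.d l n).hom (t n l (by omega) y) + t m n (by omega) ((Y.d n m).hom y) + y) :
    QuasiIso φ := by
  let F := forget₂ (ModuleCat.{u} R) AddCommGrpCat.{u}
  let Ψ : (F.mapHomologicalComplex (ComplexShape.up ℤ)).obj Y ⟶
      (F.mapHomologicalComplex (ComplexShape.up ℤ)).obj X :=
    { f := fun n => AddCommGrpCat.ofHom (ψ n)
      comm' := fun n m h => AddCommGrpCat.hom_ext (AddMonoidHom.ext fun y => (hψ n m h y).symm) }
  let E : HomotopyEquiv ((F.mapHomologicalComplex (ComplexShape.up ℤ)).obj X)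
      ((F.mapHomologicalComplex (ComplexShape.up ℤ)).obj Y) :=
    { hom := (F.mapHomologicalComplex _).map φ
      inv := Ψ
      homotopyHomInvId := (Cochain.equivHomotopy _ _).symm
        ⟨Cochain.mk fun n m h => AddCommGrpCat.ofHom (s n m h), by
          ext n x
          rw [Cochain.add_v, δ_v (-1) 0 (by simp) _ n n (by simp) (n - 1) (n + 1) rfl rfl]
          refine (hs (n - 1) n (n + 1) (by omega) rfl x).trans ?_
          simp
          rfl⟩
      homotopyInvHomId := (Cochain.equivHomotopy _ _).symm
        ⟨Cochain.mk fun n m h => AddCommGrpCat.ofHom (t n m h), by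
          ext n x
          rw [Cochain.add_v, δ_v (-1) 0 (by simp) _ n n (by simp) (n - 1) (n + 1) rfl rfl]
          refine (ht (n - 1) n (n + 1) (by omega) rfl x).trans ?_
          simp
          rfl⟩ }
  have h : QuasiIso ((F.mapHomologicalComplex (ComplexShape.up ℤ)).map φ) := E.quasiIso_hom
  exact (HomologicalComplex.quasiIso_map_iff_of_preservesHomology φ F).1 h

end QuasiIso

/-! ### Euler characteristics of the idempotent parts of a complex. -/

section EulerCharacteristic

variable {k R : Type u} [Field k] [Ring R] [Algebra k R]

/-- The summand is `u l - u (l - 1)` for `u l = (-1)^l b l`, and `u` has finite support. -/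
lemma finsum_negOnePow_add_shift (b : ℤ → ℤ) (hb : (Function.support b).Finite) :
    ∑ᶠ l : ℤ, (l.negOnePow : ℤ) * (b l + b (l - 1)) = 0 := by
  have h1 : ∀ l : ℤ, (l.negOnePow : ℤ) * (b l + b (l - 1)) =
      (l.negOnePow : ℤ) * b l - ((l - 1).negOnePow : ℤ) * b (l - 1) := fun l => by
    rw [Int.negOnePow_sub, Int.negOnePow_one]
    push_cast
    ring
  have hb1 : (Function.support fun l : ℤ => (l.negOnePow : ℤ) * b l).Finite :=
    hb.subset (Function.support_mul_subset_right _ _)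
  have hb2 : (Function.support fun l : ℤ => ((l - 1).negOnePow : ℤ) * b (l - 1)).Finite :=
    hb1.preimage (f := fun l : ℤ => l - 1) (sub_left_injective.injOn)
  simp_rw [h1]
  rw [finsum_sub_distrib hb1 hb2, sub_eq_zero]
  exact (finsum_comp_equiv (Equiv.subRight (1 : ℤ))).symm

variable (X : CochainComplex (ModuleCat.{u} R) ℤ)

lemma rangeDim_ker_add_range {X₂ X₃ : Type*} [AddCommGroup X₂] [Module k X₂] [Module R X₂]
    [IsScalarTower k R X₂] [AddCommGroup X₃] [Module k X₃] [Module R X₃] [IsScalarTower k R X₃]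
    [FiniteDimensional k X₂] (g : X₂ →ₗ[R] X₃) {r : R} (hr : IsIdempotentElem r) :
    rangeDim k r X₂ = rangeDim k r (LinearMap.ker g) + rangeDim k r (LinearMap.range g) := by
  have h : Function.Exact (LinearMap.ker g).subtype g.rangeRestrict :=
    LinearMap.exact_iff.2 (by rw [LinearMap.ker_rangeRestrict, Submodule.range_subtype])
  exact rangeDim_of_exact hr (LinearMap.ker g).subtype g.rangeRestrict
    (Submodule.injective_subtype _) (LinearMap.surjective_rangeRestrict g) h

lemma rangeDim_range_subtype_comp {X₁ X₂ : Type*} [AddCommGroup X₁] [Module R X₁] [AddCommGroup X₂]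
    [Module k X₂] [Module R X₂] [IsScalarTower k R X₂] (W : Submodule R X₂)
    (f : X₁ →ₗ[R] X₂) (f' : X₁ →ₗ[R] W) (hf : ∀ x, (f' x : X₂) = f x) (r : R) :
    rangeDim k r (LinearMap.range f') = rangeDim k r (LinearMap.range f) := by
  have h : (LinearMap.range f').map W.subtype = LinearMap.range f := by
    rw [← LinearMap.range_comp]
    exact congrArg _ (LinearMap.ext hf)
  exact rangeDim_congr r ((Submodule.equivMapOfInjective W.subtype W.injective_subtype _).trans
    (LinearEquiv.ofEq _ _ h))

lemma rangeDim_ker_quotient {X₁ X₂ X₃ : Type*} [AddCommGroup X₁] [Module R X₁] [AddCommGroup X₂]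
    [Module k X₂] [Module R X₂] [IsScalarTower k R X₂] [AddCommGroup X₃] [Module k X₃]
    [Module R X₃] [IsScalarTower k R X₃] [FiniteDimensional k X₂] (f : X₁ →ₗ[R] X₂)
    (g : X₂ →ₗ[R] X₃) (f' : X₁ →ₗ[R] LinearMap.ker g) (hf : ∀ x, (f' x : X₂) = f x) {r : R}
    (hr : IsIdempotentElem r) :
    FiniteDimensional k (LinearMap.ker g ⧸ LinearMap.range f') ∧
    rangeDim k r X₂ = rangeDim k r (LinearMap.ker g ⧸ LinearMap.range f') +
      rangeDim k r (LinearMap.range f) + rangeDim k r (LinearMap.range g) := by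
  have : FiniteDimensional k (LinearMap.ker g) :=
    FiniteDimensional.finiteDimensional_submodule ((LinearMap.ker g).restrictScalars k)
  refine ⟨Module.Finite.quotient k (LinearMap.range f'), ?_⟩
  rw [rangeDim_ker_add_range g hr, rangeDim_submodule (k := k) hr (LinearMap.range f'),
    rangeDim_range_subtype_comp _ f f' hf r,
    add_comm (rangeDim k r (LinearMap.range f))]

lemma rangeDim_homology [hX : ∀ l, FiniteDimensional k (X.X l)] {r : R} (hr : IsIdempotentElem r)
    (l n m : ℤ) (h : l + 1 = n) (h' : n + 1 = m) :
    FiniteDimensional k (X.homology n) ∧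
    rangeDim k r (X.X n) = rangeDim k r (X.homology n) +
      rangeDim k r (LinearMap.range (X.d l n).hom) +
      rangeDim k r (LinearMap.range (X.d n m).hom) := by
  let f' : X.X l →ₗ[R] LinearMap.ker (X.d n m).hom := (X.sc' l n m).moduleCatToCycles
  let e : X.homology n ≃ₗ[R] (LinearMap.ker (X.d n m).hom ⧸ LinearMap.range f') :=
    ((X.homologyIsoSc' l n m (by simp [← h]) (by simp [h'])).trans
      (X.sc' l n m).moduleCatHomologyIso).toLinearEquiv
  obtain ⟨h1, h2⟩ := rangeDim_ker_quotient (k := k) (X.d l n).hom (X.d n m).hom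
    f' (fun _ => rfl) hr
  refine ⟨Module.Finite.equiv (LinearEquiv.restrictScalars k e.symm), ?_⟩
  rw [rangeDim_congr r e]
  exact h2

/-- In each degree a term exceeds its cohomology by the ranks of the outgoing and incoming
differentials, `b l + b (l - 1)`, and these cancel in the alternating sum. -/
theorem finsum_rangeDim_homology [∀ l, FiniteDimensional k (X.X l)] {r : R}
    (hr : IsIdempotentElem r) (s : Set ℤ) (hs : s.Finite) (hX : ∀ l, l ∉ s → Subsingleton (X.X l)) :
    ∑ᶠ l : ℤ, (l.negOnePow : ℤ) * (rangeDim k r (X.homology l) : ℤ) =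
      ∑ᶠ l : ℤ, (l.negOnePow : ℤ) * (rangeDim k r (X.X l) : ℤ) := by
  let b : ℤ → ℤ := fun l => rangeDim k r (LinearMap.range (X.d l (l + 1)).hom)
  have hx0 : ∀ l, l ∉ s → rangeDim k r (X.X l) = 0 := fun l hl => by
    have := hX l hl
    exact rangeDim_of_subsingleton r
  have hb : (Function.support b).Finite := hs.subset fun l hl => by
    by_contra h
    have := hX l h
    refine hl ?_
    have : Subsingleton (LinearMap.range (X.d l (l + 1)).hom) := by
      rw [LinearMap.range_eq_bot.2 (LinearMap.ext fun x => by rw [Subsingleton.elim x 0, map_zero,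
        map_zero])]
      infer_instance
    exact congrArg Nat.cast (rangeDim_of_subsingleton r)
  have hl : ∀ l : ℤ, (rangeDim k r (X.X l) : ℤ) =
      rangeDim k r (X.homology l) + (b l + b (l - 1)) := fun l => by
    obtain ⟨m, rfl⟩ : ∃ m, l = m + 1 := ⟨l - 1, by ring⟩
    rw [(rangeDim_homology X hr m (m + 1) (m + 1 + 1) rfl rfl).2]
    simp only [b, add_sub_cancel_right]
    push_cast
    ring
  have hsupp : (Function.support fun l : ℤ => (l.negOnePow : ℤ) *
      (rangeDim k r (X.homology l) : ℤ)).Finite := hs.subset fun l hl' => by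
    by_contra h
    have h1 := hx0 l h
    rw [(rangeDim_homology X hr (l - 1) l (l + 1) (by ring) rfl).2] at h1
    exact hl' (by
      change _ * ((rangeDim k r (X.homology l) : ℕ) : ℤ) = 0
      rw [show rangeDim k r (X.homology l) = 0 by omega, Nat.cast_zero, mul_zero])
  have hsupp' : (Function.support fun l : ℤ => (l.negOnePow : ℤ) * (b l + b (l - 1))).Finite := by
    refine Set.Finite.subset (hb.union (hb.preimage (f := fun l : ℤ => l - 1)
      sub_left_injective.injOn)) fun l hl => ?_
    by_contra h
    simp only [Set.mem_union, Function.mem_support, Set.mem_preimage, not_or, not_not] at h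
    exact hl (by simp [h.1, h.2])
  simp_rw [hl, mul_add (_ : ℤ) ((rangeDim k r (X.homology _) : ℕ) : ℤ)]
  rw [finsum_add_distrib hsupp hsupp', finsum_negOnePow_add_shift b hb, add_zero]

end EulerCharacteristic

/-! ### Homotopically projective complexes of bimodules -/

section KProjective

/-- A map from `F K` to an acyclic `Y` is `F g` followed by the counit, where `g : K ⟶ G Y` is its
adjoint. As `G` is exact, `G Y` is acyclic, so `g` is null-homotopic, and hence so is the original
map. -/
lemma isKProjective_of_adjunction {D E : Type*} [Category* D] [Abelian D] [Category* E] [Abelian E]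
    {F : D ⥤ E} {G : E ⥤ D} [F.Additive] [G.Additive] (adj : F ⊣ G) [G.PreservesHomology]
    (K : CochainComplex D ℤ) [K.IsKProjective] :
    CochainComplex.IsKProjective ((F.mapHomologicalComplex (ComplexShape.up ℤ)).obj K) where
  nonempty_homotopy_zero {Y} f hY := by
    let GY : CochainComplex D ℤ := (G.mapHomologicalComplex (ComplexShape.up ℤ)).obj Y
    let g : K ⟶ GY :=
      { f := fun i => adj.homEquiv _ _ (f.f i)
        comm' := fun i j _ => (adj.homEquiv_naturality_right (f.f i) (Y.d i j)).symm.trans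
          ((congrArg (adj.homEquiv _ _) (f.comm i j)).trans
            (adj.homEquiv_naturality_left (K.d i j) (f.f j))) }
    let ε : (F.mapHomologicalComplex (ComplexShape.up ℤ)).obj GY ⟶ Y :=
      { f := fun i => adj.counit.app (Y.X i)
        comm' := fun i j _ => (adj.counit.naturality (Y.d i j)).symm }
    have hGY : GY.Acyclic := fun i => by
      rw [HomologicalComplex.exactAt_iff]
      exact ((HomologicalComplex.exactAt_iff Y i).1 (hY i)).map G
    have hf : f = (F.mapHomologicalComplex (ComplexShape.up ℤ)).map g ≫ ε := by
      ext i
      exact ((adj.homEquiv_counit (g := adj.homEquiv _ _ (f.f i))).symm.trans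
        ((adj.homEquiv _ _).symm_apply_apply _)).symm
    have h := (F.mapHomotopy (CochainComplex.IsKProjective.homotopyZero g hGY)).compRight ε
    exact ⟨(Homotopy.ofEq hf).trans (h.trans (Homotopy.ofEq (by simp)))⟩

variable {R S : Type u} [Ring R] [Ring S] (φ : R →+* S)

/-- Coextension is `Hom_R(S, -)`, so surjections are preserved when `S` is projective over `R`. -/
lemma coextendScalars_preservesEpimorphisms
    [h : Module.Projective R ((ModuleCat.restrictScalars φ).obj (ModuleCat.of S S))] :
    (ModuleCat.coextendScalars.{u, u, u} φ).PreservesEpimorphisms where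
  preserves {X Y} f hf := by
    rw [ModuleCat.epi_iff_surjective] at hf ⊢
    intro z
    obtain ⟨y, hy⟩ := Module.projective_lifting_property f.hom
      (ModuleCat.CoextendScalars.equiv _ _ z) hf
    refine ⟨(ModuleCat.CoextendScalars.equiv _ _).symm y, ?_⟩
    exact (ModuleCat.CoextendScalars.equiv _ _).injective hy

instance coextendScalars_additive : (ModuleCat.coextendScalars.{u, u, u} φ).Additive :=
  (ModuleCat.restrictCoextendScalarsAdj.{u, u, u} φ).right_adjoint_additive

lemma coextendScalars_preservesHomology
    [h : Module.Projective R ((ModuleCat.restrictScalars φ).obj (ModuleCat.of S S))] :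
    (ModuleCat.coextendScalars.{u, u, u} φ).PreservesHomology := by
  have := coextendScalars_preservesEpimorphisms φ
  have : Limits.PreservesLimitsOfSize.{0, 0} (ModuleCat.coextendScalars.{u, u, u} φ) :=
    (ModuleCat.restrictCoextendScalarsAdj.{u, u, u} φ).rightAdjoint_preservesLimits
  have : ∀ {X Y : ModuleCat.{u} R} (f : X ⟶ Y), Limits.PreservesLimit
      (Limits.parallelPair f 0) (ModuleCat.coextendScalars.{u, u, u} φ) := fun f =>
    this.preservesLimitsOfShape.preservesLimit
  exact Functor.preservesHomology_of_preservesEpis_and_kernels _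

lemma restrictScalars_preservesHomology :
    (ModuleCat.restrictScalars.{u, u, u} φ).PreservesHomology :=
  Functor.preservesHomology_of_map_exact _ fun S hS => by
    rw [ShortComplex.ShortExact.moduleCat_exact_iff_function_exact] at hS ⊢
    exact hS

variable (k A B : Type u) [Field k] [Ring A] [Algebra k A] [Ring B] [Algebra k B]

/-- As a module over `Aᵐᵒᵖ` this is the base change of the `k`-vector space `B`, hence free. -/
instance projective_rightRestrict_self : Module.Projective Aᵐᵒᵖ
    ((rightRestrict k A B).obj (ModuleCat.of (B ⊗[k] Aᵐᵒᵖ) (B ⊗[k] Aᵐᵒᵖ))) := by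
  let ψ : Aᵐᵒᵖ ⊗[k] B ≃ₗ[Aᵐᵒᵖ]
      (rightRestrict k A B).obj (ModuleCat.of (B ⊗[k] Aᵐᵒᵖ) (B ⊗[k] Aᵐᵒᵖ)) :=
    { (TensorProduct.comm k Aᵐᵒᵖ B).toAddEquiv with
      map_smul' := fun a x => by
        change TensorProduct.comm k Aᵐᵒᵖ B (a • x) =
          ((1 : B) ⊗ₜ[k] a) * TensorProduct.comm k Aᵐᵒᵖ B x
        induction x with
        | zero => simp
        | add x y hx hy => rw [smul_add, map_add, hx, hy, map_add, mul_add]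
        | tmul x y => simp [TensorProduct.smul_tmul'] }
  exact Module.Projective.of_equiv ψ

variable {k A B}

lemma projective_rightRestrict (V : Bimod k A B) [hV : Projective V] :
    Module.Projective Aᵐᵒᵖ ((rightRestrict k A B).obj V) := by
  have := coextendScalars_preservesEpimorphisms
    (Algebra.TensorProduct.includeRight : Aᵐᵒᵖ →ₐ[k] B ⊗[k] Aᵐᵒᵖ).toRingHom
  have h := (ModuleCat.restrictCoextendScalarsAdj.{u, u, u}
    (Algebra.TensorProduct.includeRight : Aᵐᵒᵖ →ₐ[k] B ⊗[k] Aᵐᵒᵖ).toRingHom).map_projective V hV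
  exact (IsProjective.iff_projective _).2 h

lemma isKProjective_rightComplex (P : CochainComplex (Bimod k A B) ℤ) [P.IsKProjective] :
    (rightComplex P).IsKProjective := by
  have := coextendScalars_preservesHomology
    (Algebra.TensorProduct.includeRight : Aᵐᵒᵖ →ₐ[k] B ⊗[k] Aᵐᵒᵖ).toRingHom
  exact isKProjective_of_adjunction (ModuleCat.restrictCoextendScalarsAdj.{u, u, u}
    (Algebra.TensorProduct.includeRight : Aᵐᵒᵖ →ₐ[k] B ⊗[k] Aᵐᵒᵖ).toRingHom) P

open DerivedCategory in
attribute [local instance] HasDerivedCategory.standard in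
-- The isomorphism `π` followed by `q⁻¹` in the derived category comes from a morphism of complexes:
-- out of a K-projective `P`, morphisms in the homotopy and derived categories agree.
lemma exists_quasiIso_lift {D : Type*} [Category* D] [Abelian D] {P Q M : CochainComplex D ℤ}
    [P.IsKProjective] (π : P ⟶ M) [QuasiIso π] (q : Q ⟶ M) [QuasiIso q] :
    ∃ α : P ⟶ Q, QuasiIso α := by
  obtain ⟨g, hg⟩ := (CochainComplex.IsKProjective.Qh_map_bijective P
    ((HomotopyCategory.quotient _ _).obj Q)).surjective
    ((quotientCompQhIso D).hom.app P ≫ DerivedCategory.Q.map π ≫ inv (DerivedCategory.Q.map q) ≫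
      (quotientCompQhIso D).inv.app Q)
  obtain ⟨α, rfl⟩ := (HomotopyCategory.quotient _ _).map_surjective g
  refine ⟨α, ?_⟩
  rw [← isIso_Q_map_iff_quasiIso]
  have h : DerivedCategory.Q.map α = DerivedCategory.Q.map π ≫ inv (DerivedCategory.Q.map q) := by
    rw [← cancel_epi ((quotientCompQhIso D).hom.app P),
      ← cancel_mono ((quotientCompQhIso D).inv.app Q), Category.assoc, Category.assoc,
      Category.assoc, ← hg]
    rw [quotientCompQhIso_inv_naturality, Iso.hom_inv_id_app_assoc]
  rw [h]
  infer_instance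

/-- A homotopically projective resolution is, over `A`, homotopy equivalent to any bounded above
resolution by bimodules that are projective over `A`. -/
theorem HProjResolution.exists_homotopyEquiv {M : CochainComplex (Bimod k A B) ℤ}
    (P : HProjResolution M) (Q : CochainComplex (Bimod k A B) ℤ) (b : ℤ) [Q.IsStrictlyLE b]
    (hQ : ∀ l, Module.Projective Aᵐᵒᵖ ((rightRestrict k A B).obj (Q.X l))) (q : Q ⟶ M)
    [QuasiIso q] :
    ∃ (α : P.complex ⟶ Q) (e : HomotopyEquiv (rightComplex P.complex) (rightComplex Q)),
      e.hom = ((rightRestrict k A B).mapHomologicalComplex _).map α := by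
  have := P.isKProjective
  have := P.quasiIso
  obtain ⟨α, hα⟩ := exists_quasiIso_lift P.π q
  have := isKProjective_rightComplex P.complex
  have : ∀ l, Projective ((rightComplex Q).X l) := fun l =>
    (IsProjective.iff_projective ((rightRestrict k A B).obj (Q.X l))).1 (hQ l)
  have : (rightComplex Q).IsStrictlyLE b := by
    rw [CochainComplex.isStrictlyLE_iff]
    intro i hi
    exact (rightRestrict k A B).map_isZero (Q.isZero_of_isStrictlyLE b i hi)
  have := CochainComplex.isKProjective_of_projective (rightComplex Q) b
  have : QuasiIso (((rightRestrict k A B).mapHomologicalComplex (ComplexShape.up ℤ)).map α) := by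
    have := restrictScalars_preservesHomology
      (Algebra.TensorProduct.includeRight : Aᵐᵒᵖ →ₐ[k] B ⊗[k] Aᵐᵒᵖ).toRingHom
    exact (HomologicalComplex.quasiIso_map_iff_of_preservesHomology α _).2 hα
  -- A quasi-isomorphism between K-projective complexes is a homotopy equivalence. This is applied
  -- after restriction to `A`, where both complexes are K-projective.
  obtain ⟨e, he⟩ := (CochainComplex.IsKProjective.quasiIso_iff
    (K := rightComplex P.complex) (L := rightComplex Q)
    (((rightRestrict k A B).mapHomologicalComplex (ComplexShape.up ℤ)).map α)).1 this
  exact ⟨α, e, he⟩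

end KProjective

/-! ### The complex `Hom_A(P, N)` -/

section HomComplexInvariance

open CochainComplex HomComplex

variable {k A B C : Type u} [Field k] [Ring A] [Algebra k A] [Ring B] [Algebra k B]
  [Ring C] [Algebra k C]
  {P Q : CochainComplex (Bimod k A B) ℤ}

lemma leftMul_comp_map (α : P ⟶ Q) (b : B) :
    leftMul P b ≫ ((rightRestrict k A B).mapHomologicalComplex _).map α =
      ((rightRestrict k A B).mapHomologicalComplex _).map α ≫ leftMul Q b := by
  ext i x
  exact (α.f i).hom.map_smul (b ⊗ₜ[k] (1 : Aᵐᵒᵖ)) (show P.X i from x)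

section Precomp

variable {D : Type*} [Category* D] [Preadditive D] {K K' L : CochainComplex D ℤ}

/-- Precomposition with a cochain. -/
def cochainPrecomp {r : ℤ} (γ : Cochain K K' r) (L : CochainComplex D ℤ) {n m : ℤ}
    (h : r + n = m) : Cochain K' L n →+ Cochain K L m :=
  AddMonoidHom.mk' (fun z => γ.comp z h) (fun _ _ => Cochain.comp_add _ _ _ _)

/-- For a homotopy `H`, of degree -1, the Leibniz rule reads `δ(H z) = H δz + (-1)^n (β - 1) z`.
Solving for `β z` forces the sign `(-1)^n` on `H` in degree `n`, and `(-1)^(n+1)` in the next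
degree. -/
lemma cochainPrecomp_homotopy {β : K ⟶ K} (H : Homotopy β (𝟙 K)) {l n m : ℤ} (hl : l + 1 = n)
    (hm : n + 1 = m) (z : Cochain K L n) :
    (Cochain.ofHom β).comp z (zero_add n) =
      δ l n ((n.negOnePow • Cochain.ofHomotopy H).comp z (by omega : -1 + n = l)) +
      (m.negOnePow • Cochain.ofHomotopy H).comp (δ n m z) (by omega : -1 + m = n) + z := by
  rw [Cochain.units_smul_comp, Cochain.units_smul_comp, δ_units_smul,
    δ_comp _ z _ 0 m n (by omega) (by omega) (by omega), δ_ofHomotopy]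
  obtain rfl : m = n + 1 := hm.symm
  rw [Int.negOnePow_succ]
  simp [smul_smul, Cochain.sub_comp]

end Precomp

/-- The map on `Hom_A(-, N)` induced by a morphism of complexes of bimodules. -/
def homComplexPrecomp (α : P ⟶ Q) (N : CochainComplex (Bimod k A C) ℤ) :
    homComplex Q N ⟶ homComplex P N where
  f n := ModuleCat.ofHom (X := HomCochain Q N n) (Y := HomCochain P N n)
    { cochainPrecomp (Cochain.ofHom (((rightRestrict k A B).mapHomologicalComplex _).map α))
        (rightComplex N) (zero_add n) with
      map_smul' := fun r z => by
        change (Cochain.ofHom (((rightRestrict k A B).mapHomologicalComplex _).map α)).comp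
          (r • z) (zero_add n) = r • (Cochain.ofHom
            (((rightRestrict k A B).mapHomologicalComplex _).map α)).comp z (zero_add n)
        induction r with
        | zero =>
          have h0 : ∀ {K : CochainComplex (Bimod k A B) ℤ} (z : HomCochain K N n),
            (0 : C ⊗[k] Bᵐᵒᵖ) • z = 0 := fun z => by
              change homAction _ N n 0 z = 0
              rw [map_zero]
              rfl
          exact (congrArg (fun w => Cochain.comp _ w (zero_add n)) (h0 z)).trans
            ((Cochain.comp_zero _ _).trans (h0 _).symm)
        | add r r' h h' => rw [add_smul, add_smul, Cochain.comp_add, h, h']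
        | tmul c b =>
          obtain ⟨b, rfl⟩ := op_surjective b
          rw [hom_tmul_smul, hom_tmul_smul, ← Cochain.comp_assoc_of_third_is_zero_cochain,
            ← Cochain.comp_assoc_of_first_is_zero_cochain, ← Cochain.ofHom_comp,
            ← leftMul_comp_map, Cochain.ofHom_comp, Cochain.comp_assoc_of_first_is_zero_cochain,
            Cochain.comp_assoc_of_first_is_zero_cochain,
            Cochain.comp_assoc_of_third_is_zero_cochain,
            Cochain.comp_assoc_of_first_is_zero_cochain] }
  comm' n m h := by
    ext z : 2
    exact δ_ofHom_comp (((rightRestrict k A B).mapHomologicalComplex _).map α)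
      (show HomCochain Q N n from z) m

lemma homComplexPrecomp_quasiIso (α : P ⟶ Q) (N : CochainComplex (Bimod k A C) ℤ)
    (e : HomotopyEquiv (rightComplex P) (rightComplex Q))
    (he : e.hom = ((rightRestrict k A B).mapHomologicalComplex _).map α) :
    QuasiIso (homComplexPrecomp α N) := by
  refine quasiIso_of_additive_homotopyEquiv _
    (fun n => cochainPrecomp (Cochain.ofHom e.inv) (rightComplex N) (zero_add n))
    (fun n m h (z : HomCochain P N n) => (δ_ofHom_comp e.inv z m).symm)
    -- By contravariance, the homotopy on `Hom_A(Q, N)` comes from the composite on `Q`, and the one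
    -- on `Hom_A(P, N)` from the composite on `P`.
    (fun n m h => cochainPrecomp (n.negOnePow • Cochain.ofHomotopy e.homotopyInvHomId)
      (rightComplex N) ((add_comm _ _).trans h))
    (fun n m h => cochainPrecomp (n.negOnePow • Cochain.ofHomotopy e.homotopyHomInvId)
      (rightComplex N) ((add_comm _ _).trans h)) ?_ ?_
  · intro l n m h h' (z : HomCochain Q N n)
    refine Eq.trans ?_ (cochainPrecomp_homotopy e.homotopyInvHomId h h' z)
    rw [Cochain.ofHom_comp, he]
    exact (Cochain.comp_assoc_of_first_is_zero_cochain (Cochain.ofHom e.inv)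
      (Cochain.ofHom (((rightRestrict k A B).mapHomologicalComplex _).map α)) z _).symm
  · intro l n m h h' (z : HomCochain P N n)
    refine Eq.trans ?_ (cochainPrecomp_homotopy e.homotopyHomInvId h h' z)
    rw [Cochain.ofHom_comp, he]
    exact (Cochain.comp_assoc_of_first_is_zero_cochain
      (Cochain.ofHom (((rightRestrict k A B).mapHomologicalComplex _).map α))
      (Cochain.ofHom e.inv) z _).symm

end HomComplexInvariance

/-! ### Dimensions of the terms of `Hom_A(P, N)` -/

section HomDimension

open CochainComplex HomComplex

lemma finrank_range_pi {k ι : Type*} [Field k] [Fintype ι] {M : ι → Type*}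
    [∀ i, AddCommGroup (M i)] [∀ i, Module k (M i)] [∀ i, FiniteDimensional k (M i)]
    (T : ∀ i, M i →ₗ[k] M i) (T' : (∀ i, M i) →ₗ[k] (∀ i, M i)) (hT : ∀ x i, T' x i = T i (x i)) :
    Module.finrank k (LinearMap.range T') = ∑ i, Module.finrank k (LinearMap.range (T i)) := by
  let Φ : (∀ i, LinearMap.range (T i)) →ₗ[k] (∀ i, M i) :=
    LinearMap.pi fun i => (LinearMap.range (T i)).subtype ∘ₗ LinearMap.proj i
  have hΦ : Function.Injective Φ := fun x y h => funext fun i => Subtype.ext (congrFun h i)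
  have hr : LinearMap.range T' = LinearMap.range Φ := by
    ext y
    constructor
    · rintro ⟨x, rfl⟩
      exact ⟨fun i => ⟨T i (x i), x i, rfl⟩, funext fun i => (hT x i).symm⟩
    · rintro ⟨x, rfl⟩
      choose z hz using fun i => (x i).2
      exact ⟨z, funext fun i => (hT z i).trans (hz i)⟩
  rw [hr, LinearMap.finrank_range_of_inj hΦ, Module.finrank_pi_fintype]

variable {k A B C : Type u} [Field k] [Ring A] [Algebra k A] [Ring B] [Algebra k B]
  [Ring C] [Algebra k C]

lemma tmul_algebraMap_smul (V : Bimod k A B) (c : k) (x : V) :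
    ((1 : B) ⊗ₜ[k] algebraMap k Aᵐᵒᵖ c) • x = c • x := by
  rw [← algebraMap_smul (B ⊗[k] Aᵐᵒᵖ) c x, Algebra.TensorProduct.algebraMap_apply']

lemma algebraMap_tmul_smul (V : Bimod k A B) (c : k) (x : V) :
    (algebraMap k B c ⊗ₜ[k] (1 : Aᵐᵒᵖ)) • x = c • x := by
  rw [← algebraMap_smul (B ⊗[k] Aᵐᵒᵖ) c x, Algebra.TensorProduct.algebraMap_apply]

/-- The identity, as a `k`-linear map from the underlying right module of a bimodule. -/
def rightRestrictEquiv (V : Bimod k A B) : (rightRestrict k A B).obj V ≃ₗ[k] V :=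
  { AddEquiv.refl V with
    map_smul' := fun c x => tmul_algebraMap_smul V c x }

instance (V : Bimod k A B) [FiniteDimensional k V] :
    FiniteDimensional k ((rightRestrict k A B).obj V) :=
  Module.Finite.equiv (rightRestrictEquiv V).symm

/-- The action of `b : B` on a bimodule, as an endomorphism of the underlying right module. -/
def leftEnd (V : Bimod k A B) (b : B) :
    (rightRestrict k A B).obj V →ₗ[Aᵐᵒᵖ] (rightRestrict k A B).obj V where
  toFun x := ((b ⊗ₜ[k] (1 : Aᵐᵒᵖ) • (show V from x) : V))
  map_add' x y := smul_add (b ⊗ₜ[k] (1 : Aᵐᵒᵖ)) (show V from x) (show V from y)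
  map_smul' a x := by
    change b ⊗ₜ[k] (1 : Aᵐᵒᵖ) • ((1 : B) ⊗ₜ[k] a • (show V from x)) =
      (1 : B) ⊗ₜ[k] a • (b ⊗ₜ[k] (1 : Aᵐᵒᵖ) • (show V from x))
    rw [← mul_smul, ← mul_smul]
    simp

lemma leftEnd_idempotent (V : Bimod k A B) {b : B} (hb : IsIdempotentElem b)
    (x : (rightRestrict k A B).obj V) : leftEnd V b (leftEnd V b x) = leftEnd V b x := by
  change b ⊗ₜ[k] (1 : Aᵐᵒᵖ) • (b ⊗ₜ[k] (1 : Aᵐᵒᵖ) • (show V from x)) =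
    b ⊗ₜ[k] (1 : Aᵐᵒᵖ) • (show V from x)
  rw [← mul_smul, Algebra.TensorProduct.tmul_mul_tmul, hb.eq, one_mul]

lemma finrank_range_leftEnd (V : Bimod k A B) (b : B) (a : A) :
    Module.finrank k (LinearMap.range ((leftEnd V b).restrictScalars k ∘ₗ
      Algebra.lsmul k k ((rightRestrict k A B).obj V) (op a))) = rangeDim k (b ⊗ₜ[k] op a) V :=
  finrank_range_of_equiv (rightRestrictEquiv V) _ _ fun x => by
    change b ⊗ₜ[k] (1 : Aᵐᵒᵖ) • ((1 : B) ⊗ₜ[k] op a • (show V from x)) =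
      b ⊗ₜ[k] op a • (show V from x)
    rw [← mul_smul, Algebra.TensorProduct.tmul_mul_tmul, mul_one, one_mul]

variable (Q : CochainComplex (Bimod k A B) ℤ) (N : CochainComplex (Bimod k A C) ℤ)

lemma hom_tmul_smul_apply (n : ℤ) (c : C) (b : B) (z : HomCochain Q N n) (p q : ℤ)
    (h : p + n = q) (x : Q.X p) :
    (((c ⊗ₜ[k] op b) • z : HomCochain Q N n).v p q h).hom x =
      leftEnd (N.X q) c ((z.v p q h).hom (leftEnd (Q.X p) b x)) := by
  rw [hom_tmul_smul, Cochain.comp_zero_cochain_v, Cochain.zero_cochain_comp_v, Cochain.ofHom_v,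
    Cochain.ofHom_v]
  rfl

/-- The component of a cochain, as a `k`-linear map. -/
def homCochainComponent (n p q : ℤ) (h : p + n = q) :
    (homComplex Q N).X n →ₗ[k] ((rightRestrict k A B).obj (Q.X p) →ₗ[Aᵐᵒᵖ]
      (rightRestrict k A C).obj (N.X q)) where
  toFun z := (Cochain.v (F := rightComplex Q) (G := rightComplex N) z p q h).hom
  map_add' z z' := rfl
  map_smul' c z := by
    refine LinearMap.ext fun x => ?_
    have h1 : (c • z : (homComplex Q N).X n) =
        (((algebraMap k C c ⊗ₜ[k] op (1 : B)) • (z : HomCochain Q N n) : HomCochain Q N n)) :=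
      congrArg (fun r : C ⊗[k] Bᵐᵒᵖ => (r • (z : HomCochain Q N n) : HomCochain Q N n))
        (Algebra.TensorProduct.algebraMap_apply c)
    have h2 := hom_tmul_smul_apply Q N n (algebraMap k C c) 1 z p q h x
    have h3 : leftEnd (Q.X p) 1 x = x := one_smul (B ⊗[k] Aᵐᵒᵖ) (show Q.X p from x)
    rw [h3] at h2
    refine (congrArg (fun w : HomCochain Q N n => (w.v p q h).hom x) h1).trans (h2.trans ?_)
    refine (algebraMap_tmul_smul (N.X q) c _).trans ?_
    exact ((rightRestrictEquiv (N.X q)).map_smul c _).symm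

/-- A cochain is determined by its components at the places where the source is nonzero. -/
def homCochainEquiv (n : ℤ) (s : Finset ℤ) (hs : ∀ p ∉ s, Subsingleton (Q.X p)) :
    (homComplex Q N).X n ≃ₗ[k] ∀ p : s, ((rightRestrict k A B).obj (Q.X p) →ₗ[Aᵐᵒᵖ]
      (rightRestrict k A C).obj (N.X (p + n))) :=
  LinearEquiv.ofBijective (LinearMap.pi fun p : s => homCochainComponent Q N n p (p + n) rfl) (by
    classical
    constructor
    · intro z z' h
      refine Cochain.ext (F := rightComplex Q) (G := rightComplex N) z z' fun p q hpq => ?_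
      subst hpq
      by_cases hp : p ∈ s
      · exact ModuleCat.hom_ext (congrFun h ⟨p, hp⟩)
      · have := hs p hp
        refine ModuleCat.hom_ext (LinearMap.ext fun (x : Q.X p) => ?_)
        rw [Subsingleton.elim x 0]
        exact (map_zero _).trans (map_zero _).symm
    · intro y
      -- The data `y` covers only the target degree `p + n`; `eqToHom` transports it to any `q`
      -- equal to `p + n`, and is the identity at the component that is checked.
      refine ⟨(Cochain.mk fun p q hpq => if hp : p ∈ s then
        ModuleCat.ofHom (X := (rightRestrict k A B).obj (Q.X p))
          (Y := (rightRestrict k A C).obj (N.X (p + n))) (y ⟨p, hp⟩) ≫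
            eqToHom (by rw [← hpq]; rfl) else 0 : HomCochain Q N n), ?_⟩
      funext ⟨p, hp⟩
      change (ModuleCat.Hom.hom (dite _ _ _)) = _
      rw [dif_pos hp]
      rfl)

/-- The map `z ↦ c z b` on `Hom_A(V, W)`. -/
def homCorner (V : Bimod k A B) (W : Bimod k A C) (b : B) (c : C) :
    ((rightRestrict k A B).obj V →ₗ[Aᵐᵒᵖ] (rightRestrict k A C).obj W) →ₗ[k]
      ((rightRestrict k A B).obj V →ₗ[Aᵐᵒᵖ] (rightRestrict k A C).obj W) where
  toFun z := leftEnd W c ∘ₗ z ∘ₗ leftEnd V b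
  map_add' z z' := by rw [LinearMap.add_comp, LinearMap.comp_add]
  map_smul' r z := LinearMap.ext fun x => (leftEnd W c).map_smul_of_tower r _

/-- The images of left multiplication by `f_i` and `g_j` are right modules whose dimension vectors
are column `i` of `dm V` and column `j` of `dm W`. -/
theorem IsDualFamily.finrank_range_homCorner [FiniteDimensional k A] {n m p : ℕ} {e : Fin n → A}
    {χ : Fin n → A →ₐ[k] k} (hχ : IsDualFamily e χ) (he : ∀ s, IsIdempotentElem (e s))
    (hC : IsUnit (cartanMatrix k e).det) {f : Fin m → B} {g : Fin p → C}
    (hf : ∀ i, IsIdempotentElem (f i)) (hg : ∀ j, IsIdempotentElem (g j))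
    (V : Bimod k A B) (W : Bimod k A C) [FiniteDimensional k V] [FiniteDimensional k W]
    (hV : Module.Projective Aᵐᵒᵖ ((rightRestrict k A B).obj V)) (i : Fin m) (j : Fin p) :
    (Module.finrank k (LinearMap.range (homCorner V W (f i) (g j))) : ℤ) =
      ((dimMatrix f e V).transpose * ((cartanMatrix k e)⁻¹).transpose * dimMatrix g e W) i j := by
  rw [hχ.finrank_range_hom he hC (leftEnd V (f i)) (leftEnd W (g j)) (leftEnd_idempotent V (hf i))
    (leftEnd_idempotent W (hg j)) _ fun _ _ => rfl]
  simp_rw [finrank_range_leftEnd]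
  rw [← Matrix.transpose_mul]
  rfl

lemma dimMatrix_homComplex {m p : ℕ} (f : Fin m → B) (g : Fin p → C)
    [∀ l, FiniteDimensional k (Q.X l)] [∀ l, FiniteDimensional k (N.X l)]
    (s : Finset ℤ) (hs : ∀ l ∉ s, Subsingleton (Q.X l)) (l : ℤ) (i : Fin m) (j : Fin p) :
    dimMatrix g f ((homComplex Q N).X l) i j = ∑ q ∈ s,
      (Module.finrank k (LinearMap.range (homCorner (Q.X q) (N.X (q + l)) (f i) (g j))) : ℤ) := by
  have hfd : ∀ q r, FiniteDimensional k ((rightRestrict k A B).obj (Q.X q) →ₗ[Aᵐᵒᵖ]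
      (rightRestrict k A C).obj (N.X r)) := fun q r => finiteDimensional_hom
  rw [← Finset.sum_coe_sort s, ← Nat.cast_sum, ← finrank_range_pi
    (fun q : s => homCorner (Q.X q) (N.X (q + l)) (f i) (g j))
    (LinearMap.pi fun q => homCorner (Q.X q) (N.X (q + l)) (f i) (g j) ∘ₗ LinearMap.proj q)
    fun _ _ => rfl]
  refine congrArg Nat.cast (finrank_range_of_equiv (homCochainEquiv Q N l s hs) _ _ fun z => ?_)
  funext q
  exact LinearMap.ext fun x => hom_tmul_smul_apply Q N l (g j) (f i) z q (q + l) rfl x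

lemma finiteDimensional_homComplex
    [∀ l, FiniteDimensional k (Q.X l)] [∀ l, FiniteDimensional k (N.X l)]
    (s : Finset ℤ) (hs : ∀ l ∉ s, Subsingleton (Q.X l)) (l : ℤ) :
    FiniteDimensional k ((homComplex Q N).X l) := by
  have hfd : ∀ q r, FiniteDimensional k ((rightRestrict k A B).obj (Q.X q) →ₗ[Aᵐᵒᵖ]
      (rightRestrict k A C).obj (N.X r)) := fun q r => finiteDimensional_hom
  exact Module.Finite.equiv (homCochainEquiv Q N l s hs).symm

lemma subsingleton_homComplex (l : ℤ)
    (h : ∀ q, Subsingleton (Q.X q) ∨ Subsingleton (N.X (q + l))) :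
    Subsingleton ((homComplex Q N).X l) := by
  refine ⟨fun z z' => Cochain.ext (F := rightComplex Q) (G := rightComplex N) z z'
    fun p q hpq => ModuleCat.hom_ext (LinearMap.ext fun (x : Q.X p) => ?_)⟩
  subst hpq
  rcases h p with h | h
  · rw [Subsingleton.elim x 0]
    exact (map_zero _).trans (map_zero _).symm
  · exact h.elim _ _

end HomDimension

/-! ### Resolutions of bounded complexes by bimodules that are projective on the right -/

section Resolution

open CochainComplex

variable (k : Type u) [Field k] (R : Type u) [Ring R] [Algebra k R]

/-- The functor sending an `R`-module to the free `R`-module on its underlying vector space. -/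
def freeCover : ModuleCat.{u} R ⥤ ModuleCat.{u} R where
  obj V := ModuleCat.of R (R ⊗[k] V)
  map φ := ModuleCat.ofHom ((φ.hom.restrictScalars k).baseChange R)
  map_id V := ModuleCat.hom_ext (TensorProduct.AlgebraTensorModule.ext fun r v => rfl)
  map_comp φ ψ := ModuleCat.hom_ext (TensorProduct.AlgebraTensorModule.ext fun r v => rfl)

instance : (freeCover k R).PreservesZeroMorphisms where
  map_zero V W := ModuleCat.hom_ext (TensorProduct.AlgebraTensorModule.ext fun r v =>
    TensorProduct.tmul_zero W r)

/-- The multiplication `R ⊗ V → V`. -/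
def freeCoverCounit : freeCover k R ⟶ 𝟭 (ModuleCat.{u} R) where
  app V := ModuleCat.ofHom (TensorProduct.AlgebraTensorModule.lift
    { toFun := fun r => r • LinearMap.id (R := k) (M := V)
      map_add' := fun r s => add_smul r s _
      map_smul' := fun r s => mul_smul r s _ })
  naturality V W φ := ModuleCat.hom_ext (TensorProduct.AlgebraTensorModule.ext fun r v =>
    (φ.hom.map_smul r v).symm)

lemma freeCoverCounit_surjective (V : ModuleCat.{u} R) :
    Function.Surjective ((freeCoverCounit k R).app V).hom :=
  fun v => ⟨(1 : R) ⊗ₜ[k] v, one_smul R v⟩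

lemma finiteDimensional_freeCover [FiniteDimensional k R] (V : ModuleCat.{u} R)
    [FiniteDimensional k V] : FiniteDimensional k ((freeCover k R).obj V) := by
  have : Module.Finite R ((freeCover k R).obj V) :=
    inferInstanceAs (Module.Finite R (R ⊗[k] V))
  exact Module.Finite.trans R _

instance projective_freeCover (V : ModuleCat.{u} R) : Projective ((freeCover k R).obj V) :=
  (IsProjective.iff_projective (R ⊗[k] V)).1 inferInstance

variable {k R}

/-- Two of the three vertical maps between the cone triangles are isomorphisms in the derived
category, hence so is the third. -/
lemma mappingCone_map_quasiIso {D : Type*} [Category* D] [Abelian D]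
    {K₁ K₂ L : CochainComplex D ℤ} (φ : K₂ ⟶ L) (a : K₁ ⟶ K₂) [QuasiIso a] :
    QuasiIso (mappingCone.map (a ≫ φ) φ a (𝟙 L) (Category.comp_id _)) := by
  let _ : HasDerivedCategory D := HasDerivedCategory.standard D
  rw [← DerivedCategory.isIso_Q_map_iff_quasiIso]
  exact Pretriangulated.isIso₃_of_isIso₁₂
    (DerivedCategory.Q.mapTriangle.map
      (mappingCone.triangleMap (a ≫ φ) φ a (𝟙 L) (Category.comp_id _)))
    (DerivedCategory.mappingCone_triangle_distinguished _)
    (DerivedCategory.mappingCone_triangle_distinguished _)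
    (inferInstanceAs (IsIso (DerivedCategory.Q.map a)))
    (inferInstanceAs (IsIso (DerivedCategory.Q.map (𝟙 L))))

/-- The terms of a mapping cone of complexes of modules. -/
def mappingConeXEquiv {K L : CochainComplex (ModuleCat.{u} R) ℤ} (φ : K ⟶ L) (l : ℤ) :
    (mappingCone φ).X l ≃ₗ[R] K.X (l + 1) × L.X l :=
  (HomologicalComplex.homotopyCofiber.XIsoBiprod φ l (l + 1) rfl ≪≫
    ModuleCat.biprodIsoProd _ _).toLinearEquiv

lemma finiteDimensional_mappingCone {K L : CochainComplex (ModuleCat.{u} R) ℤ} (φ : K ⟶ L) (l : ℤ)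
    [FiniteDimensional k (K.X (l + 1))] [FiniteDimensional k (L.X l)] :
    FiniteDimensional k ((mappingCone φ).X l) :=
  Module.Finite.equiv ((mappingConeXEquiv φ l).symm.restrictScalars k)

lemma rangeDim_mappingCone {K L : CochainComplex (ModuleCat.{u} R) ℤ} (φ : K ⟶ L) (l : ℤ)
    [FiniteDimensional k (K.X (l + 1))] [FiniteDimensional k (L.X l)] {r : R}
    (hr : IsIdempotentElem r) :
    rangeDim k r ((mappingCone φ).X l) = rangeDim k r (K.X (l + 1)) + rangeDim k r (L.X l) := by
  rw [rangeDim_congr r (mappingConeXEquiv φ l)]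
  exact rangeDim_of_exact hr (LinearMap.inl R _ _) (LinearMap.snd R _ _) LinearMap.inl_injective
    LinearMap.snd_surjective Function.Exact.inl_snd

lemma projective_map_mappingCone {E : Type*} [Category* E] [Abelian E]
    (F : ModuleCat.{u} R ⥤ E) [F.Additive]
    {K L : CochainComplex (ModuleCat.{u} R) ℤ} (φ : K ⟶ L) (l : ℤ)
    [Projective (F.obj (K.X (l + 1)))] [Projective (F.obj (L.X l))] :
    Projective (F.obj ((mappingCone φ).X l)) :=
  have := Limits.preservesBinaryBiproducts_of_preservesBiproducts F
  Projective.of_iso ((F.mapIso (HomologicalComplex.homotopyCofiber.XIsoBiprod φ l (l + 1) rfl) ≪≫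
    F.mapBiprod _ _).symm) inferInstance

lemma finsum_negOnePow_mul_shift (b : ℤ → ℤ) :
    ∑ᶠ l : ℤ, (l.negOnePow : ℤ) * b (l + 1) = -∑ᶠ l : ℤ, (l.negOnePow : ℤ) * b l := by
  rw [← finsum_neg_distrib, ← finsum_comp_equiv (Equiv.addRight (1 : ℤ))
    (f := fun l : ℤ => -((l.negOnePow : ℤ) * b l))]
  refine finsum_congr fun l => ?_
  simp [Int.negOnePow_succ]

lemma finite_support_negOnePow_mul_rangeDim (X : CochainComplex (ModuleCat.{u} R) ℤ) (r : R)
    (s : Set ℤ) (hs : s.Finite) (hX : ∀ l, l ∉ s → Subsingleton (X.X l)) :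
    (Function.support fun l : ℤ => (l.negOnePow : ℤ) * (rangeDim k r (X.X l) : ℤ)).Finite :=
  hs.subset fun l hl => by
    by_contra h
    have := hX l h
    exact hl (by simp [rangeDim_of_subsingleton])

end Resolution

/-! ### Finite resolutions by bimodules that are projective over `A`. -/

section Resolution

open CochainComplex

variable {k A B : Type u} [Field k] [Ring A] [Algebra k A] [Ring B] [Algebra k B]
  [FiniteDimensional k A] [FiniteDimensional k B]

/-- Induction on the bound for the projective dimension of the terms over `A`. Only projectivity
over `A` is demanded, since bimodules may have infinite projective dimension. The functorial free
cover gives an exact sequence `0 → K → FM → M → 0` of complexes whose terms `K^l` have smaller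
projective dimension over `A`. If `Q` resolves `K`, the cone of `Q ⟶ FM` resolves `M`. -/
theorem exists_projective_resolution (d : ℕ) :
    ∀ (M : CochainComplex (Bimod k A B) ℤ) (s : Set ℤ) (hs : s.Finite)
      (hM : ∀ l, l ∉ s → Subsingleton (M.X l)) (hfd : ∀ l, FiniteDimensional k (M.X l))
      (hpd : ∀ l, HasProjectiveDimensionLE ((rightRestrict k A B).obj (M.X l)) d),
    ∃ (Q : CochainComplex (Bimod k A B) ℤ) (q : Q ⟶ M) (t : Set ℤ), QuasiIso q ∧
      t.Finite ∧ (∀ l, l ∉ t → Subsingleton (Q.X l)) ∧ (∀ l, FiniteDimensional k (Q.X l)) ∧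
      (∀ l, Projective ((rightRestrict k A B).obj (Q.X l))) ∧
      ∀ r : B ⊗[k] Aᵐᵒᵖ, IsIdempotentElem r →
        ∑ᶠ l : ℤ, (l.negOnePow : ℤ) * (rangeDim k r (Q.X l) : ℤ) =
        ∑ᶠ l : ℤ, (l.negOnePow : ℤ) * (rangeDim k r (M.X l) : ℤ) := by
  induction d with
  | zero =>
    intro M s hs hM hfd hpd
    exact ⟨M, 𝟙 M, s, inferInstance, hs, hM, hfd, fun l =>
      (projective_iff_hasProjectiveDimensionLE_zero _).2 (hpd l), fun r hr => rfl⟩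
  | succ d ih =>
    intro M s hs hM hfd hpd
    let F := freeCover k (B ⊗[k] Aᵐᵒᵖ)
    let FM : CochainComplex (Bimod k A B) ℤ := (F.mapHomologicalComplex _).obj M
    let ε : FM ⟶ M :=
      { f := fun l => (freeCoverCounit k (B ⊗[k] Aᵐᵒᵖ)).app (M.X l)
        comm' := fun i j _ => ((freeCoverCounit k (B ⊗[k] Aᵐᵒᵖ)).naturality (M.d i j)).symm }
    have : ∀ l, Epi (ε.f l) := fun l =>
      (ModuleCat.epi_iff_surjective _).2 (freeCoverCounit_surjective k _ (M.X l))
    have hε : Epi ε := HomologicalComplex.epi_of_epi_f ε this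
    let S : ShortComplex (CochainComplex (Bimod k A B) ℤ) :=
      ShortComplex.mk (Limits.kernel.ι ε) ε (Limits.kernel.condition ε)
    have hS : S.ShortExact := { exact := ShortComplex.exact_kernel ε }
    have hSl := fun l => hS.map_of_exact (HomologicalComplex.eval (Bimod k A B) (.up ℤ) l)
    have hFfd : ∀ l, FiniteDimensional k (FM.X l) := fun l => finiteDimensional_freeCover k _ _
    have hinj : ∀ l, Function.Injective (S.f.f l).hom := fun l => (hSl l).moduleCat_injective_f
    have hsurj : ∀ l, Function.Surjective (S.g.f l).hom := fun l => (hSl l).moduleCat_surjective_g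
    have hex : ∀ l, Function.Exact (S.f.f l).hom (S.g.f l).hom := fun l =>
      (ShortComplex.ShortExact.moduleCat_exact_iff_function_exact _).1 (hSl l).exact
    have hFM : ∀ l, l ∉ s → Subsingleton (FM.X l) := fun l hl =>
      ModuleCat.subsingleton_of_isZero (F.map_isZero
        (ModuleCat.isZero_iff_subsingleton.2 (hM l hl)))
    have hK : ∀ l, l ∉ s → Subsingleton (S.X₁.X l) := fun l hl =>
      have := hFM l hl
      (hinj l).subsingleton
    have hKfd : ∀ l, FiniteDimensional k (S.X₁.X l) := fun l =>
      FiniteDimensional.of_injective ((S.f.f l).hom.restrictScalars k) (hinj l)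
    have hproj : ∀ l, Projective ((rightRestrict k A B).obj (FM.X l)) := fun l =>
      have : Projective (FM.X l) := projective_freeCover k _ (M.X l)
      (IsProjective.iff_projective ((rightRestrict k A B).obj (FM.X l))).1
        (projective_rightRestrict (FM.X l))
    have hKpd : ∀ l, HasProjectiveDimensionLE ((rightRestrict k A B).obj (S.X₁.X l)) d := fun l => by
      have := restrictScalars_preservesHomology
        (Algebra.TensorProduct.includeRight : Aᵐᵒᵖ →ₐ[k] B ⊗[k] Aᵐᵒᵖ).toRingHom
      have : Limits.PreservesFiniteLimits (rightRestrict k A B) :=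
        Functor.preservesFiniteLimits_of_preservesHomology _
      have : Limits.PreservesFiniteColimits (rightRestrict k A B) :=
        Functor.preservesFiniteColimits_of_preservesHomology _
      exact (((hSl l).map_of_exact (rightRestrict k A B)).hasProjectiveDimensionLT_X₃_iff d
        (hproj l)).1 (hpd l)
    obtain ⟨Q, q, t, hq, ht, hQt, hQfd, hQp, hQr⟩ := ih S.X₁ s hs hK hKfd hKpd
    -- The augmentation factors through the cone of `K ⟶ FM`, which is quasi-isomorphic to `M`.
    refine ⟨mappingCone (q ≫ S.f), mappingCone.map (q ≫ S.f) S.f q (𝟙 _) (Category.comp_id _) ≫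
      mappingCone.descShortComplex S, (fun l => l + 1) ⁻¹' t ∪ s, ?_, ?_, ?_, ?_, ?_, ?_⟩
    · have := mappingCone_map_quasiIso S.f q
      have := mappingCone.quasiIso_descShortComplex hS
      infer_instance
    · exact (ht.preimage ((add_left_injective (1 : ℤ)).injOn)).union hs
    · intro l hl
      simp only [Set.mem_union, Set.mem_preimage, not_or] at hl
      have := hQt _ hl.1
      have := hFM _ hl.2
      exact (mappingConeXEquiv (q ≫ S.f) l).toEquiv.subsingleton
    · intro l
      exact finiteDimensional_mappingCone _ l
    · intro l
      exact projective_map_mappingCone _ _ l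
    · intro r hr
      have h1 : ∀ l, (rangeDim k r ((mappingCone (q ≫ S.f)).X l) : ℤ) =
          rangeDim k r (Q.X (l + 1)) + rangeDim k r (FM.X l) := fun l => by
        rw [rangeDim_mappingCone (q ≫ S.f) l hr]
        push_cast
        rfl
      have h2 : ∀ l, (rangeDim k r (FM.X l) : ℤ) =
          rangeDim k r (S.X₁.X l) + rangeDim k r (M.X l) := fun l => by
        rw [← Nat.cast_add, ← rangeDim_of_exact hr (S.f.f l).hom (S.g.f l).hom (hinj l) (hsurj l)
          (hex l)]
      have hsQ := (finite_support_negOnePow_mul_rangeDim (k := k) Q r t ht hQt)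
      have hsK := (finite_support_negOnePow_mul_rangeDim (k := k) S.X₁ r s hs hK)
      have hsM := (finite_support_negOnePow_mul_rangeDim (k := k) M r s hs hM)
      have hsF := (finite_support_negOnePow_mul_rangeDim (k := k) FM r s hs hFM)
      have hsQ' : (Function.support fun l : ℤ => (l.negOnePow : ℤ) *
          (rangeDim k r (Q.X (l + 1)) : ℤ)).Finite := by
        refine (ht.preimage ((add_left_injective (1 : ℤ)).injOn)).subset fun l hl => ?_
        by_contra h
        have := hQt _ h
        exact hl (by simp [rangeDim_of_subsingleton])
      -- The shift by one makes `Q` contribute with a minus sign, so the total is `-χ(K) + χ(FM) =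
      -- χ(M)`.
      simp_rw [h1, mul_add]
      rw [finsum_add_distrib hsQ' hsF,
        finsum_negOnePow_mul_shift (fun l => (rangeDim k r (Q.X l) : ℤ)), hQr r hr]
      simp_rw [h2, mul_add]
      rw [finsum_add_distrib hsK hsM]
      ring

end Resolution

/-! ### The terms and the differential of `P ⊗_A N` -/

section TensorComplex

open CochainComplex HomologicalComplex

variable {k A B C : Type u} [Field k] [Ring A] [Algebra k A] [Ring B] [Algebra k B]
  [Ring C] [Algebra k C]

section Terms

variable (P : CochainComplex (Bimod k A B) ℤ) (N : CochainComplex (Bimod k C A) ℤ)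

/-- The inclusion of `P^p ⊗_A N^q` in `P ⊗_A N`. -/
def tensorInclusion (p q n : ℤ) (h : p + q = n) :
    BalancedTensor (P.X p) (N.X q) →ₗ[B ⊗[k] Cᵐᵒᵖ] (tensorComplex P N).X n :=
  (ιMapBifunctor P N (tensorBifunctor k A B C) (ComplexShape.up ℤ) p q n h).hom

variable {P N} in
/-- Constructor for linear maps from a term of `P ⊗_A N`. -/
def tensorComplexDesc {n : ℤ} {Z : Type u} [AddCommGroup Z] [Module (B ⊗[k] Cᵐᵒᵖ) Z]
    (φ : ∀ p q, p + q = n → (BalancedTensor (P.X p) (N.X q) →ₗ[B ⊗[k] Cᵐᵒᵖ] Z)) :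
    (tensorComplex P N).X n →ₗ[B ⊗[k] Cᵐᵒᵖ] Z :=
  (mapBifunctorDesc (K₁ := P) (K₂ := N) (F := tensorBifunctor k A B C)
    (c := ComplexShape.up ℤ) (j := n) (A := ModuleCat.of (B ⊗[k] Cᵐᵒᵖ) Z)
    fun p q h => ModuleCat.ofHom (φ p q h)).hom

variable {P N} in
lemma tensorComplexDesc_inclusion {n : ℤ} {Z : Type u} [AddCommGroup Z] [Module (B ⊗[k] Cᵐᵒᵖ) Z]
    (φ : ∀ p q, p + q = n → (BalancedTensor (P.X p) (N.X q) →ₗ[B ⊗[k] Cᵐᵒᵖ] Z)) (p q : ℤ)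
    (h : p + q = n) (t : BalancedTensor (P.X p) (N.X q)) :
    tensorComplexDesc φ (tensorInclusion P N p q n h t) = φ p q h t :=
  congrArg (fun z => (ModuleCat.Hom.hom z) t) (ι_mapBifunctorDesc (K₁ := P) (K₂ := N)
    (F := tensorBifunctor k A B C) (c := ComplexShape.up ℤ) (j := n)
    (A := ModuleCat.of (B ⊗[k] Cᵐᵒᵖ) Z) (fun p q h => ModuleCat.ofHom (φ p q h)) p q h)

variable {P N} in
lemma tensorComplex_linearMap_ext {n : ℤ} {Z : Type u} [AddCommGroup Z] [Module (B ⊗[k] Cᵐᵒᵖ) Z]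
    {φ ψ : (tensorComplex P N).X n →ₗ[B ⊗[k] Cᵐᵒᵖ] Z}
    (h : ∀ p q (h : p + q = n) t, φ (tensorInclusion P N p q n h t) =
      ψ (tensorInclusion P N p q n h t)) : φ = ψ :=
  ModuleCat.hom_ext_iff.1 (mapBifunctor.hom_ext (K₁ := P) (K₂ := N)
    (F := tensorBifunctor k A B C) (c := ComplexShape.up ℤ) (j := n)
    (Y := ModuleCat.of (B ⊗[k] Cᵐᵒᵖ) Z)
    (f := ModuleCat.ofHom (X := (tensorComplex P N).X n) φ)
    (g := ModuleCat.ofHom (X := (tensorComplex P N).X n) ψ)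
    fun p q hpq => ModuleCat.hom_ext (LinearMap.ext (h p q hpq)))

/-- The decomposition of the terms of `P ⊗_A N`. -/
def tensorComplexEquiv (n : ℤ) :
    (DirectSum {x : ℤ × ℤ // x.1 + x.2 = n}
      fun x => BalancedTensor (P.X x.1.1) (N.X x.1.2)) ≃ₗ[B ⊗[k] Cᵐᵒᵖ]
        (tensorComplex P N).X n :=
  LinearEquiv.ofLinearMap
    (DirectSum.toModule _ _ _ fun x => tensorInclusion P N x.1.1 x.1.2 n x.2)
    (tensorComplexDesc fun p q h => DirectSum.lof (B ⊗[k] Cᵐᵒᵖ) {x : ℤ × ℤ // x.1 + x.2 = n}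
        (fun x => BalancedTensor (P.X x.1.1) (N.X x.1.2)) ⟨(p, q), h⟩)
    (tensorComplex_linearMap_ext fun p q h t => by
      rw [LinearMap.comp_apply, tensorComplexDesc_inclusion, DirectSum.toModule_lof]
      rfl)
    (DirectSum.linearMap_ext _ fun x => LinearMap.ext fun t => by
      rw [LinearMap.comp_apply, LinearMap.comp_apply, DirectSum.toModule_lof,
        tensorComplexDesc_inclusion]
      rfl)

lemma tensorComplexEquiv_of (p q n : ℤ) (h : p + q = n) (t : BalancedTensor (P.X p) (N.X q)) :
    tensorComplexEquiv P N n (DirectSum.of (fun x : {x : ℤ × ℤ // x.1 + x.2 = n} =>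
      BalancedTensor (P.X x.1.1) (N.X x.1.2)) ⟨(p, q), h⟩ t) = tensorInclusion P N p q n h t :=
  DirectSum.toModule_lof _ _ _

variable {P N} in
-- Stated for additive maps because cochains of right `A`-modules do not induce bimodule maps on the
-- tensor complex.
lemma tensorComplex_addHom_ext {n : ℤ} {Z : Type*} [AddCommGroup Z]
    {φ ψ : (tensorComplex P N).X n →+ Z}
    (h : ∀ p q (h : p + q = n) v w, φ (tensorInclusion P N p q n h (balancedMk v w)) =
      ψ (tensorInclusion P N p q n h (balancedMk v w))) : φ = ψ := by
  have h1 : φ.comp (tensorComplexEquiv P N n).toAddEquiv.toAddMonoidHom =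
      ψ.comp (tensorComplexEquiv P N n).toAddEquiv.toAddMonoidHom := by
    refine DirectSum.addHom_ext fun x t => ?_
    obtain ⟨⟨p, q⟩, hx⟩ := x
    change φ (tensorComplexEquiv P N n _) = ψ (tensorComplexEquiv P N n _)
    rw [tensorComplexEquiv_of]
    induction t using balancedTensor_induction with
    | h0 => simp only [map_zero]
    | hmk v w => exact h p q hx v w
    | hadd x y hx hy => simp only [map_add, hx, hy]
  refine AddMonoidHom.ext fun x => ?_
  obtain ⟨y, rfl⟩ := (tensorComplexEquiv P N n).surjective x
  exact DFunLike.congr_fun h1 y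

lemma tensorComplex_d (p p' q q' n m : ℤ) (h : p + q = n) (hp : p + 1 = p') (hq : q + 1 = q')
    (hm : n + 1 = m) (v : P.X p) (w : N.X q) :
    ((tensorComplex P N).d n m).hom (tensorInclusion P N p q n h (balancedMk v w)) =
      tensorInclusion P N p' q m (by omega) (balancedMk ((P.d p p').hom v) w) +
        (p.negOnePow : ℤ) •
          tensorInclusion P N p q' m (by omega) (balancedMk v ((N.d q q').hom w)) := by
  have h1 : ιMapBifunctor P N (tensorBifunctor k A B C) (ComplexShape.up ℤ) p q n h ≫
      (tensorComplex P N).d n m =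
      ((tensorBifunctor k A B C).map (P.d p p')).app (N.X q) ≫
        ιMapBifunctor P N (tensorBifunctor k A B C) (ComplexShape.up ℤ) p' q m
          (show p' + q = m by omega) +
      p.negOnePow • (((tensorBifunctor k A B C).obj (P.X p)).map (N.d q q') ≫
        ιMapBifunctor P N (tensorBifunctor k A B C) (ComplexShape.up ℤ) p q' m
          (show p + q' = m by omega)) := by
    change _ ≫ (mapBifunctor P N (tensorBifunctor k A B C) (ComplexShape.up ℤ)).d n m = _
    rw [mapBifunctor.d_eq, Preadditive.comp_add, mapBifunctor.ι_D₁, mapBifunctor.ι_D₂,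
      mapBifunctor.d₁_eq _ _ _ _ (show (ComplexShape.up ℤ).Rel p p' from hp) q m
        (show p' + q = m by omega),
      mapBifunctor.d₂_eq _ _ _ _ p (show (ComplexShape.up ℤ).Rel q q' from hq) m
        (show p + q' = m by omega)]
    congr 1
    exact one_smul _ _
  exact congrArg (fun z => z.hom (balancedMk v w)) h1

end Terms

/-! ### The action of cochains on `P ⊗_A N` -/

section Cochain

open HomComplex

variable {V V' : Bimod k A B}

/-- The map `φ ⊗ 1` induced by a homomorphism `φ` of right `A`-modules. -/
def balancedMapLeft (φ : (rightRestrict k A B).obj V ⟶ (rightRestrict k A B).obj V')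
    (W : Bimod k C A) : BalancedTensor V W →ₗ[k] BalancedTensor V' W :=
  balancedMap ((rightRestrictEquiv V').toLinearMap ∘ₗ φ.hom.restrictScalars k ∘ₗ
      (rightRestrictEquiv V).symm.toLinearMap) LinearMap.id
    (fun v a => φ.hom.map_smul (op a) v) (fun a w => rfl)

variable {P Q : CochainComplex (Bimod k A B) ℤ} (N : CochainComplex (Bimod k C A) ℤ)

/-- A component of a cochain of right `A`-modules. -/
def cochainComponent {r : ℤ} (γ : Cochain (rightComplex P) (rightComplex Q) r) (p q : ℤ)
    (h : p + r = q) : P.X p →+ Q.X q :=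
  (γ.v p q h).hom.toAddMonoidHom

lemma cochainComponent_δ {r r' : ℤ} (hr : r + 1 = r')
    (γ : Cochain (rightComplex P) (rightComplex Q) r) (p p' q q' : ℤ) (h : p + r = q)
    (hp : p + 1 = p') (hq : q + 1 = q') (v : P.X p) :
    cochainComponent (δ r r' γ) p q' (by omega) v =
      (Q.d q q').hom (cochainComponent γ p q h v) -
        (r.negOnePow : ℤ) • cochainComponent γ p' q' (by omega) ((P.d p p').hom v) := by
  subst hr
  have h1 := congrArg (fun z => z.hom v) (δ_v r (r + 1) rfl γ p q' (by omega) q p' (by omega) hp)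
  refine h1.trans ?_
  rcases Int.units_eq_one_or r.negOnePow with h2 | h2
  · rw [Int.negOnePow_succ, h2]
    simp only [Units.val_one, one_smul, sub_eq_add_neg, Units.neg_smul]
    rfl
  · rw [Int.negOnePow_succ, h2]
    simp only [neg_neg, one_smul, Units.val_neg, Units.val_one, neg_smul, sub_neg_eq_add]
    rfl

/-- The map `γ ⊗ 1` on `P ⊗_A N` induced by a cochain `γ` of right `A`-modules. -/
def cochainTensor {r : ℤ} (γ : Cochain (rightComplex P) (rightComplex Q) r) (n m : ℤ)
    (h : n + r = m) : (tensorComplex P N).X n →+ (tensorComplex Q N).X m :=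
  (DirectSum.toAddMonoid fun x : {x : ℤ × ℤ // x.1 + x.2 = n} =>
    ((tensorInclusion Q N (x.1.1 + r) x.1.2 m (by have := x.2; omega)).toAddMonoidHom.comp
      (balancedMapLeft (γ.v x.1.1 (x.1.1 + r) rfl) (N.X x.1.2)).toAddMonoidHom)).comp
    (tensorComplexEquiv P N n).symm.toAddEquiv.toAddMonoidHom

lemma cochainTensor_inclusion {r : ℤ} (γ : Cochain (rightComplex P) (rightComplex Q) r) (n m : ℤ)
    (h : n + r = m) (p p' q : ℤ) (hp : p + r = p') (hn : p + q = n) (v : P.X p) (w : N.X q) :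
    cochainTensor N γ n m h (tensorInclusion P N p q n hn (balancedMk v w)) =
      tensorInclusion Q N p' q m (by omega)
        (balancedMk (cochainComponent γ p p' hp v) w) := by
  subst hp
  rw [← tensorComplexEquiv_of]
  change DirectSum.toAddMonoid _ ((tensorComplexEquiv P N n).symm _) = _
  rw [LinearEquiv.symm_apply_apply]
  exact DirectSum.toAddMonoid_of _ _ _

end Cochain

end TensorComplex

/-! ### Invariance of `P ⊗_A N` under homotopy equivalences over `A` -/

section TensorInvariance

open CochainComplex HomologicalComplex HomComplex

variable {k A B C : Type u} [Field k] [Ring A] [Algebra k A] [Ring B] [Algebra k B]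
  [Ring C] [Algebra k C]
variable {P Q : CochainComplex (Bimod k A B) ℤ} (N : CochainComplex (Bimod k C A) ℤ)

lemma balancedMk_neg_left {V : Bimod k A B} {W : Bimod k C A} (v : V) (w : W) :
    balancedMk (-v) w = -balancedMk v w := by
  rw [← neg_one_smul k v, balancedMk_smul_left, neg_one_smul]

/-- The graded Leibniz rule `d (γ ⊗ 1) = δγ ⊗ 1 + (-1)^r (γ ⊗ 1) d`. It makes homotopies over `A`
act on the tensor complex. -/
lemma cochainTensor_d {r r' : ℤ} (hr : r + 1 = r')
    (γ : Cochain (rightComplex P) (rightComplex Q) r)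
    (n n' m m' : ℤ) (h : n + r = m) (hn : n + 1 = n') (hm : m + 1 = m')
    (x : (tensorComplex P N).X n) :
    ((tensorComplex Q N).d m m').hom (cochainTensor N γ n m h x) =
      cochainTensor N (δ r r' γ) n m' (by omega) x +
        (r.negOnePow : ℤ) • cochainTensor N γ n' m' (by omega)
          (((tensorComplex P N).d n n').hom x) := by
  let L : (tensorComplex P N).X n →+ (tensorComplex Q N).X m' :=
    ((tensorComplex Q N).d m m').hom.toAddMonoidHom.comp (cochainTensor N γ n m h)
  let L' : (tensorComplex P N).X n →+ (tensorComplex Q N).X m' :=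
    cochainTensor N (δ r r' γ) n m' (by omega) +
        (r.negOnePow : ℤ) • (cochainTensor N γ n' m' (by omega)).comp
          ((tensorComplex P N).d n n').hom.toAddMonoidHom
  refine DFunLike.congr_fun (show L = L' from ?_) x
  refine tensorComplex_addHom_ext fun p q hpq v w => ?_
  change ((tensorComplex Q N).d m m').hom (cochainTensor N γ n m h _) =
    cochainTensor N (δ r r' γ) n m' (by omega) _ + (r.negOnePow : ℤ) •
      cochainTensor N γ n' m' (by omega) (((tensorComplex P N).d n n').hom _)
  rw [cochainTensor_inclusion N γ n m h p (p + r) q rfl hpq,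
    cochainTensor_inclusion N _ n m' _ p (p + r + 1) q (by omega) hpq,
    tensorComplex_d P N p (p + 1) q (q + 1) n n' hpq rfl rfl hn,
    tensorComplex_d Q N (p + r) (p + r + 1) q (q + 1) m m' (by omega) rfl rfl hm,
    map_add, map_zsmul,
    cochainTensor_inclusion N γ n' m' _ (p + 1) (p + r + 1) q (by omega) (by omega),
    cochainTensor_inclusion N γ n' m' _ p (p + r) (q + 1) rfl (by omega),
    cochainComponent_δ hr γ p (p + 1) (p + r) (p + r + 1) rfl rfl rfl, smul_add,
    sub_eq_add_neg, balancedMk_add_left, balancedMk_neg_left, map_add, map_neg,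
    Int.negOnePow_add]
  -- The differential of `N` enters with sign `(-1)^(p+r)` on the left and `(-1)^r (-1)^p` on the
  -- right; after fixing the parity of `r` the terms match.
  rcases Int.units_eq_one_or r.negOnePow with h2 | h2
  · simp only [h2, Units.val_one, one_smul, mul_one]
    abel
  · simp only [h2, Units.val_neg, Units.val_one, neg_smul, one_smul, mul_neg, mul_one,
      balancedMk_neg_left, map_neg]
    abel

/-- The map `α ⊗ 1 : P ⊗_A N ⟶ Q ⊗_A N` induced by a morphism of complexes of bimodules. -/
def tensorComplexMap (α : P ⟶ Q) : tensorComplex P N ⟶ tensorComplex Q N :=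
  mapBifunctorMap α (𝟙 N) (tensorBifunctor k A B C) (ComplexShape.up ℤ)

lemma tensorComplexMap_apply (α : P ⟶ Q) (n : ℤ) (x : (tensorComplex P N).X n) :
    ((tensorComplexMap N α).f n).hom x = cochainTensor N
      (Cochain.ofHom (((rightRestrict k A B).mapHomologicalComplex _).map α)) n n (add_zero n) x := by
  refine DFunLike.congr_fun (f := ((tensorComplexMap N α).f n).hom.toAddMonoidHom)
    (tensorComplex_addHom_ext fun p q hpq v w => ?_) x
  rw [cochainTensor_inclusion N _ n n _ p p q (add_zero p) hpq]
  refine (congrArg (fun z => z.hom (balancedMk v w)) (ι_mapBifunctorMap α (𝟙 N)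
    (tensorBifunctor k A B C) (ComplexShape.up ℤ) p q n hpq)).trans ?_
  rfl

lemma cochainTensor_comp {R : CochainComplex (Bimod k A B) ℤ}
    (φ : rightComplex P ⟶ rightComplex Q) (ψ : rightComplex Q ⟶ rightComplex R) (n : ℤ)
    (x : (tensorComplex P N).X n) :
    cochainTensor N (Cochain.ofHom (φ ≫ ψ)) n n (add_zero n) x =
      cochainTensor N (Cochain.ofHom ψ) n n (add_zero n)
        (cochainTensor N (Cochain.ofHom φ) n n (add_zero n) x) := by
  refine DFunLike.congr_fun (g := (cochainTensor N (Cochain.ofHom ψ) n n (add_zero n)).comp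
    (cochainTensor N (Cochain.ofHom φ) n n (add_zero n)))
    (tensorComplex_addHom_ext fun p q hpq v w => ?_) x
  rw [AddMonoidHom.comp_apply, cochainTensor_inclusion N _ n n _ p p q (add_zero p) hpq,
    cochainTensor_inclusion N _ n n _ p p q (add_zero p) hpq,
    cochainTensor_inclusion N _ n n _ p p q (add_zero p) hpq]
  simp only [cochainComponent, Cochain.ofHom_v, HomologicalComplex.comp_f, ModuleCat.hom_comp]
  rfl

lemma cochainTensor_add {r : ℤ} (γ γ' : Cochain (rightComplex P) (rightComplex Q) r) (n m : ℤ)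
    (h : n + r = m) (x : (tensorComplex P N).X n) :
    cochainTensor N (γ + γ') n m h x = cochainTensor N γ n m h x + cochainTensor N γ' n m h x := by
  refine DFunLike.congr_fun (g := cochainTensor N γ n m h + cochainTensor N γ' n m h)
    (tensorComplex_addHom_ext fun p q hpq v w => ?_) x
  rw [AddMonoidHom.add_apply, cochainTensor_inclusion N _ n m _ p (p + r) q rfl hpq,
    cochainTensor_inclusion N _ n m _ p (p + r) q rfl hpq,
    cochainTensor_inclusion N _ n m _ p (p + r) q rfl hpq, ← map_add, ← balancedMk_add_left]
  rfl

lemma cochainTensor_id (n : ℤ) (x : (tensorComplex P N).X n) :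
    cochainTensor N (Cochain.ofHom (𝟙 (rightComplex P))) n n (add_zero n) x = x := by
  refine DFunLike.congr_fun (g := AddMonoidHom.id _)
    (tensorComplex_addHom_ext fun p q hpq v w => ?_) x
  rw [cochainTensor_inclusion N _ n n _ p p q (add_zero p) hpq]
  simp only [cochainComponent, Cochain.ofHom_v, HomologicalComplex.id_f, ModuleCat.hom_id]
  rfl

/-- This is the Leibniz rule for `r = -1` and `δH = φ - 1`. In contrast with `Hom_A(-, N)`, no
degree-dependent sign has to be put on the homotopy. -/
lemma cochainTensor_homotopy {φ : rightComplex P ⟶ rightComplex P} (H : Homotopy φ (𝟙 _))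
    {l n m : ℤ} (h : l + 1 = n) (h' : n + 1 = m) (x : (tensorComplex P N).X n) :
    cochainTensor N (Cochain.ofHom φ) n n (add_zero n) x =
      ((tensorComplex P N).d l n).hom
        (cochainTensor N (Cochain.ofHomotopy H) n l (by omega) x) +
      cochainTensor N (Cochain.ofHomotopy H) m n (by omega)
        (((tensorComplex P N).d n m).hom x) + x := by
  rw [cochainTensor_d N (show (-1 : ℤ) + 1 = 0 by simp) _ n m l n _ h' h,
    δ_ofHomotopy, Int.negOnePow_neg, Int.negOnePow_one]
  have h1 := cochainTensor_add N (Cochain.ofHom φ - Cochain.ofHom (𝟙 (rightComplex P)))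
    (Cochain.ofHom (𝟙 (rightComplex P))) n n (add_zero n) x
  rw [sub_add_cancel, cochainTensor_id] at h1
  rw [h1]
  simp

lemma tensorComplexMap_quasiIso (α : P ⟶ Q)
    (e : HomotopyEquiv (rightComplex P) (rightComplex Q))
    (he : e.hom = ((rightRestrict k A B).mapHomologicalComplex _).map α) :
    QuasiIso (tensorComplexMap N α) := by
  refine quasiIso_of_additive_homotopyEquiv _
    (fun n => cochainTensor N (Cochain.ofHom e.inv) n n (add_zero n))
    (fun n m h y => ?_)
    (fun n m h => cochainTensor N (Cochain.ofHomotopy e.homotopyHomInvId) n m h)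
    (fun n m h => cochainTensor N (Cochain.ofHomotopy e.homotopyInvHomId) n m h) ?_ ?_
  · rw [cochainTensor_d N (zero_add 1) _ n m n m _ h h, δ_ofHom, Int.negOnePow_zero,
      Units.val_one, one_smul, right_eq_add]
    -- Additivity at `0 + 0` shows that the zero cochain acts by zero.
    have h1 := cochainTensor_add N (0 : Cochain (rightComplex Q) (rightComplex P) 1) 0 n m h y
    rwa [add_zero, left_eq_add] at h1
  · intro l n m h h' x
    rw [tensorComplexMap_apply, ← he, ← cochainTensor_comp]
    exact cochainTensor_homotopy N e.homotopyHomInvId h h' x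
  · intro l n m h h' x
    rw [tensorComplexMap_apply, ← he, ← cochainTensor_comp]
    exact cochainTensor_homotopy N e.homotopyInvHomId h h' x

end TensorInvariance

/-! ### Dimensions of the terms of `P ⊗_A N` -/

section TensorDimension

variable {k A B C : Type u} [Field k] [Ring A] [Algebra k A] [Ring B] [Algebra k B]
  [Ring C] [Algebra k C]

section BalancedTensor

variable (V : Bimod k A B) (W : Bimod k C A)

/-- The left `A`-module underlying an `A`-`C`-bimodule. -/
abbrev leftRestrict : ModuleCat.{u} A :=
  (ModuleCat.restrictScalars
    (Algebra.TensorProduct.includeLeft : A →ₐ[k] A ⊗[k] Cᵐᵒᵖ).toRingHom).obj W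

/-- The identity, as a `k`-linear map from the underlying left module of a bimodule. -/
def leftRestrictEquiv : leftRestrict W ≃ₗ[k] W :=
  { AddEquiv.refl W with
    map_smul' := fun c x => algebraMap_tmul_smul W c x }

instance [FiniteDimensional k W] : FiniteDimensional k (leftRestrict W) :=
  Module.Finite.equiv (leftRestrictEquiv W).symm

/-- The transpose of the action of `c : C` on an `A`-`C`-bimodule. -/
def rightEndDual (c : C) :
    RightDual k (leftRestrict W) →ₗ[Aᵐᵒᵖ] RightDual k (leftRestrict W) where
  toFun φ := (show Module.Dual k (leftRestrict W) from φ) ∘ₗ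
    ((leftRestrictEquiv W).symm.toLinearMap ∘ₗ Algebra.lsmul k k W ((1 : A) ⊗ₜ[k] op c) ∘ₗ
      (leftRestrictEquiv W).toLinearMap)
  map_add' φ φ' := rfl
  map_smul' a φ := LinearMap.ext fun x => by
    change (show Module.Dual k (leftRestrict W) from φ)
        (a.unop ⊗ₜ[k] (1 : Cᵐᵒᵖ) • ((1 : A) ⊗ₜ[k] op c • (show W from x)) : W) =
      (show Module.Dual k (leftRestrict W) from φ)
        ((1 : A) ⊗ₜ[k] op c • (a.unop ⊗ₜ[k] (1 : Cᵐᵒᵖ) • (show W from x)) : W)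
    rw [← mul_smul, ← mul_smul]
    simp

variable {V W} in
/-- The homomorphism `v ↦ ξ(v ⊗ -)` attached to a linear form `ξ` on `V ⊗_A W`. -/
def balancedCurry (ξ : Module.Dual k (BalancedTensor V W)) :
    (rightRestrict k A B).obj V →ₗ[Aᵐᵒᵖ] RightDual k (leftRestrict W) where
  toFun v := ((ξ ∘ₗ balancedQuotient V W ∘ₗ TensorProduct.mk k V W v) ∘ₗ
    (leftRestrictEquiv W).toLinearMap : Module.Dual k (leftRestrict W))
  map_add' v v' := LinearMap.ext fun w =>
    (congrArg ξ (balancedMk_add_left (W := W) (show V from v) v' w)).trans (map_add ξ _ _)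
  map_smul' a v := LinearMap.ext fun w => congrArg ξ
    ((Submodule.Quotient.eq _).2 (Submodule.subset_span ⟨v, a.unop, w, rfl⟩))

/-- The adjunction between tensor products and duals. -/
def dualBalancedTensorEquiv : Module.Dual k (BalancedTensor V W) ≃ₗ[k]
    ((rightRestrict k A B).obj V →ₗ[Aᵐᵒᵖ] RightDual k (leftRestrict W)) := by
  refine LinearEquiv.ofBijective
    { toFun := balancedCurry
      map_add' := fun ξ ξ' => rfl
      map_smul' := fun r ξ => rfl } ⟨?_, ?_⟩
  · intro ξ ξ' h
    refine balancedTensor_ext fun v w => ?_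
    exact LinearMap.congr_fun
      (LinearMap.congr_fun h v : (_ : Module.Dual k (leftRestrict W)) = _) w
  · intro z
    let β : V →ₗ[k] W →ₗ[k] k :=
      { toFun := fun v => (show Module.Dual k (leftRestrict W) from z v) ∘ₗ
          (leftRestrictEquiv W).symm.toLinearMap
        map_add' := fun v v' => LinearMap.ext fun w =>
          LinearMap.congr_fun (map_add z v v' : (_ : Module.Dual k (leftRestrict W)) = _) w
        map_smul' := fun r v => LinearMap.ext fun w => LinearMap.congr_fun
          ((congrArg z ((rightRestrictEquiv V).symm.map_smul r v)).trans
            (LinearMap.map_smul_of_tower z r ((rightRestrictEquiv V).symm v)) :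
            (_ : Module.Dual k (leftRestrict W)) = _) w }
    refine ⟨(balancedRelations V W).liftQ (TensorProduct.lift β) ?_, ?_⟩
    · rw [balancedRelations, Submodule.span_le]
      rintro _ ⟨v, a, w, rfl⟩
      refine (map_sub _ _ _).trans (sub_eq_zero.2 ?_)
      rw [TensorProduct.lift.tmul, TensorProduct.lift.tmul]
      exact LinearMap.congr_fun (z.map_smul (op a) v : (_ : Module.Dual k (leftRestrict W)) = _) w
    · rfl


instance : IsScalarTower k (B ⊗[k] Cᵐᵒᵖ) (BalancedTensor V W) :=
  .of_algebraMap_smul fun (r : k) (t : BalancedTensor V W) => show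
      (algebraMap k (B ⊗[k] Cᵐᵒᵖ) r) • t = r • t by
    induction t using balancedTensor_induction with
    | h0 => rw [smul_zero, smul_zero]
    | hmk v w =>
      rw [Algebra.TensorProduct.algebraMap_apply, tensor_tmul_smul, algebraMap_tmul_smul,
        ← Algebra.TensorProduct.one_def, one_smul, balancedMk_smul_left]
    | hadd x y hx hy => rw [smul_add, smul_add, hx, hy]

instance [FiniteDimensional k V] [FiniteDimensional k W] :
    FiniteDimensional k (BalancedTensor V W) :=
  Module.Finite.of_surjective (balancedQuotient V W) (Submodule.mkQ_surjective _)

lemma finrank_range_rightEndDual (a : A) (c : C) :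
    Module.finrank k (LinearMap.range ((rightEndDual W c).restrictScalars k ∘ₗ
      Algebra.lsmul k k (RightDual k (leftRestrict W)) (op a))) =
        rangeDim k (a ⊗ₜ[k] op c) W := by
  let T := Algebra.lsmul k k W (a ⊗ₜ[k] op c)
  refine Eq.trans ?_ (LinearMap.finrank_range_dualMap_eq_finrank_range T)
  refine (finrank_range_of_equiv (leftRestrictEquiv W).dualMap T.dualMap _ fun φ => ?_).symm
  refine LinearMap.ext fun w => congrArg φ ?_
  change a ⊗ₜ[k] op c • (show W from w) =
    a ⊗ₜ[k] (1 : Cᵐᵒᵖ) • ((1 : A) ⊗ₜ[k] op c • (show W from w))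
  rw [← mul_smul, Algebra.TensorProduct.tmul_mul_tmul, mul_one, one_mul]

lemma rightEndDual_idempotent {c : C} (hc : IsIdempotentElem c)
    (φ : RightDual k (leftRestrict W)) :
    rightEndDual W c (rightEndDual W c φ) = rightEndDual W c φ := by
  refine LinearMap.ext fun w =>
    congrArg (show Module.Dual k (leftRestrict W) from φ) (?_ : (_ : W) = _)
  change (1 : A) ⊗ₜ[k] op c • ((1 : A) ⊗ₜ[k] op c • (show W from w)) =
    (1 : A) ⊗ₜ[k] op c • (show W from w)
  rw [← mul_smul, Algebra.TensorProduct.tmul_mul_tmul, ← op_mul, hc.eq, one_mul]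

/-- Dualizing preserves ranks and turns `V ⊗_A W` into `Hom_A(V, DW)`, with `g_j` acting on `DW` by
its transpose. The Hom formula applies, and `DW` has the same dimensions as `W`. -/
theorem IsDualFamily.rangeDim_balancedTensor [FiniteDimensional k A] {n m p : ℕ} {e : Fin n → A}
    {χ : Fin n → A →ₐ[k] k} (hχ : IsDualFamily e χ) (he : ∀ s, IsIdempotentElem (e s))
    (hC : IsUnit (cartanMatrix k e).det) {f : Fin m → B} {g : Fin p → C}
    (hf : ∀ i, IsIdempotentElem (f i)) (hg : ∀ j, IsIdempotentElem (g j))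
    [FiniteDimensional k V] [FiniteDimensional k W]
    (hV : Module.Projective Aᵐᵒᵖ ((rightRestrict k A B).obj V)) (i : Fin m) (j : Fin p) :
    (rangeDim k (f i ⊗ₜ[k] op (g j)) (BalancedTensor V W) : ℤ) =
      (dimMatrix e g W * (cartanMatrix k e)⁻¹ * dimMatrix f e V) j i := by
  let T : ((rightRestrict k A B).obj V →ₗ[Aᵐᵒᵖ] RightDual k (leftRestrict W)) →ₗ[k]
      ((rightRestrict k A B).obj V →ₗ[Aᵐᵒᵖ] RightDual k (leftRestrict W)) :=
    { toFun := fun z => rightEndDual W (g j) ∘ₗ z ∘ₗ leftEnd V (f i)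
      map_add' := fun z z' => by rw [LinearMap.add_comp, LinearMap.comp_add]
      map_smul' := fun r z => LinearMap.ext fun x =>
        (rightEndDual W (g j)).map_smul_of_tower r _ }
  have h := hχ.finrank_range_hom he hC (leftEnd V (f i)) (rightEndDual W (g j))
    (leftEnd_idempotent V (hf i)) (rightEndDual_idempotent W (hg j)) T fun _ _ => rfl
  simp_rw [finrank_range_leftEnd, finrank_range_rightEndDual] at h
  have h1 : rangeDim k (f i ⊗ₜ[k] op (g j)) (BalancedTensor V W) =
      Module.finrank k (LinearMap.range T) :=
    (LinearMap.finrank_range_dualMap_eq_finrank_range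
      (Algebra.lsmul k k (BalancedTensor V W) (f i ⊗ₜ[k] op (g j)))).symm.trans
      (finrank_range_of_equiv (dualBalancedTensorEquiv V W) _ T fun ξ => rfl)
  rw [h1, h, dotProduct_comm, Matrix.mul_assoc]
  rfl

end BalancedTensor

variable (Q : CochainComplex (Bimod k A B) ℤ) (N : CochainComplex (Bimod k C A) ℤ)

/-- A direct sum of modules which vanish off a finite set is a product. -/
def directSumEquivPi {R ι : Type*} [Ring R] [DecidableEq ι] (M : ι → Type*)
    [∀ i, AddCommGroup (M i)] [∀ i, Module R (M i)] (s : Finset ι)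
    (hs : ∀ i ∉ s, Subsingleton (M i)) : DirectSum ι M ≃ₗ[R] ∀ i : s, M i :=
  LinearEquiv.ofBijective (LinearMap.pi fun i : s => DirectSum.component R ι M i) (by
    constructor
    · intro x y h
      refine DFinsupp.ext fun i => ?_
      by_cases hi : i ∈ s
      · exact congrFun h ⟨i, hi⟩
      · exact (hs i hi).elim _ _
    · intro y
      refine ⟨DFinsupp.mk s fun i => y i, funext fun i => ?_⟩
      exact DFinsupp.mk_of_mem i.2)

lemma subsingleton_balancedTensor (V : Bimod k A B) (W : Bimod k C A)
    (h : Subsingleton V ∨ Subsingleton W) : Subsingleton (BalancedTensor V W) := by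
  refine subsingleton_of_forall_eq 0 fun t => ?_
  induction t using balancedTensor_induction with
  | h0 => rfl
  | hadd x y hx hy => rw [hx, hy, add_zero]
  | hmk v w =>
    rcases h with h | h
    · rw [Subsingleton.elim v ((0 : k) • v), balancedMk_smul_left, zero_smul]
    · rw [Subsingleton.elim w ((0 : k) • w), balancedMk_smul_right, zero_smul]

/-- The positions `(p, n - p)`, for `p` in a finite set. -/
def antidiagonalFinset (s : Finset ℤ) (n : ℤ) : Finset {x : ℤ × ℤ // x.1 + x.2 = n} :=
  s.map ⟨fun p => ⟨(p, n - p), add_sub_cancel p n⟩, fun p q h => congrArg (fun x => x.1.1) h⟩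

/-- The terms of `Q ⊗_A N` as finite products. -/
def tensorComplexEquivPi (s : Finset ℤ) (hs : ∀ p ∉ s, Subsingleton (Q.X p)) (n : ℤ) :
    (tensorComplex Q N).X n ≃ₗ[B ⊗[k] Cᵐᵒᵖ]
      ∀ x : antidiagonalFinset s n, BalancedTensor (Q.X x.1.1.1) (N.X x.1.1.2) :=
  (tensorComplexEquiv Q N n).symm.trans (directSumEquivPi _ _ fun x hx =>
    subsingleton_balancedTensor _ _ (Or.inl (hs _ fun h => hx (Finset.mem_map.2
      ⟨x.1.1, h, Subtype.ext (Prod.ext rfl (by have := x.2; simp [← this]))⟩))))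

lemma dimMatrix_tensorComplex {m p : ℕ} (f : Fin m → B) (g : Fin p → C)
    [∀ l, FiniteDimensional k (Q.X l)] [∀ l, FiniteDimensional k (N.X l)]
    (s : Finset ℤ) (hs : ∀ l ∉ s, Subsingleton (Q.X l)) (l : ℤ) (i : Fin m) (j : Fin p) :
    dimMatrix f g ((tensorComplex Q N).X l) j i = ∑ q ∈ s,
      (rangeDim k (f i ⊗ₜ[k] op (g j)) (BalancedTensor (Q.X q) (N.X (l - q))) : ℤ) := by
  have h1 : dimMatrix f g ((tensorComplex Q N).X l) j i =
      (rangeDim k (f i ⊗ₜ[k] op (g j)) ((tensorComplex Q N).X l) : ℤ) := rfl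
  have h2 := finrank_range_pi (k := k) (fun x : antidiagonalFinset s l =>
    (Algebra.lsmul k k (BalancedTensor (Q.X x.1.1.1) (N.X x.1.1.2)) (f i ⊗ₜ[k] op (g j)) :
      _ →ₗ[k] _))
    (Algebra.lsmul k k (∀ x : antidiagonalFinset s l,
      BalancedTensor (Q.X x.1.1.1) (N.X x.1.1.2)) (f i ⊗ₜ[k] op (g j))) fun _ _ => rfl
  rw [h1, rangeDim_congr _ (tensorComplexEquivPi Q N s hs l), rangeDim, h2,
    Finset.sum_coe_sort (antidiagonalFinset s l) (fun x => Module.finrank k (LinearMap.range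
      (Algebra.lsmul k k (BalancedTensor (Q.X x.1.1) (N.X x.1.2)) (f i ⊗ₜ[k] op (g j)) :
      _ →ₗ[k] _))), antidiagonalFinset, Finset.sum_map]
  push_cast
  rfl

lemma finiteDimensional_tensorComplex
    [∀ l, FiniteDimensional k (Q.X l)] [∀ l, FiniteDimensional k (N.X l)]
    (s : Finset ℤ) (hs : ∀ l ∉ s, Subsingleton (Q.X l)) (l : ℤ) :
    FiniteDimensional k ((tensorComplex Q N).X l) :=
  Module.Finite.equiv ((tensorComplexEquivPi Q N s hs l).restrictScalars k).symm

lemma subsingleton_tensorComplex (l : ℤ)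
    (h : ∀ q, Subsingleton (Q.X q) ∨ Subsingleton (N.X (l - q))) :
    Subsingleton ((tensorComplex Q N).X l) := by
  refine (tensorComplexEquiv Q N l).symm.toEquiv.subsingleton_congr.2
    ⟨fun x y => DFinsupp.ext fun i => ?_⟩
  obtain ⟨⟨p, q⟩, hpq⟩ := i
  obtain rfl : q = l - p := by simp only at hpq; omega
  exact (subsingleton_balancedTensor _ _ (h p)).elim _ _

end TensorDimension

/-! ### Dimension matrices of derived functors -/

section DimensionMatrix

/-- The alternating sum of a convolution is the product of alternating sums. The bijection `σ q`
sends the total degree to the degree in the second variable: `q + l` for Hom and `l - q` for the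
tensor product. Both have the parity required by `hσ`. -/
lemma finsum_negOnePow_bilinear {X Y Z : Type*} [AddCommGroup X] [AddCommGroup Y] [AddCommGroup Z]
    (β : X →+ Y →+ Z) (x : ℤ → X) (y : ℤ → Y) (s : Finset ℤ) (hx : ∀ q ∉ s, x q = 0)
    (hy : (Function.support y).Finite) (σ : ℤ → ℤ ≃ ℤ)
    (hσ : ∀ q l, l.negOnePow = q.negOnePow * (σ q l).negOnePow) :
    ∑ᶠ l : ℤ, (l.negOnePow : ℤ) • ∑ q ∈ s, β (x q) (y (σ q l)) =
      β (∑ᶠ q : ℤ, (q.negOnePow : ℤ) • x q) (∑ᶠ r : ℤ, (r.negOnePow : ℤ) • y r) := by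
  have hy' : (Function.support fun r : ℤ => (r.negOnePow : ℤ) • y r).Finite :=
    hy.subset fun r hr h => hr (show (r.negOnePow : ℤ) • y r = 0 by rw [h, smul_zero])
  simp_rw [Finset.smul_sum]
  rw [finsum_sum_comm, finsum_eq_sum_of_support_subset (s := s), map_sum, AddMonoidHom.finsetSum_apply]
  · refine Finset.sum_congr rfl fun q _ => ?_
    rw [AddMonoidHom.map_finsum _ hy', ← finsum_comp_equiv (σ q)
      (f := fun r : ℤ => β ((q.negOnePow : ℤ) • x q) ((r.negOnePow : ℤ) • y r))]
    refine finsum_congr fun l => ?_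
    rw [hσ q l, map_zsmul, map_zsmul, AddMonoidHom.smul_apply, smul_smul, Units.val_mul, mul_comm]
  · intro q hq
    by_contra h
    exact hq (by simp [hx q h])
  · intro q _
    refine (hy.preimage (σ q).injective.injOn).subset fun l hl => ?_
    by_contra h
    simp only [Set.mem_preimage, Function.mem_support, not_not] at h
    exact hl (by simp [h])

variable {k A B C : Type u} [Field k] [Ring A] [Algebra k A] [Ring B] [Algebra k B]
  [Ring C] [Algebra k C]

lemma dimMatrix_of_subsingleton {n m : ℕ} (f : Fin m → B) (e : Fin n → A) (V : Bimod k A B)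
    [Subsingleton V] : dimMatrix f e V = 0 := by
  ext i j
  exact congrArg Nat.cast (rangeDim_of_subsingleton (k := k) (V₁ := V) (f j ⊗ₜ[k] op (e i)))

lemma finite_support_dimMatrix {n m : ℕ} (f : Fin m → B) (e : Fin n → A) (X : ℤ → Bimod k A B)
    (s : Set ℤ) (hs : s.Finite) (hX : ∀ l, l ∉ s → Subsingleton (X l)) :
    (Function.support fun l => dimMatrix f e (X l)).Finite :=
  hs.subset fun l hl => by
    by_contra h
    have := hX l h
    exact hl (dimMatrix_of_subsingleton f e (X l))

lemma finsum_dimMatrix_apply {n m : ℕ} (f : Fin m → B) (e : Fin n → A) (X : ℤ → Bimod k A B)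
    (s : Set ℤ) (hs : s.Finite) (hX : ∀ l, l ∉ s → Subsingleton (X l)) (i : Fin n) (j : Fin m) :
    (∑ᶠ l : ℤ, (l.negOnePow : ℤ) • dimMatrix f e (X l)) i j =
      ∑ᶠ l : ℤ, (l.negOnePow : ℤ) * (rangeDim k (f j ⊗ₜ[k] op (e i)) (X l) : ℤ) :=
  (Matrix.entryAddMonoidHom ℤ i j).map_finsum
    ((finite_support_dimMatrix f e X s hs hX).subset
      (Function.support_smul_subset_right _ _))

/-- Only the cohomology of `X` matters, so `X` may be unbounded with infinite-dimensional terms, as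
happens for complexes built from an arbitrary resolution. -/
theorem cohomologyDimMatrix_eq_superDimMatrix {n m : ℕ} {f : Fin m → B} {e : Fin n → A}
    (hf : ∀ j, IsIdempotentElem (f j)) (he : ∀ i, IsIdempotentElem (e i))
    (X Y : CochainComplex (Bimod k A B) ℤ) (φ : ∀ l, X.homology l ≅ Y.homology l)
    [∀ l, FiniteDimensional k (Y.X l)] (s : Set ℤ) (hs : s.Finite)
    (hY : ∀ l, l ∉ s → Subsingleton (Y.X l)) :
    IsCohomologicallyFinite X ∧ cohomologyDimMatrix f e X = superDimMatrix f e Y := by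
  have hr : ∀ i j, IsIdempotentElem (f j ⊗ₜ[k] op (e i)) := fun i j => by
    rw [IsIdempotentElem, Algebra.TensorProduct.tmul_mul_tmul, (hf j).eq, ← op_mul, (he i).eq]
  have h0 : ∀ l, l ∉ s → Limits.IsZero (X.homology l) := fun l hl =>
    (ShortComplex.isZero_homology_of_isZero_X₂ (Y.sc l)
      (ModuleCat.isZero_iff_subsingleton.2 (hY l hl))).of_iso (φ l)
  have h1 : ∀ l, l ∉ s → Subsingleton (X.homology l) := fun l hl =>
    ModuleCat.isZero_iff_subsingleton.1 (h0 l hl)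
  refine ⟨⟨fun l => ?_, hs.subset fun l hl => by_contra fun h => hl (h0 l h)⟩, ?_⟩
  · have := (rangeDim_homology (k := k) Y (r := (1 : B ⊗[k] Aᵐᵒᵖ)) IsIdempotentElem.one (l - 1) l
      (l + 1) (by ring) rfl).1
    exact Module.Finite.equiv ((φ l).toLinearEquiv.restrictScalars k).symm
  · ext i j
    rw [cohomologyDimMatrix, superDimMatrix, finsum_dimMatrix_apply f e _ s hs h1,
      finsum_dimMatrix_apply f e _ s hs hY, ← finsum_rangeDim_homology Y (hr i j) s hs hY]
    exact finsum_congr fun l => by rw [rangeDim_congr _ (φ l).toLinearEquiv]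

lemma IsBoundedFiniteDimensional.exists_finset {M : CochainComplex (Bimod k A B) ℤ}
    (hM : IsBoundedFiniteDimensional M) :
    ∃ s : Finset ℤ, ∀ l, l ∉ s → Subsingleton (M.X l) := by
  obtain ⟨⟨a, b, ha, hb⟩, -⟩ := hM
  refine ⟨Finset.Icc a b, fun l hl => ModuleCat.isZero_iff_subsingleton.1 ?_⟩
  rw [Finset.mem_Icc, not_and_or, not_le, not_le] at hl
  rcases hl with hl | hl
  · exact M.isZero_of_isStrictlyGE a l hl
  · exact M.isZero_of_isStrictlyLE b l hl

variable [FiniteDimensional k A] [FiniteDimensional k B]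

/-- A complex that is projective on the right and computes the derived functors of a bounded
complex of finite dimensional bimodules. -/
theorem HProjResolution.exists_finite_replacement (hgl : HasFiniteGlobalDimension A)
    {M : CochainComplex (Bimod k A B) ℤ} (hM : IsBoundedFiniteDimensional M)
    (P : HProjResolution M) :
    ∃ (Q : CochainComplex (Bimod k A B) ℤ) (s : Finset ℤ) (α : P.complex ⟶ Q)
      (E : HomotopyEquiv (rightComplex P.complex) (rightComplex Q)),
      E.hom = ((rightRestrict k A B).mapHomologicalComplex _).map α ∧
      (∀ l, l ∉ s → Subsingleton (Q.X l)) ∧ (∀ l, FiniteDimensional k (Q.X l)) ∧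
      (∀ l, Module.Projective Aᵐᵒᵖ ((rightRestrict k A B).obj (Q.X l))) ∧
      ∀ {n m : ℕ} (e : Fin n → A) (f : Fin m → B), (∀ i, IsIdempotentElem (e i)) →
        (∀ j, IsIdempotentElem (f j)) → superDimMatrix f e Q = superDimMatrix f e M := by
  obtain ⟨s, hs⟩ := hM.exists_finset
  obtain ⟨d, hd⟩ := hgl
  obtain ⟨Q, q, t, hq, ht, hQt, hQfd, hQp, hQr⟩ := exists_projective_resolution d M s
    s.finite_toSet hs hM.2 fun l => hd _
  have hQp' : ∀ l, Module.Projective Aᵐᵒᵖ ((rightRestrict k A B).obj (Q.X l)) := fun l =>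
    (IsProjective.iff_projective _).2 (hQp l)
  obtain ⟨b, hb⟩ := ht.bddAbove
  -- An upper bound is what makes a complex of projectives K-projective, as the comparison over `A`
  -- requires.
  have : Q.IsStrictlyLE b := by
    rw [CochainComplex.isStrictlyLE_iff]
    exact fun i hi => ModuleCat.isZero_iff_subsingleton.2
      (hQt i fun h => (hb h).not_gt hi)
  obtain ⟨α, E, hE⟩ := P.exists_homotopyEquiv Q b hQp' q
  refine ⟨Q, ht.toFinset, α, E, hE, fun l hl => hQt l fun h => hl (ht.mem_toFinset.2 h), hQfd,
    hQp', fun e f he hf => ?_⟩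
  ext i j
  rw [superDimMatrix, superDimMatrix, finsum_dimMatrix_apply f e _ t ht hQt,
    finsum_dimMatrix_apply f e _ s s.finite_toSet hs]
  refine hQr _ ?_
  rw [IsIdempotentElem, Algebra.TensorProduct.tmul_mul_tmul, (hf j).eq, ← op_mul, (he i).eq]

end DimensionMatrix

/-! ### The formulas for terms, and their passage to cohomology. -/

section DimensionMatrix

open scoped Matrix

variable {k A B C : Type u} [Field k] [Ring A] [Algebra k A] [Ring B] [Algebra k B]
  [Ring C] [Algebra k C] [FiniteDimensional k A] {n m p : ℕ} {e : Fin n → A}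
  {f : Fin m → B} {g : Fin p → C} {χ : Fin n → A →ₐ[k] k}

theorem IsDualFamily.superDimMatrix_homComplex (hχ : IsDualFamily e χ)
    (he : ∀ s, IsIdempotentElem (e s)) (hC : IsUnit (cartanMatrix k e).det)
    (hf : ∀ i, IsIdempotentElem (f i)) (hg : ∀ j, IsIdempotentElem (g j))
    (Q : CochainComplex (Bimod k A B) ℤ) (N : CochainComplex (Bimod k A C) ℤ)
    [∀ l, FiniteDimensional k (Q.X l)] [∀ l, FiniteDimensional k (N.X l)]
    (hQ : ∀ l, Module.Projective Aᵐᵒᵖ ((rightRestrict k A B).obj (Q.X l)))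
    (s t : Finset ℤ) (hs : ∀ l ∉ s, Subsingleton (Q.X l)) (ht : ∀ l ∉ t, Subsingleton (N.X l)) :
    superDimMatrix g f (homComplex Q N) =
      (superDimMatrix f e Q)ᵀ * ((cartanMatrix k e)⁻¹)ᵀ * superDimMatrix g e N := by
  let β : Matrix (Fin n) (Fin m) ℤ →+ Matrix (Fin n) (Fin p) ℤ →+ Matrix (Fin m) (Fin p) ℤ :=
    AddMonoidHom.mk' (fun X => AddMonoidHom.mk' (fun Y => Xᵀ * ((cartanMatrix k e)⁻¹)ᵀ * Y)
      fun Y Y' => Matrix.mul_add _ _ _) fun X X' => AddMonoidHom.ext fun Y => by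
        simp [Matrix.transpose_add, Matrix.add_mul]
  have h := finsum_negOnePow_bilinear β (fun q => dimMatrix f e (Q.X q))
    (fun r => dimMatrix g e (N.X r)) s
    (fun q hq => by have := hs q hq; exact dimMatrix_of_subsingleton f e _)
    (finite_support_dimMatrix g e N.X t t.finite_toSet ht) (fun q => Equiv.addLeft q)
    fun q l => by
      rw [Equiv.coe_addLeft, Int.negOnePow_add, ← mul_assoc, Int.units_mul_self, one_mul]
  refine Eq.trans (finsum_congr fun l => congrArg _ ?_) h
  ext i j
  rw [dimMatrix_homComplex Q N f g s hs l i j, Matrix.sum_apply]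
  exact Finset.sum_congr rfl fun q _ => hχ.finrank_range_homCorner he hC hf hg _ _ (hQ q) i j

theorem IsDualFamily.superDimMatrix_tensorComplex (hχ : IsDualFamily e χ)
    (he : ∀ s, IsIdempotentElem (e s)) (hC : IsUnit (cartanMatrix k e).det)
    (hf : ∀ i, IsIdempotentElem (f i)) (hg : ∀ j, IsIdempotentElem (g j))
    (Q : CochainComplex (Bimod k A B) ℤ) (N : CochainComplex (Bimod k C A) ℤ)
    [∀ l, FiniteDimensional k (Q.X l)] [∀ l, FiniteDimensional k (N.X l)]
    (hQ : ∀ l, Module.Projective Aᵐᵒᵖ ((rightRestrict k A B).obj (Q.X l)))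
    (s t : Finset ℤ) (hs : ∀ l ∉ s, Subsingleton (Q.X l)) (ht : ∀ l ∉ t, Subsingleton (N.X l)) :
    superDimMatrix f g (tensorComplex Q N) =
      superDimMatrix e g N * (cartanMatrix k e)⁻¹ * superDimMatrix f e Q := by
  let β : Matrix (Fin n) (Fin m) ℤ →+ Matrix (Fin p) (Fin n) ℤ →+ Matrix (Fin p) (Fin m) ℤ :=
    AddMonoidHom.mk' (fun X => AddMonoidHom.mk' (fun Y => Y * (cartanMatrix k e)⁻¹ * X)
      fun Y Y' => by simp [Matrix.add_mul]) fun X X' => AddMonoidHom.ext fun Y => by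
        simp [Matrix.mul_add]
  have h := finsum_negOnePow_bilinear β (fun q => dimMatrix f e (Q.X q))
    (fun r => dimMatrix e g (N.X r)) s
    (fun q hq => by have := hs q hq; exact dimMatrix_of_subsingleton f e _)
    (finite_support_dimMatrix e g N.X t t.finite_toSet ht) (fun q => Equiv.subRight q)
    fun q l => by
      rw [Equiv.subRight_apply, Int.negOnePow_sub, mul_comm, mul_assoc, Int.units_mul_self,
        mul_one]
  refine Eq.trans (finsum_congr fun l => congrArg _ ?_) h
  ext j i
  rw [dimMatrix_tensorComplex Q N f g s hs l i j, Matrix.sum_apply]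
  exact Finset.sum_congr rfl fun q _ => hχ.rangeDim_balancedTensor _ _ he hC hf hg (hQ q) i j

variable [FiniteDimensional k B]

theorem IsDualFamily.cohomologyDimMatrix_rHom (hχ : IsDualFamily e χ)
    (he : ∀ s, IsIdempotentElem (e s)) (hC : IsUnit (cartanMatrix k e).det)
    (hgl : HasFiniteGlobalDimension A)
    (hf : ∀ i, IsIdempotentElem (f i)) (hg : ∀ j, IsIdempotentElem (g j))
    {M : CochainComplex (Bimod k A B) ℤ} {N : CochainComplex (Bimod k A C) ℤ}
    (hM : IsBoundedFiniteDimensional M) (hN : IsBoundedFiniteDimensional N)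
    (P : HProjResolution M) :
    IsCohomologicallyFinite (rHom P N) ∧ cohomologyDimMatrix g f (rHom P N) =
      (superDimMatrix f e M)ᵀ * ((cartanMatrix k e)⁻¹)ᵀ * superDimMatrix g e N := by
  obtain ⟨Q, s, α, E, hE, hs, hQfd, hQp, hQ⟩ := P.exists_finite_replacement hgl hM
  obtain ⟨t, ht⟩ := hN.exists_finset
  have hNfd := hN.2
  have hqi := homComplexPrecomp_quasiIso α N E hE
  have hfd := finiteDimensional_homComplex Q N s hs
  rw [← hQ e f he hf, ← hχ.superDimMatrix_homComplex he hC hf hg Q N hQp s t hs ht]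
  refine cohomologyDimMatrix_eq_superDimMatrix hg hf (rHom P N) (homComplex Q N)
    (fun l => (isoOfQuasiIsoAt (homComplexPrecomp α N) l).symm)
    -- Degree `l` of `Hom_A(Q, N)` involves `Q^q` and `N^(q+l)`, so it can be nonzero only for `l =
    -- r - q` with `q` and `r` in the two supports.
    (Finset.image₂ (fun q r => r - q) s t) (Finset.finite_toSet _) fun l hl =>
      subsingleton_homComplex Q N l fun q => ?_
  by_cases hq : q ∈ s
  · exact Or.inr (ht _ fun hr => hl (Finset.mem_coe.2
      (Finset.mem_image₂.2 ⟨q, hq, q + l, hr, add_sub_cancel_left q l⟩)))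
  · exact Or.inl (hs q hq)

theorem IsDualFamily.cohomologyDimMatrix_derivedTensor (hχ : IsDualFamily e χ)
    (he : ∀ s, IsIdempotentElem (e s)) (hC : IsUnit (cartanMatrix k e).det)
    (hgl : HasFiniteGlobalDimension A)
    (hf : ∀ i, IsIdempotentElem (f i)) (hg : ∀ j, IsIdempotentElem (g j))
    {M : CochainComplex (Bimod k A B) ℤ} {N : CochainComplex (Bimod k C A) ℤ}
    (hM : IsBoundedFiniteDimensional M) (hN : IsBoundedFiniteDimensional N)
    (P : HProjResolution M) :
    IsCohomologicallyFinite (derivedTensor P N) ∧ cohomologyDimMatrix f g (derivedTensor P N) =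
      superDimMatrix e g N * (cartanMatrix k e)⁻¹ * superDimMatrix f e M := by
  obtain ⟨Q, s, α, E, hE, hs, hQfd, hQp, hQ⟩ := P.exists_finite_replacement hgl hM
  obtain ⟨t, ht⟩ := hN.exists_finset
  have hNfd := hN.2
  have hqi := tensorComplexMap_quasiIso N α E hE
  have hfd := finiteDimensional_tensorComplex Q N s hs
  rw [← hQ e f he hf, ← hχ.superDimMatrix_tensorComplex he hC hf hg Q N hQp s t hs ht]
  refine cohomologyDimMatrix_eq_superDimMatrix hf hg (derivedTensor P N) (tensorComplex Q N)
    (fun l => isoOfQuasiIsoAt (tensorComplexMap N α) l)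
    (Finset.image₂ (fun q r => q + r) s t) (Finset.finite_toSet _) fun l hl =>
      subsingleton_tensorComplex Q N l fun q => ?_
  by_cases hq : q ∈ s
  · exact Or.inr (ht _ fun hr => hl (Finset.mem_coe.2
      (Finset.mem_image₂.2 ⟨q, hq, l - q, hr, add_sub_cancel q l⟩)))
  · exact Or.inl (hs q hq)

end DimensionMatrix

end BimoduleHRR

end

theorem theorem4 {k : Type u} [Field k]
    {A B C : Type u} [Ring A] [Algebra k A] [Ring B] [Algebra k B] [Ring C] [Algebra k C]
    [FiniteDimensional k A] [FiniteDimensional k B] [FiniteDimensional k C]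
    (hA : IsElementary k A) (hB : IsElementary k B) (hC : IsElementary k C)
    (hgl : HasFiniteGlobalDimension A)
    {n m p : ℕ} (e : Fin n → A) (f : Fin m → B) (g : Fin p → C)
    (he : IsCompletePrimitiveSet e) (hf : IsCompletePrimitiveSet f)
    (hg : IsCompletePrimitiveSet g) :
    IsUnit (cartanMatrix k e).det ∧
    (∀ (M : CochainComplex (Bimod k A B) ℤ) (N : CochainComplex (Bimod k A C) ℤ),
      IsBoundedFiniteDimensional M → IsBoundedFiniteDimensional N →
      ∀ P : HProjResolution M,
        IsCohomologicallyFinite (rHom P N) ∧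
        cohomologyDimMatrix g f (rHom P N) =
          (superDimMatrix f e M)ᵀ * ((cartanMatrix k e)⁻¹)ᵀ * superDimMatrix g e N) ∧
    (∀ (M : CochainComplex (Bimod k A B) ℤ) (N : CochainComplex (Bimod k C A) ℤ),
      IsBoundedFiniteDimensional M → IsBoundedFiniteDimensional N →
      ∀ P : HProjResolution M,
        IsCohomologicallyFinite (derivedTensor P N) ∧
        cohomologyDimMatrix f g (derivedTensor P N) =
          superDimMatrix e g N * (cartanMatrix k e)⁻¹ * superDimMatrix f e M) := by
  have hei := he.1.idem
  have hfi := hf.1.idem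
  have hgi := hg.1.idem
  obtain ⟨χ, hχ⟩ := exists_isDualFamily hA he
  have hdet := hχ.isUnit_det_cartanMatrix hei hgl
  exact ⟨hdet, fun M N hM hN P => hχ.cohomologyDimMatrix_rHom hei hdet hgl hfi hgi hM hN P,
    fun M N hM hN P => hχ.cohomologyDimMatrix_derivedTensor hei hdet hgl hfi hgi hM hN P⟩
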